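/- **Setting.** Let $(\Omega,\mathcal H,\overline{\mathbf E})$ be a sublinear expectation space: $\mathcal H$ is a linear space of real functions on $\Omega$ containing the constants, and $\overline{\mathbf E}:\mathcal H\to\mathbb R$ is monotone, constant preserving, sub-additive and positively homogeneous. Let $X_0,X_1,X_2,\dots$ be real functions on $\Omega$ such that $X_1,X_2,\dots$ are i.i.d. with $X_0$, i.e., with $\vec X_k=(X_1,\dots,X_k)$: - for each $k\ge 2$, $X_k$ is independent to $\vec X_{k-1}$: for all bounded continuous $\psi:\mathbb R^{k}\to\mathbb R$, $\psi(\vec X_{k-1},X_k)\in\mathcal H$ and $\overline{\mathbf E}[\psi(\vec X_{k-1},X_k)]=\overline{\mathbf E}\big[\overline{\mathbf E}[\psi(\vec x,X_k)]|_{\vec x=\vec X_{k-1}}\big]$ (the variable under the outer expectation on the right being in $\mathcal H$); - for each $k\ge1$ and all bounded continuous $\psi:\mathbb R\to\mathbb R$, $\psi(X_k),\psi(X_0)\in\mathcal H$ and $\overline{\mathbf E}[\psi(X_k)]=\overline{\mathbf E}[\psi(X_0)]$. Suppose $X_0,X_0^2\in\mathcal H$. Put $\underline\mu=-\overline{\mathbf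 E}[-X_0]$, $\overline\mu=\overline{\mathbf E}[X_0]$ and, for $\mu\in[\underline\mu,\overline\mu]$, $\underline\sigma^2(\mu)=-\overline{\mathbf E}[-(X_0-\mu)^2]$, $\overline\sigma^2(\mu)=\overline{\mathbf E}[(X_0-\mu)^2]$ (with $\underline\sigma(\mu),\overline\sigma(\mu)\ge0$), and suppose $\inf_{\mu\in[\underline\mu,\overline\mu]}\underline\sigma(\mu)>0$. For $Y\ge0$ on $\Omega$ put $\overline{\mathbf E}[Y]=\inf\{\overline{\mathbf E}[X]: X\ge Y,\ X\in\mathcal H\}\in[0,\infty]$, with $\inf\emptyset=\infty$. With $\xi_0(\mu)=(X_0-\mu)/\underline\sigma(\mu)$ let $$\gamma_p(C)=\sup_{\mu\in[\underline\mu,\overline\mu]}\overline{\mathbf E}\big[\min\{|\xi_0(\mu)|^p,\;C^{p-2}\xi_0^2(\mu)\}\big],\qquad \gamma_p=\sup_{\mu\in[\underline\mu,\overline\mu]}\overline{\mathbf E}\big[|\xi_0(\mu)|^p\big]\le\infty .$$ Let $n\ge1$. Let $\mathcal M_n$ be the set of all sequences $(\mu_i,\sigma_i)_{i=1}^n$ of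 pairs of continuous real functions on $\mathbb R^{i-1}$ (constants if $i=1$) with $\underline\mu\le\mu_i\le\overline\mu$ and $\underline\sigma(\mu_i)\le\sigma_i\le\overline\sigma(\mu_i)$ everywhere. For such a sequence let $S_n$ be the random broken line in $\mathbb C[0,1]$ with $S_n(0)=0$ and $$S_n\Big(\frac kn\Big)=\frac1{\sqrt n}\sum_{i=1}^k\frac{X_i-\mu_i(\vec X_{i-1})}{\sigma_i(\vec X_{i-1})},\qquad k=1,\dots,n,$$ linear between these points. Put $$\overline{\mathbf P}(S_n\in D)=\inf\{\overline{\mathbf E}\,\psi(\vec X_n):\ \psi:\mathbb R^n\to\mathbb R,\ \psi(\vec X_n)\in\mathcal H,\ \psi(\vec X_n)\ge\mathbf I(S_n\in D)\}.$$ Let $B$ be a Wiener process on $[0,1]$ (on a classical probability space), let $D^\varepsilon$ be the open $\varepsilon$-neighbourhood of $D\subset\mathbb C[0,1]$ in the uniform norm, and define the Prokhorov distance $$\overline\Pi(S_n,B)=\inf\Big\{\varepsilon>0:\ \sup_{D\subset\mathbb C[0,1]}\Big[\inf_{(\mu_i,\sigma_i)\in\mathcal M_n}\overline{\mathbf P}(S_n\in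 D)-\mathbf P(B\in D^\varepsilon)\Big]\le\varepsilon\Big\},$$ the supremum being over all subsets $D$, measurable or not. **Claim.** For all $n\ge1$ and $p\in[2,3]$, $$\overline\Pi(S_n,B)\le\frac{4.7\,\big(\gamma_p(\sqrt n)\big)^{1/(p+1)}}{n^{(p-2)/(2p+2)}}\le\frac{4.7\,\gamma_p^{1/(p+1)}}{n^{(p-2)/(2p+2)}} .$$ **Classical case.** Let $X_1,X_2,\dots$ be classical i.i.d. random variables with mean $\mu$ and variance $0<\sigma^2<\infty$, let $\xi_i=(X_i-\mu)/\sigma$, and let $S_n$ be the broken line with $S_n(0)=0$ and $S_n(k/n)=n^{-1/2}\sum_{i=1}^k\xi_i$ for $k=1,\dots,n$, linear between these points. Let $\Pi(S_n,B)$ be the infimum of all $\varepsilon>0$ such that $\mathbf P(S_n\in D)-\mathbf P(B\in D^\varepsilon)\le\varepsilon$ for all Borel sets $D\subset\mathbb C[0,1]$. Then for all $n\ge1$ and $p\in[2,3]$ $$\Pi(S_n,B)\le4.7\,\frac{\big(\mathbf E\min\{|\xi_1|^p,(\sqrt n)^{p-2}\xi_1^2\}\big)^{1/(p+1)}}{n^{(p-2)/(2p+2)}}\le4.7\,\frac{\big(\mathbf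 E\min\{|\xi_1|^p,\sqrt n\,\xi_1^2\}\big)^{1/(p+1)}}{n^{(p-2)/(2p+2)}}\le4.7\,\frac{\big(\mathbf E|\xi_1|^p\big)^{1/(p+1)}}{n^{(p-2)/(2p+2)}},$$ where the last moment may be infinite. -/

import Mathlib

open MeasureTheory ProbabilityTheory
open scoped ENNReal NNReal BoundedContinuousFunction

/-- A sublinear expectation space `(Ω, H, E)`: a linear space `H` of real functions on `Ω`
containing the constants, and a monotone, constant preserving, sub-additive and positively
homogeneous functional `E` on `H`. (For convenience `E` is a total function; only its values on
`H` carry a meaning, and only these are ever used.) -/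
structure SublinearExpectation (Ω : Type*) where
  H : Submodule ℝ (Ω → ℝ)
  E : (Ω → ℝ) → ℝ
  const_mem : ∀ c : ℝ, (fun _ => c) ∈ H
  mono : ∀ X ∈ H, ∀ Y ∈ H, (∀ ω, X ω ≤ Y ω) → E X ≤ E Y
  const : ∀ c : ℝ, E (fun _ => c) = c
  subadd : ∀ X ∈ H, ∀ Y ∈ H, E (X + Y) ≤ E X + E Y
  pos_homog : ∀ X ∈ H, ∀ c : ℝ, 0 ≤ c → E (c • X) = c * E X

/-- The vector `(X 0, …, X (k-1))` of the first `k` variables of a sequence. -/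
def firstVars {Ω : Type*} (X : ℕ → Ω → ℝ) (k : ℕ) (ω : Ω) : Fin k → ℝ := fun j => X j ω

/-- The broken line on `[0,1]` with value `0` at `0` and `x 0 + ⋯ + x (k-1)` at `k / n`, linear
in between: the `i`-th summand is `0` up to time `i / n`, is `x i` from time `(i + 1) / n` on, and
is linear between these times. -/
noncomputable def brokenLine {n : ℕ} (x : Fin n → ℝ) : C(unitInterval, ℝ) where
  toFun t := ∑ i : Fin n, x i * max 0 (min 1 ((n : ℝ) * (t : ℝ) - ((i : ℕ) : ℝ)))
  continuous_toFun := by fun_prop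

/-- `B` is a Wiener process on `[0,1]`, given as a random element of `C[0,1]`: its increments are
independent and `B(t)` has the law `N(0,t)` for each `t` (so that `B(0) = 0` a.s. and
`B(t) - B(s)` has the law `N(0,t-s)` for `s ≤ t`). -/
structure IsWienerProcess {Ω' : Type*} [MeasurableSpace Ω'] (P' : Measure Ω')
    (B : Ω' → C(unitInterval, ℝ)) : Prop where
  indep : HasIndepIncrements (fun (t : unitInterval) (ω : Ω') => B ω t) P'
  law : ∀ t : unitInterval,
    HasLaw (fun ω => B ω t) (gaussianReal 0 ⟨(t : ℝ), t.2.1⟩) P'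

namespace SublinearExpectation

variable {Ω : Type*} (𝔼 : SublinearExpectation Ω)

/-- The random element `Y` is independent to the random element `X`:
`E[ψ(X, Y)] = E[ E[ψ(x, Y)] at x = X ]` for all bounded continuous `ψ`, the variables under both
expectations being in `H`. (For a fixed `x`, `ψ(x, Y)` is in `H` too, by the first clause
applied to the function `(x', y) ↦ ψ(x, y)`.) -/
def IndepTo {α β : Type*} [TopologicalSpace α] [TopologicalSpace β]
    (Y : Ω → β) (X : Ω → α) : Prop :=
  ∀ ψ : (α × β) →ᵇ ℝ,
    (fun ω => ψ (X ω, Y ω)) ∈ 𝔼.H ∧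
    (fun ω => 𝔼.E (fun ω' => ψ (X ω, Y ω'))) ∈ 𝔼.H ∧
    𝔼.E (fun ω => ψ (X ω, Y ω)) = 𝔼.E (fun ω => 𝔼.E (fun ω' => ψ (X ω, Y ω')))

/-- `Y` and `X₀` are identically distributed: `E[ψ(Y)] = E[ψ(X₀)]` for all bounded
continuous `ψ`. -/
def SameDistrib (Y X₀ : Ω → ℝ) : Prop :=
  ∀ ψ : ℝ →ᵇ ℝ, (fun ω => ψ (Y ω)) ∈ 𝔼.H ∧ (fun ω => ψ (X₀ ω)) ∈ 𝔼.H ∧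
    𝔼.E (fun ω => ψ (Y ω)) = 𝔼.E (fun ω => ψ (X₀ ω))

/-- The sequence `X 0, X 1, …` (the `X_1, X_2, …` of the usual notation) is i.i.d. with `X₀`:
each variable but the first is independent to the vector of its predecessors, and each variable is
distributed as `X₀`. -/
def IIDWith (X₀ : Ω → ℝ) (X : ℕ → Ω → ℝ) : Prop :=
  (∀ i : ℕ, 1 ≤ i → 𝔼.IndepTo (X i) (firstVars X i)) ∧ ∀ i : ℕ, 𝔼.SameDistrib (X i) X₀

/-- The lower mean `-E[-X₀]`. -/
def lowerMean (X₀ : Ω → ℝ) : ℝ := -𝔼.E (-X₀)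

/-- The upper mean `E[X₀]`. -/
def upperMean (X₀ : Ω → ℝ) : ℝ := 𝔼.E X₀

/-- The interval between the lower and the upper mean. -/
def meanSet (X₀ : Ω → ℝ) : Set ℝ := Set.Icc (𝔼.lowerMean X₀) (𝔼.upperMean X₀)

/-- The lower standard deviation about `μ`: the square root of `-E[-(X₀ - μ)²]`. -/
noncomputable def lowerSD (X₀ : Ω → ℝ) (μ : ℝ) : ℝ :=
  √(-𝔼.E (fun ω => -((X₀ ω - μ) ^ 2)))

/-- The upper standard deviation about `μ`: the square root of `E[(X₀ - μ)²]`. -/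
noncomputable def upperSD (X₀ : Ω → ℝ) (μ : ℝ) : ℝ :=
  √(𝔼.E (fun ω => (X₀ ω - μ) ^ 2))

/-- The standing assumption: `X₀` and `X₀²` are in `H` and the infimum of the lower standard
deviations over all `μ` between the lower and the upper mean is positive (the supremum of the
upper standard deviations is then finite without further assumptions). -/
def NonDegenerate (X₀ : Ω → ℝ) : Prop :=
  X₀ ∈ 𝔼.H ∧ (fun ω => X₀ ω ^ 2) ∈ 𝔼.H ∧ 0 < sInf (𝔼.lowerSD X₀ '' 𝔼.meanSet X₀)

/-- The extension of the expectation to arbitrary non-negative functions `Y` on `Ω`: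
`inf {E[X] : X ≥ Y, X ∈ H}`, where `inf ∅ = ∞`. (For `Y ≥ 0` all these `E[X]` are `≥ 0`.) -/
noncomputable def upperE (Y : Ω → ℝ) : ℝ≥0∞ :=
  ⨅ (X : Ω → ℝ) (_ : X ∈ 𝔼.H) (_ : ∀ ω, Y ω ≤ X ω), ENNReal.ofReal (𝔼.E X)

/-- `ξ₀(μ) = (X₀ - μ) / (lower standard deviation about μ)`. -/
noncomputable def xiZero (X₀ : Ω → ℝ) (μ : ℝ) (ω : Ω) : ℝ := (X₀ ω - μ) / 𝔼.lowerSD X₀ μ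

/-- The truncated moment `γ_p(C) = sup_μ E[|ξ₀(μ)|^p ∧ C^(p-2) ξ₀(μ)²]`. -/
noncomputable def gammaTrunc (X₀ : Ω → ℝ) (p C : ℝ) : ℝ≥0∞ :=
  ⨆ μ ∈ 𝔼.meanSet X₀,
    𝔼.upperE (fun ω => min (|𝔼.xiZero X₀ μ ω| ^ p) (C ^ (p - 2) * 𝔼.xiZero X₀ μ ω ^ 2))

/-- The moment `γ_p = sup_μ E[|ξ₀(μ)|^p]`, possibly infinite. -/
noncomputable def gamma (X₀ : Ω → ℝ) (p : ℝ) : ℝ≥0∞ :=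
  ⨆ μ ∈ 𝔼.meanSet X₀, 𝔼.upperE (fun ω => |𝔼.xiZero X₀ μ ω| ^ p)

/-- Admissible centerings and scalings of length `n`: the `i`-th centering `m i` and the `i`-th
scaling `s i` are continuous functions of the preceding variables, `m i` lies between the lower
and the upper mean, and `s i` between the lower and the upper standard deviation about `m i`. -/
def Admissible (X₀ : Ω → ℝ) (n : ℕ) (m s : (i : Fin n) → (Fin (i : ℕ) → ℝ) → ℝ) : Prop :=
  ∀ i : Fin n, Continuous (m i) ∧ Continuous (s i) ∧ ∀ x : Fin (i : ℕ) → ℝ,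
    m i x ∈ 𝔼.meanSet X₀ ∧ s i x ∈ Set.Icc (𝔼.lowerSD X₀ (m i x)) (𝔼.upperSD X₀ (m i x))

/-- The upper probability of the event `A`: the infimum of the values `E[ψ(X_1,…,X_n)]` over all
`ψ` such that `ψ(X_1,…,X_n)` is in `H` and dominates the indicator of `A`. -/
noncomputable def upperProb (X : ℕ → Ω → ℝ) (n : ℕ) (A : Set Ω) : ℝ :=
  sInf {r : ℝ | ∃ ψ : (Fin n → ℝ) → ℝ, (fun ω => ψ (firstVars X n ω)) ∈ 𝔼.H ∧
    (∀ ω, A.indicator (fun _ => (1 : ℝ)) ω ≤ ψ (firstVars X n ω)) ∧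
    r = 𝔼.E (fun ω => ψ (firstVars X n ω))}

end SublinearExpectation

/-- The random broken line `S_n` with the centerings `m` and the scalings `s`: its value at `k / n`
is `n^(-1/2) ∑_{i ≤ k} (X_i - μ_i) / σ_i`, where `μ_i` and `σ_i` are the functions `m`, `s` of the
preceding variables. -/
noncomputable def controlledLine {Ω : Type*} (X : ℕ → Ω → ℝ) (n : ℕ)
    (m s : (i : Fin n) → (Fin (i : ℕ) → ℝ) → ℝ) (ω : Ω) : C(unitInterval, ℝ) :=
  brokenLine (fun i : Fin n =>
    (X i ω - m i (firstVars X i ω)) / s i (firstVars X i ω) / √(n : ℝ))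

/-- The difference `inf P̄(S_n ∈ D) - P(B ∈ D^ε)`, where the infimum is over all admissible
centerings and scalings, `P̄` is the upper probability and `D^ε` the open `ε`-neighbourhood
of `D`. -/
noncomputable def SublinearExpectation.prokhorovDefect {Ω Ω' : Type*} [MeasurableSpace Ω']
    (𝔼 : SublinearExpectation Ω) (X₀ : Ω → ℝ) (X : ℕ → Ω → ℝ) (n : ℕ)
    (P' : Measure Ω') (B : Ω' → C(unitInterval, ℝ)) (D : Set C(unitInterval, ℝ)) (ε : ℝ) : ℝ :=
  sInf {r : ℝ | ∃ m s : (i : Fin n) → (Fin (i : ℕ) → ℝ) → ℝ, 𝔼.Admissible X₀ n m s ∧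
      r = 𝔼.upperProb X n {ω | controlledLine X n m s ω ∈ D}}
    - P'.real {ω | B ω ∈ Metric.thickening ε D}

/-- The Prokhorov distance between `S_n` and `B` under the sublinear expectation: the infimum of
all `ε > 0` for which the supremum of the above differences over all sets `D ⊆ C[0,1]`,
measurable or not, is at most `ε`. -/
noncomputable def SublinearExpectation.prokhorovDist {Ω Ω' : Type*} [MeasurableSpace Ω']
    (𝔼 : SublinearExpectation Ω) (X₀ : Ω → ℝ) (X : ℕ → Ω → ℝ) (n : ℕ)
    (P' : Measure Ω') (B : Ω' → C(unitInterval, ℝ)) : ℝ :=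
  sInf {ε : ℝ | 0 < ε ∧ ∀ D : Set C(unitInterval, ℝ), 𝔼.prokhorovDefect X₀ X n P' B D ε ≤ ε}

/-- The classical variable normalized by its mean and standard deviation. -/
noncomputable def normalized {Ω : Type*} [MeasurableSpace Ω] (P : Measure Ω)
    (Y : Ω → ℝ) (ω : Ω) : ℝ :=
  (Y ω - ∫ ω', Y ω' ∂P) / √(Var[Y; P])

/-- The classical random broken line with the values `n^(-1/2) ∑_{i ≤ k} ξ_i` at `k / n`, where
`ξ_i` are the normalized variables. -/
noncomputable def classicalLine {Ω : Type*} [MeasurableSpace Ω] (P : Measure Ω)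
    (X : ℕ → Ω → ℝ) (n : ℕ) (ω : Ω) : C(unitInterval, ℝ) :=
  brokenLine (fun i : Fin n => normalized P (X i) ω / √(n : ℝ))

/-- The classical Prokhorov distance between random elements `S` and `B` of `C[0,1]`: the infimum of
all `ε > 0` such that `P(S ∈ D) - P(B ∈ D^ε) ≤ ε` for all Borel sets `D ⊆ C[0,1]`. -/
noncomputable def classicalProkhorovDist {Ω Ω' : Type*} [MeasurableSpace Ω] [MeasurableSpace Ω']
    (P : Measure Ω) (S : Ω → C(unitInterval, ℝ)) (P' : Measure Ω')
    (B : Ω' → C(unitInterval, ℝ)) : ℝ :=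
  sInf {ε : ℝ | 0 < ε ∧ ∀ D : Set C(unitInterval, ℝ), MeasurableSet[borel C(unitInterval, ℝ)] D →
    P.real {ω | S ω ∈ D} - P'.real {ω | B ω ∈ Metric.thickening ε D} ≤ ε}

/-- The bound `4.7 a^(1/(p+1)) / n^((p-2)/(2p+2))` in `[0, ∞]`. -/
noncomputable def rateBound (p : ℝ) (n : ℕ) (a : ℝ≥0∞) : ℝ≥0∞ :=
  ENNReal.ofReal 4.7 * a ^ (1 / (p + 1)) / (n : ℝ≥0∞) ^ ((p - 2) / (2 * p + 2))

/-! The proof is Lindeberg's exchange of steps, arranged so that no estimate for a single step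
depends on the number of coordinates of the path. It suffices to compare the values at the grid
times: the controlled walk against a Gaussian walk with steps `N(0, 1/n)`. Passing from grid values
to whole paths costs only the oscillation of `B` between grid times, which the exponential maximal
inequality controls.

The reward is a smoothed indicator of the grid values of `D`, a function of all positions, and an
exchange of steps needs value functions with bounded derivatives. Instead of smoothing in all
coordinates, the past is frozen in labels and only the present position is smoothed. In the game of
`gameValue` a player watches the Gaussian walk and, after each step, records a label within `δ = 3a`
of the position; the reward is evaluated at the labels. The comparison function is `tripleAvg a` of
the game value: its average over a present position perturbed by three independent uniform variables
on `[-a, a]`. The perturbation is at most `δ`, so the player may record the unperturbed position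
(`tripleAvg_gameValue_le`). The perturbation also commutes with the Gaussian step
(`tripleAvg_gameValue_succ`). Hence both the controlled step and the Gaussian step act on one and
the same function of one real variable, a triple average of a continuous function with values in
`[0, 1]`, whose second and third derivatives are at most `1/(2a²)` and `1/(2a³)`.

In the Taylor expansion of that function the centering is chosen by the sign of the first derivative
and the scaling by the sign of the second. Under the sublinear expectation the quadratic part then
does no worse than with mean `0` and variance `1/n`, which is what the Gaussian step yields.
Admissible controls must be continuous, so the signs are replaced by ramps of width `τ`, at a cost
that vanishes with `τ`. What remains is the Taylor remainder, bounded by the truncated moment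
(`min_cube_sq_le`), and the third Gaussian moment (`exists_step_bound`,
`exists_admissible_upperProb_le`).

In the end the labels are within `2δ` of the Gaussian path (`gameValue_le_walkValue`), so the game
is worth at most the probability that this path comes near the grid values of `D`. Fixed proportions
of the rate `ε = 4.7 t` for `δ`, the smoothing scale and the oscillation make the errors sum to at
most `ε` (`error_le_rate`). This uses that the truncated moment is bounded below, so a rate below
`1` forces `n` to be large. The classical case is the linear expectation, where the only control is
standardization. -/

/-! ### Smoothing by averages and the derivatives of the triple average -/

/-- The average of `h` over `[x - a, x + a]`. -/
noncomputable def symAvg (a : ℝ) (h : ℝ → ℝ) (x : ℝ) : ℝ := (∫ t in -a..a, h (x + t)) / (2 * a)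

/-- The symmetric difference quotient of `h` with step `a`. -/
noncomputable def symQuot (a : ℝ) (h : ℝ → ℝ) (x : ℝ) : ℝ := (h (x + a) - h (x - a)) / (2 * a)

/-- The three-fold average of `h`. -/
noncomputable def tripleAvg (a : ℝ) (h : ℝ → ℝ) : ℝ → ℝ := symAvg a (symAvg a (symAvg a h))

lemma continuous_symAvg_param {α : Type*} [TopologicalSpace α] (a : ℝ) {h : α → ℝ → ℝ}
    (hh : Continuous fun p : α × ℝ => h p.1 p.2) :
    Continuous fun p : α × ℝ => symAvg a (h p.1) p.2 := by
  unfold symAvg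
  refine Continuous.div_const ?_ _
  apply intervalIntegral.continuous_parametric_intervalIntegral_of_continuous'
  exact hh.comp (f := fun q : (α × ℝ) × ℝ => (q.1.1, q.1.2 + q.2)) (by fun_prop)

lemma continuous_symAvg (a : ℝ) {h : ℝ → ℝ} (hh : Continuous h) : Continuous (symAvg a h) := by
  have := continuous_symAvg_param (α := Unit) a (h := fun _ => h) (by fun_prop)
  exact this.comp (f := fun x : ℝ => ((), x)) (by fun_prop)

lemma continuous_tripleAvg_param {α : Type*} [TopologicalSpace α] (a : ℝ) {h : α → ℝ → ℝ}
    (hh : Continuous fun p : α × ℝ => h p.1 p.2) :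
    Continuous fun p : α × ℝ => tripleAvg a (h p.1) p.2 :=
  continuous_symAvg_param a (h := fun d => symAvg a (symAvg a (h d)))
    (continuous_symAvg_param a (h := fun d => symAvg a (h d)) (continuous_symAvg_param a hh))

lemma continuous_symQuot_param {α : Type*} [TopologicalSpace α] (a : ℝ) {h : α → ℝ → ℝ}
    (hh : Continuous fun p : α × ℝ => h p.1 p.2) :
    Continuous fun p : α × ℝ => symQuot a (h p.1) p.2 := by
  unfold symQuot
  have h1 := hh.comp (f := fun q : α × ℝ => (q.1, q.2 + a)) (by fun_prop)
  have h2 := hh.comp (f := fun q : α × ℝ => (q.1, q.2 - a)) (by fun_prop)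
  exact (h1.sub h2).div_const _

lemma hasDerivAt_symAvg {a : ℝ} {h : ℝ → ℝ} (hh : Continuous h) (x : ℝ) :
    HasDerivAt (symAvg a h) (symQuot a h x) x := by
  have e : symAvg a h = fun x => ((∫ t in (0 : ℝ)..(x + a), h t) - ∫ t in (0 : ℝ)..(x - a), h t) /
      (2 * a) := by
    funext y
    unfold symAvg
    rw [intervalIntegral.integral_comp_add_left (fun t => h t) y,
      intervalIntegral.integral_interval_sub_left (hh.intervalIntegrable _ _)
        (hh.intervalIntegrable _ _)]
    rfl
  rw [e]
  have key : ∀ u : ℝ, HasDerivAt (fun y => ∫ t in (0 : ℝ)..y, h t) (h u) u := fun u =>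
    intervalIntegral.integral_hasDerivAt_right (hh.intervalIntegrable _ _)
      (hh.stronglyMeasurableAtFilter _ _) hh.continuousAt
  exact (((key (x + a)).comp_add_const x a).sub ((key (x - a)).comp_sub_const x a)).div_const _

lemma hasDerivAt_symQuot {a : ℝ} {h h' : ℝ → ℝ} (hh : ∀ x, HasDerivAt h (h' x) x) (x : ℝ) :
    HasDerivAt (symQuot a h) (symQuot a h' x) x :=
  (((hh (x + a)).comp_add_const x a).sub ((hh (x - a)).comp_sub_const x a)).div_const _

lemma symAvg_mono {a : ℝ} (ha : 0 < a) {h₁ h₂ : ℝ → ℝ} (c₁ : Continuous h₁) (c₂ : Continuous h₂)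
    {x : ℝ} (h : ∀ t, |t| ≤ a → h₁ (x + t) ≤ h₂ (x + t)) : symAvg a h₁ x ≤ symAvg a h₂ x := by
  unfold symAvg
  gcongr
  refine intervalIntegral.integral_mono_on (by linarith)
    ((c₁.comp (continuous_const_add x)).intervalIntegrable _ _)
    ((c₂.comp (continuous_const_add x)).intervalIntegrable _ _) fun t ht => h t (abs_le.2 ht)

lemma symAvg_const {a : ℝ} (ha : 0 < a) (c x : ℝ) : symAvg a (fun _ => c) x = c := by
  unfold symAvg
  rw [intervalIntegral.integral_const, smul_eq_mul]
  field_simp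
  ring

lemma tripleAvg_mono {a : ℝ} (ha : 0 < a) {h₁ h₂ : ℝ → ℝ} (c₁ : Continuous h₁)
    (c₂ : Continuous h₂) {x : ℝ} (h : ∀ t, |t| ≤ 3 * a → h₁ (x + t) ≤ h₂ (x + t)) :
    tripleAvg a h₁ x ≤ tripleAvg a h₂ x := by
  refine symAvg_mono ha (continuous_symAvg a (continuous_symAvg a c₁))
    (continuous_symAvg a (continuous_symAvg a c₂)) fun r hr => ?_
  refine symAvg_mono ha (continuous_symAvg a c₁) (continuous_symAvg a c₂) fun s hs => ?_
  refine symAvg_mono ha c₁ c₂ fun t ht => ?_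
  rw [add_assoc, add_assoc]
  refine h _ ?_
  have := abs_add_le r (s + t)
  have := abs_add_le s t
  linarith

lemma tripleAvg_const {a : ℝ} (ha : 0 < a) (c x : ℝ) : tripleAvg a (fun _ => c) x = c := by
  have : symAvg a (fun _ => c) = fun _ => c := funext (symAvg_const ha c)
  unfold tripleAvg
  rw [this, this, this]

lemma symAvg_mem {a : ℝ} (ha : 0 < a) {h : ℝ → ℝ} (hc : Continuous h)
    (hb : ∀ x, h x ∈ Set.Icc (0 : ℝ) 1) (x : ℝ) : symAvg a h x ∈ Set.Icc (0 : ℝ) 1 := by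
  constructor
  · rw [← symAvg_const ha 0 x]
    exact symAvg_mono ha continuous_const hc fun t _ => (hb _).1
  · rw [← symAvg_const ha 1 x]
    exact symAvg_mono ha hc continuous_const fun t _ => (hb _).2

lemma tripleAvg_mem {a : ℝ} (ha : 0 < a) {h : ℝ → ℝ} (hc : Continuous h)
    (hb : ∀ x, h x ∈ Set.Icc (0 : ℝ) 1) (x : ℝ) : tripleAvg a h x ∈ Set.Icc (0 : ℝ) 1 :=
  symAvg_mem ha (continuous_symAvg a (continuous_symAvg a hc))
    (symAvg_mem ha (continuous_symAvg a hc) (symAvg_mem ha hc hb)) x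

/-- Averaging over an interval commutes with averaging over the translates by a random variable. -/
lemma symAvg_integral {a : ℝ} (ha : 0 < a) (γ : Measure ℝ) [IsProbabilityMeasure γ] {h : ℝ → ℝ}
    (hc : Continuous h) (hb : ∀ x, h x ∈ Set.Icc (0 : ℝ) 1) (x : ℝ) :
    symAvg a (fun y => ∫ η, h (y + η) ∂γ) x = ∫ η, symAvg a h (x + η) ∂γ := by
  unfold symAvg
  rw [integral_div]
  congr 1
  simp_rw [intervalIntegral.integral_of_le (by linarith : -a ≤ a)]
  rw [integral_integral_swap]
  · simp_rw [add_right_comm]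
  · refine Integrable.of_bound (C := 1) ?_ ?_
    · apply Continuous.aestronglyMeasurable
      simp only [Function.uncurry_def]
      fun_prop
    · refine Filter.Eventually.of_forall fun p => ?_
      simp only [Function.uncurry_def, Real.norm_eq_abs]
      exact abs_le.2 ⟨by linarith [(hb (x + p.1 + p.2)).1], (hb _).2⟩

lemma continuous_integral_add {α : Type*} [TopologicalSpace α] [FirstCountableTopology α]
    (γ : Measure ℝ) [IsProbabilityMeasure γ] {F : α → ℝ → ℝ}
    (hc : Continuous fun p : α × ℝ => F p.1 p.2) (hb : ∀ d x, F d x ∈ Set.Icc (0 : ℝ) 1) :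
    Continuous fun d => ∫ η, F d η ∂γ := by
  refine continuous_of_dominated (bound := fun _ => 1) (fun d => ?_) (fun d => ?_) (by simp) ?_
  · exact (hc.comp (f := fun η : ℝ => (d, η)) (by fun_prop)).aestronglyMeasurable
  · refine Filter.Eventually.of_forall fun η => abs_le.2 ⟨by linarith [(hb d η).1], (hb d η).2⟩
  · refine Filter.Eventually.of_forall fun η => ?_
    exact hc.comp (f := fun d => (d, η)) (by fun_prop)

lemma integrable_of_mem_Icc {γ : Measure ℝ} [IsProbabilityMeasure γ] {h : ℝ → ℝ}
    (hc : Continuous h) (hb : ∀ x, h x ∈ Set.Icc (0 : ℝ) 1) : Integrable h γ := by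
  refine Integrable.of_bound (C := 1) hc.aestronglyMeasurable ?_
  exact Filter.Eventually.of_forall fun η => abs_le.2 ⟨by linarith [(hb η).1], (hb η).2⟩

lemma integral_mem_Icc {γ : Measure ℝ} [IsProbabilityMeasure γ] {h : ℝ → ℝ}
    (hc : Continuous h) (hb : ∀ x, h x ∈ Set.Icc (0 : ℝ) 1) : ∫ η, h η ∂γ ∈ Set.Icc (0 : ℝ) 1 := by
  refine ⟨integral_nonneg fun x => (hb x).1, ?_⟩
  calc ∫ η, h η ∂γ ≤ ∫ _, (1 : ℝ) ∂γ :=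
        integral_mono (integrable_of_mem_Icc hc hb) (integrable_const _) fun x => (hb x).2
    _ = 1 := by simp

/-- Fubini, once for each average. It lets the smoothing perturbation be applied before or after a
random step. -/
lemma tripleAvg_integral {a : ℝ} (ha : 0 < a) (γ : Measure ℝ) [IsProbabilityMeasure γ] {h : ℝ → ℝ}
    (hc : Continuous h) (hb : ∀ x, h x ∈ Set.Icc (0 : ℝ) 1) (x : ℝ) :
    tripleAvg a (fun y => ∫ η, h (y + η) ∂γ) x = ∫ η, tripleAvg a h (x + η) ∂γ := by
  unfold tripleAvg
  have c1 := continuous_symAvg a hc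
  have b1 := symAvg_mem ha hc hb
  rw [funext (symAvg_integral ha γ hc hb), funext (symAvg_integral ha γ c1 b1),
    symAvg_integral ha γ (continuous_symAvg a c1) (symAvg_mem ha c1 b1)]

/-- First derivative of the three-fold average. -/
noncomputable def tripleDeriv (a : ℝ) (h : ℝ → ℝ) : ℝ → ℝ := symQuot a (symAvg a (symAvg a h))

/-- Second derivative of the three-fold average. -/
noncomputable def tripleDeriv₂ (a : ℝ) (h : ℝ → ℝ) : ℝ → ℝ := symQuot a (symQuot a (symAvg a h))

lemma continuous_tripleDeriv_param {α : Type*} [TopologicalSpace α] (a : ℝ) {h : α → ℝ → ℝ}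
    (hh : Continuous fun p : α × ℝ => h p.1 p.2) :
    Continuous fun p : α × ℝ => tripleDeriv a (h p.1) p.2 :=
  continuous_symQuot_param a (h := fun d => symAvg a (symAvg a (h d)))
    (continuous_symAvg_param a (h := fun d => symAvg a (h d)) (continuous_symAvg_param a hh))

lemma continuous_tripleDeriv₂_param {α : Type*} [TopologicalSpace α] (a : ℝ) {h : α → ℝ → ℝ}
    (hh : Continuous fun p : α × ℝ => h p.1 p.2) :
    Continuous fun p : α × ℝ => tripleDeriv₂ a (h p.1) p.2 :=
  continuous_symQuot_param a (h := fun d => symQuot a (symAvg a (h d)))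
    (continuous_symQuot_param a (h := fun d => symAvg a (h d)) (continuous_symAvg_param a hh))

lemma hasDerivAt_tripleAvg {a : ℝ} {h : ℝ → ℝ} (hc : Continuous h) (x : ℝ) :
    HasDerivAt (tripleAvg a h) (tripleDeriv a h x) x :=
  hasDerivAt_symAvg (continuous_symAvg a (continuous_symAvg a hc)) x

lemma hasDerivAt_tripleDeriv {a : ℝ} {h : ℝ → ℝ} (hc : Continuous h) (x : ℝ) :
    HasDerivAt (tripleDeriv a h) (tripleDeriv₂ a h x) x :=
  hasDerivAt_symQuot (hasDerivAt_symAvg (continuous_symAvg a hc)) x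

lemma hasDerivAt_tripleDeriv₂ {a : ℝ} {h : ℝ → ℝ} (hc : Continuous h) (x : ℝ) :
    HasDerivAt (tripleDeriv₂ a h) (symQuot a (symQuot a (symQuot a h)) x) x :=
  hasDerivAt_symQuot (hasDerivAt_symQuot (hasDerivAt_symAvg hc)) x

/-- The second derivative is a double difference quotient: an alternating sum of four numbers in
`[0, 1]`, hence in `[-2, 2]`, divided by `4a²`. -/
lemma tripleDeriv₂_mem {a : ℝ} (ha : 0 < a) {h : ℝ → ℝ} (hc : Continuous h)
    (hb : ∀ x, h x ∈ Set.Icc (0 : ℝ) 1) (x : ℝ) : |tripleDeriv₂ a h x| ≤ 1 / (2 * a ^ 2) := by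
  have b := symAvg_mem ha hc hb
  have e : tripleDeriv₂ a h x =
      (symAvg a h (x + a + a) - symAvg a h (x + a - a) -
        (symAvg a h (x - a + a) - symAvg a h (x - a - a))) / 2 * (1 / (2 * a ^ 2)) := by
    unfold tripleDeriv₂ symQuot
    field_simp
  rw [e, abs_mul, abs_of_pos (by positivity : 0 < 1 / (2 * a ^ 2))]
  refine mul_le_of_le_one_left (by positivity) ?_
  have h1 := b (x + a + a)
  have h2 := b (x + a - a)
  have h3 := b (x - a + a)
  have h4 := b (x - a - a)
  rw [Set.mem_Icc] at h1 h2 h3 h4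
  rw [abs_le]
  constructor <;> linarith

/-- An alternating sum of eight numbers in `[0, 1]`, hence in `[-4, 4]`, divided by `8a³`. This is
the third derivative of the triple average, so no smoothness of `h` is needed. -/
lemma symQuot₃_abs_le {a : ℝ} (ha : 0 < a) {h : ℝ → ℝ}
    (hb : ∀ x, h x ∈ Set.Icc (0 : ℝ) 1) (x : ℝ) :
    |symQuot a (symQuot a (symQuot a h)) x| ≤ 1 / (2 * a ^ 3) := by
  have e : symQuot a (symQuot a (symQuot a h)) x =
      (h (x + a + a + a) - h (x + a + a - a) - (h (x + a - a + a) - h (x + a - a - a)) -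
        (h (x - a + a + a) - h (x - a + a - a) - (h (x - a - a + a) - h (x - a - a - a)))) / 4
        * (1 / (2 * a ^ 3)) := by
    unfold symQuot
    field_simp
    ring
  rw [e, abs_mul, abs_of_pos (by positivity : 0 < 1 / (2 * a ^ 3))]
  refine mul_le_of_le_one_left (by positivity) ?_
  have h1 := hb (x + a + a + a)
  have h2 := hb (x + a + a - a)
  have h3 := hb (x + a - a + a)
  have h4 := hb (x + a - a - a)
  have h5 := hb (x - a + a + a)
  have h6 := hb (x - a + a - a)
  have h7 := hb (x - a - a + a)
  have h8 := hb (x - a - a - a)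
  rw [Set.mem_Icc] at h1 h2 h3 h4 h5 h6 h7 h8
  rw [abs_le]
  constructor <;> linarith

/-! ### Second-order Taylor estimates -/

lemma le_of_hasDerivAt_le {f g f' g' : ℝ → ℝ} (hf : ∀ t, HasDerivAt f (f' t) t)
    (hg : ∀ t, HasDerivAt g (g' t) t) (h0 : f 0 ≤ g 0) (h : ∀ t, 0 ≤ t → f' t ≤ g' t) {t : ℝ}
    (ht : 0 ≤ t) : f t ≤ g t := by
  have hm : MonotoneOn (fun t => g t - f t) (Set.Ici 0) := by
    refine monotoneOn_of_deriv_nonneg (convex_Ici 0)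
      (fun t _ => ((hg t).sub (hf t)).continuousAt.continuousWithinAt)
      (fun t _ => ((hg t).sub (hf t)).differentiableAt.differentiableWithinAt) fun t ht' => ?_
    rw [interior_Ici] at ht'
    have := ((hg t).sub (hf t)).deriv
    rw [show (fun t => g t - f t) = g - f from rfl, this]
    linarith [h t (le_of_lt ht')]
  have := hm (Set.mem_Ici.2 le_rfl) (Set.mem_Ici.2 ht) ht
  simp only at this
  linarith

/-- Taylor's formula of order two with a modulus `K + M t` for the second derivative. -/
lemma taylor_two_le {φ φ' φ'' : ℝ → ℝ} (h1 : ∀ t, HasDerivAt φ (φ' t) t)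
    (h2 : ∀ t, HasDerivAt φ' (φ'' t) t) (c u K M : ℝ)
    (h : ∀ t, 0 ≤ t → (φ'' (c + t * u) - φ'' c) * u ^ 2 ≤ K + M * t) :
    φ (c + u) - φ c - φ' c * u - φ'' c * u ^ 2 / 2 ≤ K / 2 + M / 6 := by
  have d1 : ∀ t, HasDerivAt (fun t => φ (c + t * u)) (φ' (c + t * u) * u) t := fun t => by
    have := (h1 (c + t * u)).comp t (((hasDerivAt_id t).mul_const u).const_add c)
    simpa [Function.comp_def] using this
  have d2 : ∀ t, HasDerivAt (fun t => φ' (c + t * u)) (φ'' (c + t * u) * u) t := fun t => by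
    have := (h2 (c + t * u)).comp t (((hasDerivAt_id t).mul_const u).const_add c)
    simpa [Function.comp_def] using this
  have s1 : ∀ t, 0 ≤ t → φ' (c + t * u) * u ≤
      φ' c * u + φ'' c * u ^ 2 * t + K * t + M / 2 * t ^ 2 := by
    intro t ht
    refine le_of_hasDerivAt_le (f := fun t => φ' (c + t * u) * u)
      (g := fun t => φ' c * u + φ'' c * u ^ 2 * t + K * t + M / 2 * t ^ 2)
      (fun t => (d2 t).mul_const u) (g' := fun t => φ'' c * u ^ 2 + K + M * t) (fun t => ?_)
      (by simp) (fun t ht => by nlinarith [h t ht]) ht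
    have e := ((((hasDerivAt_id t).const_mul (φ'' c * u ^ 2)).const_add (φ' c * u)).add
      ((hasDerivAt_id t).const_mul K)).add ((hasDerivAt_pow 2 t).const_mul (M / 2))
    convert! e using 1
    simp
    ring
  have s2 : φ (c + 1 * u) ≤
      φ c + φ' c * u * 1 + φ'' c * u ^ 2 / 2 * 1 ^ 2 + K / 2 * 1 ^ 2 + M / 6 * 1 ^ 3 := by
    refine le_of_hasDerivAt_le (f := fun t => φ (c + t * u)) (g := fun t =>
      φ c + φ' c * u * t + φ'' c * u ^ 2 / 2 * t ^ 2 + K / 2 * t ^ 2 + M / 6 * t ^ 3) d1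
      (g' := fun t => φ' c * u + φ'' c * u ^ 2 * t + K * t + M / 2 * t ^ 2) (fun t => ?_)
      (by simp) s1 zero_le_one
    have e := ((((hasDerivAt_id t).const_mul (φ' c * u)).const_add (φ c)).add
      ((hasDerivAt_pow 2 t).const_mul (φ'' c * u ^ 2 / 2))).add
      ((hasDerivAt_pow 2 t).const_mul (K / 2)) |>.add ((hasDerivAt_pow 3 t).const_mul (M / 6))
    convert! e using 1
    simp
    ring
  rw [one_mul] at s2
  linarith

lemma tripleDeriv₂_lipschitz {a : ℝ} (ha : 0 < a) {h : ℝ → ℝ} (hc : Continuous h)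
    (hb : ∀ x, h x ∈ Set.Icc (0 : ℝ) 1) (x y : ℝ) :
    |tripleDeriv₂ a h y - tripleDeriv₂ a h x| ≤ 1 / (2 * a ^ 3) * |y - x| := by
  have := Convex.norm_image_sub_le_of_norm_hasDerivWithin_le (f := tripleDeriv₂ a h)
    (fun x _ => (hasDerivAt_tripleDeriv₂ (a := a) hc x).hasDerivWithinAt)
    (fun x _ => by rw [Real.norm_eq_abs]; exact symQuot₃_abs_le ha hb x) (convex_univ)
    (Set.mem_univ x) (Set.mem_univ y)
  simpa only [Real.norm_eq_abs] using this

/-- The cubic bound comes from the Lipschitz constant of the second derivative, the quadratic one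
from its supremum (`M = 0` in `taylor_two_le`). Keeping both allows truncated moments in place of
third moments. -/
lemma tripleAvg_taylor_upper {a : ℝ} (ha : 0 < a) {h : ℝ → ℝ} (hc : Continuous h)
    (hb : ∀ x, h x ∈ Set.Icc (0 : ℝ) 1) (c u : ℝ) :
    tripleAvg a h (c + u) - tripleAvg a h c - tripleDeriv a h c * u -
      tripleDeriv₂ a h c * u ^ 2 / 2 ≤ min (|u| ^ 3 / (12 * a ^ 3)) (u ^ 2 / (2 * a ^ 2)) := by
  refine le_min ?_ ?_
  · have := taylor_two_le (hasDerivAt_tripleAvg (a := a) hc) (hasDerivAt_tripleDeriv hc) c u 0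
      (1 / (2 * a ^ 3) * |u| ^ 3) (fun t ht => ?_)
    · refine this.trans_eq ?_
      field_simp
      ring
    · have h1 := tripleDeriv₂_lipschitz ha hc hb c (c + t * u)
      rw [add_sub_cancel_left, abs_mul, abs_of_nonneg ht] at h1
      calc _ ≤ |tripleDeriv₂ a h (c + t * u) - tripleDeriv₂ a h c| * u ^ 2 := by
            gcongr; exact le_abs_self _
        _ ≤ 1 / (2 * a ^ 3) * (t * |u|) * u ^ 2 := by gcongr
        _ = _ := by rw [← sq_abs]; ring
  · have := taylor_two_le (hasDerivAt_tripleAvg (a := a) hc) (hasDerivAt_tripleDeriv hc) c u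
      (u ^ 2 / a ^ 2) 0 (fun t ht => ?_)
    · refine this.trans_eq ?_
      field_simp
      ring
    · have h1 := abs_le.1 (tripleDeriv₂_mem ha hc hb c)
      have h2 := abs_le.1 (tripleDeriv₂_mem ha hc hb (c + t * u))
      have e : 1 / a ^ 2 = 1 / (2 * a ^ 2) + 1 / (2 * a ^ 2) := by field_simp; norm_num
      have : tripleDeriv₂ a h (c + t * u) - tripleDeriv₂ a h c ≤ 1 / a ^ 2 := by
        rw [e]; linarith
      calc _ ≤ 1 / a ^ 2 * u ^ 2 := by gcongr
        _ = _ := by ring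

/-- For the Gaussian side, where third moments exist and the cubic bound is enough. -/
lemma tripleAvg_taylor_lower {a : ℝ} (ha : 0 < a) {h : ℝ → ℝ} (hc : Continuous h)
    (hb : ∀ x, h x ∈ Set.Icc (0 : ℝ) 1) (c u : ℝ) :
    tripleAvg a h c + tripleDeriv a h c * u + tripleDeriv₂ a h c * u ^ 2 / 2 -
      |u| ^ 3 / (12 * a ^ 3) ≤ tripleAvg a h (c + u) := by
  have := taylor_two_le (φ := -tripleAvg a h) (φ' := -tripleDeriv a h) (φ'' := -tripleDeriv₂ a h)
    (fun t => (hasDerivAt_tripleAvg (a := a) hc t).neg)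
    (fun t => (hasDerivAt_tripleDeriv hc t).neg) c u 0
      (1 / (2 * a ^ 3) * |u| ^ 3) (fun t ht => ?_)
  · have e : (0 : ℝ) / 2 + 1 / (2 * a ^ 3) * |u| ^ 3 / 6 = |u| ^ 3 / (12 * a ^ 3) := by
      field_simp
      ring
    rw [e] at this
    simp only [Pi.neg_apply] at this
    linarith
  · have h1 := tripleDeriv₂_lipschitz ha hc hb c (c + t * u)
    rw [add_sub_cancel_left, abs_mul, abs_of_nonneg ht] at h1
    simp only [Pi.neg_apply]
    calc _ ≤ |tripleDeriv₂ a h (c + t * u) - tripleDeriv₂ a h c| * u ^ 2 := by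
          gcongr; linarith [neg_abs_le (tripleDeriv₂ a h (c + t * u) - tripleDeriv₂ a h c)]
      _ ≤ 1 / (2 * a ^ 3) * (t * |u|) * u ^ 2 := by gcongr
      _ = _ := by rw [← sq_abs]; ring

/-! ### The relabelling game and the Gaussian walk -/

/-- The best value that can be reached from position `x` by choosing a new `k`-th label within
distance `δ` of `x`. -/
noncomputable def relabelSup (δ : ℝ) (k : ℕ) (W : (ℕ → ℝ) → ℝ → ℝ) (d : ℕ → ℝ) (x : ℝ) : ℝ :=
  sSup ((fun e => W (Function.update d k (x + e)) x) '' Set.Icc (-δ) δ)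

/-- The value, with `j` steps left and the labels `d` chosen before time `k`, of the game where a
random walk with step law `γ` is labelled within distance `δ` at every step and the final reward
is a function `f` of the labels. -/
noncomputable def gameValue (δ : ℝ) (γ : Measure ℝ) (f : (ℕ → ℝ) → ℝ) :
    ℕ → ℕ → (ℕ → ℝ) → ℝ → ℝ
  | 0, _ => fun d _ => f d
  | j + 1, k => fun d x => ∫ η, relabelSup δ k (gameValue δ γ f j (k + 1)) d (x + η) ∂γ

/-- The expectation of `f` at the path of a random walk with step law `γ`, with `j` steps left, past
positions `y` and present position `x`. -/
noncomputable def walkValue (γ : Measure ℝ) (f : (ℕ → ℝ) → ℝ) : ℕ → ℕ → (ℕ → ℝ) → ℝ → ℝ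
  | 0, _ => fun y _ => f y
  | j + 1, k => fun y x => ∫ η, walkValue γ f j (k + 1) (Function.update y k (x + η)) (x + η) ∂γ

section

variable {δ : ℝ} {W : (ℕ → ℝ) → ℝ → ℝ}

lemma relabelSup_mem (k : ℕ) (hb : ∀ d x, W d x ∈ Set.Icc (0 : ℝ) 1)
    (d : ℕ → ℝ) (x : ℝ) : relabelSup δ k W d x ∈ Set.Icc (0 : ℝ) 1 := by
  constructor
  · exact Real.sSup_nonneg (by rintro _ ⟨e, -, rfl⟩; exact (hb _ _).1)
  · exact Real.sSup_le (by rintro _ ⟨e, -, rfl⟩; exact (hb _ _).2) zero_le_one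

lemma le_relabelSup (k : ℕ) (hb : ∀ d x, W d x ∈ Set.Icc (0 : ℝ) 1)
    (d : ℕ → ℝ) (x e : ℝ) (he : |e| ≤ δ) :
    W (Function.update d k (x + e)) x ≤ relabelSup δ k W d x := by
  refine le_csSup ⟨1, ?_⟩ ⟨e, abs_le.1 he, rfl⟩
  rintro _ ⟨e, -, rfl⟩
  exact (hb _ _).2

lemma relabelSup_le (hδ : 0 ≤ δ) (k : ℕ) (d : ℕ → ℝ) (x r : ℝ)
    (h : ∀ e, |e| ≤ δ → W (Function.update d k (x + e)) x ≤ r) : relabelSup δ k W d x ≤ r := by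
  refine csSup_le ((Set.nonempty_Icc.2 (by linarith)).image _) ?_
  rintro _ ⟨e, he, rfl⟩
  exact h e (abs_le.2 he)

lemma continuous_relabelSup (k : ℕ) (hc : Continuous fun p : (ℕ → ℝ) × ℝ => W p.1 p.2) :
    Continuous fun p : (ℕ → ℝ) × ℝ => relabelSup δ k W p.1 p.2 := by
  refine IsCompact.continuous_sSup
    (f := fun (p : (ℕ → ℝ) × ℝ) e => W (Function.update p.1 k (p.2 + e)) p.2) isCompact_Icc ?_
  refine hc.comp (f := fun q : ((ℕ → ℝ) × ℝ) × ℝ =>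
    (Function.update q.1.1 k (q.1.2 + q.2), q.1.2)) ?_
  exact Continuous.prodMk (Continuous.update (by fun_prop) k (by fun_prop)) (by fun_prop)

end

section

variable {δ : ℝ} {γ : Measure ℝ} [IsProbabilityMeasure γ] {f : (ℕ → ℝ) → ℝ}

lemma continuous_translates {F : (ℕ → ℝ) → ℝ → ℝ} (γ : Measure ℝ) [IsProbabilityMeasure γ]
    (hc : Continuous fun p : (ℕ → ℝ) × ℝ => F p.1 p.2) (hb : ∀ d x, F d x ∈ Set.Icc (0 : ℝ) 1) :
    Continuous fun p : (ℕ → ℝ) × ℝ => ∫ η, F p.1 (p.2 + η) ∂γ :=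
  continuous_integral_add γ (F := fun (p : (ℕ → ℝ) × ℝ) η => F p.1 (p.2 + η))
    (hc.comp (f := fun q : ((ℕ → ℝ) × ℝ) × ℝ => (q.1.1, q.1.2 + q.2)) (by fun_prop))
    fun _ _ => hb _ _

lemma gameValue_regular (hf : Continuous f) (hb : ∀ d, f d ∈ Set.Icc (0 : ℝ) 1)
    (j k : ℕ) : (Continuous fun p : (ℕ → ℝ) × ℝ => gameValue δ γ f j k p.1 p.2) ∧
      ∀ d x, gameValue δ γ f j k d x ∈ Set.Icc (0 : ℝ) 1 := by
  induction j generalizing k with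
  | zero => exact ⟨hf.comp continuous_fst, fun d _ => hb d⟩
  | succ j ih =>
    obtain ⟨h1, h2⟩ := ih (k + 1)
    have c := continuous_relabelSup (δ := δ) k h1
    have b := relabelSup_mem (δ := δ) k h2
    refine ⟨continuous_translates γ c b, fun d x => ?_⟩
    exact integral_mem_Icc (c.comp (f := fun η : ℝ => (d, x + η)) (by fun_prop)) fun η => b d _

lemma walkValue_regular (hf : Continuous f) (hb : ∀ d, f d ∈ Set.Icc (0 : ℝ) 1)
    (j k : ℕ) : (Continuous fun p : (ℕ → ℝ) × ℝ => walkValue γ f j k p.1 p.2) ∧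
      ∀ d x, walkValue γ f j k d x ∈ Set.Icc (0 : ℝ) 1 := by
  induction j generalizing k with
  | zero => exact ⟨hf.comp continuous_fst, fun d _ => hb d⟩
  | succ j ih =>
    obtain ⟨h1, h2⟩ := ih (k + 1)
    have c : Continuous fun p : (ℕ → ℝ) × ℝ =>
        walkValue γ f j (k + 1) (Function.update p.1 k p.2) p.2 :=
      h1.comp (f := fun p : (ℕ → ℝ) × ℝ => (Function.update p.1 k p.2, p.2))
        (Continuous.prodMk (Continuous.update (by fun_prop) k (by fun_prop)) (by fun_prop))
    refine ⟨continuous_translates γ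
      (F := fun d x => walkValue γ f j (k + 1) (Function.update d k x) x) c fun _ _ => h2 _ _,
      fun d x => ?_⟩
    exact integral_mem_Icc (c.comp (f := fun η : ℝ => (d, x + η)) (by fun_prop)) fun η => h2 _ _

/-- The initial displacement `z` is carried along unchanged by both walks, driven by the same steps.
A label is thus off by `z` plus the player's own error, at most `2δ` in total, however many steps
are played. -/
lemma gameValue_le_walkValue (hδ : 0 ≤ δ) {g : (ℕ → ℝ) → ℝ} (hf : Continuous f)
    (hfb : ∀ d, f d ∈ Set.Icc (0 : ℝ) 1) (hg : Continuous g)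
    (hgb : ∀ d, g d ∈ Set.Icc (0 : ℝ) 1) (n : ℕ)
    (hfg : ∀ d y, (∀ i < n, |d i - y i| ≤ 2 * δ) → f d ≤ g y) (j k : ℕ) (hjk : j + k = n)
    (d y : ℕ → ℝ) (x z : ℝ) (hz : |z| ≤ δ) (hd : ∀ i < k, |d i - y i| ≤ 2 * δ) :
    gameValue δ γ f j k d (x + z) ≤ walkValue γ g j k y x := by
  induction j generalizing k d y x with
  | zero => exact hfg d y (by simpa [← hjk] using hd)
  | succ j ih =>
    obtain ⟨c1, b1⟩ := gameValue_regular (δ := δ) (γ := γ) hf hfb j (k + 1)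
    obtain ⟨c2, b2⟩ := walkValue_regular (γ := γ) hg hgb j (k + 1)
    refine integral_mono ?_ ?_ fun η => ?_
    · exact integrable_of_mem_Icc ((continuous_relabelSup (δ := δ) k c1).comp
        (f := fun η : ℝ => (d, x + z + η)) (by fun_prop)) fun _ => relabelSup_mem k b1 _ _
    · exact integrable_of_mem_Icc (c2.comp
        (f := fun η : ℝ => (Function.update y k (x + η), x + η))
        (Continuous.prodMk (Continuous.update (by fun_prop) k (by fun_prop)) (by fun_prop)))
        fun _ => b2 _ _
    · refine relabelSup_le hδ k _ _ _ fun e he => ?_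
      rw [add_right_comm x z η]
      refine ih (k + 1) (by omega) _ _ _ fun i hi => ?_
      rcases Nat.lt_succ_iff_lt_or_eq.1 hi with hi | rfl
      · rw [Function.update_of_ne hi.ne, Function.update_of_ne hi.ne]
        exact hd i hi
      · rw [Function.update_self, Function.update_self]
        have := abs_add_le z e
        rw [show x + η + z + e - (x + η) = z + e by ring]
        linarith

/-- From a perturbed position `c + t` with `|t| ≤ 3a` the label `c` is a legal choice. So the exact
position may be recorded although the value is averaged around it. -/
lemma tripleAvg_gameValue_le {a : ℝ} (ha : 0 < a) (hf : Continuous f)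
    (hb : ∀ d, f d ∈ Set.Icc (0 : ℝ) 1) (j k : ℕ) (d : ℕ → ℝ) (c : ℝ) :
    tripleAvg a (gameValue (3 * a) γ f j (k + 1) (Function.update d k c)) c ≤
      tripleAvg a (relabelSup (3 * a) k (gameValue (3 * a) γ f j (k + 1)) d) c := by
  obtain ⟨c1, b1⟩ := gameValue_regular (δ := 3 * a) (γ := γ) hf hb j (k + 1)
  refine tripleAvg_mono ha (c1.comp (f := fun x : ℝ => (Function.update d k c, x)) (by fun_prop))
    ((continuous_relabelSup (δ := 3 * a) k c1).comp (f := fun x : ℝ => (d, x)) (by fun_prop))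
    fun t ht => ?_
  have := le_relabelSup (δ := 3 * a) k b1 d (c + t) (-t) (by rwa [abs_neg])
  rwa [add_neg_cancel_right] at this

lemma tripleAvg_gameValue_succ {a : ℝ} (ha : 0 < a) (hf : Continuous f)
    (hb : ∀ d, f d ∈ Set.Icc (0 : ℝ) 1) (j k : ℕ) (d : ℕ → ℝ) (c : ℝ) :
    tripleAvg a (gameValue (3 * a) γ f (j + 1) k d) c =
      ∫ η, tripleAvg a (relabelSup (3 * a) k (gameValue (3 * a) γ f j (k + 1)) d) (c + η) ∂γ := by
  obtain ⟨c1, b1⟩ := gameValue_regular (δ := 3 * a) (γ := γ) hf hb j (k + 1)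
  exact tripleAvg_integral ha γ
    ((continuous_relabelSup (δ := 3 * a) k c1).comp (f := fun x : ℝ => (d, x)) (by fun_prop))
    (relabelSup_mem k b1 d) c

/-- Integrating the lower Taylor bound removes the linear term, as the steps are centered. The
curvature term left is the one that the controlled step must match. -/
lemma integral_tripleAvg_ge {a : ℝ} (ha : 0 < a) {h : ℝ → ℝ} (hc : Continuous h)
    (hb : ∀ x, h x ∈ Set.Icc (0 : ℝ) 1) (c v m : ℝ) (i1 : Integrable (fun η => η) γ)
    (i2 : Integrable (fun η => η ^ 2) γ) (i3 : Integrable (fun η => |η| ^ 3) γ)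
    (e1 : ∫ η, η ∂γ = 0) (e2 : ∫ η, η ^ 2 ∂γ = v) (e3 : ∫ η, |η| ^ 3 ∂γ ≤ m) :
    tripleAvg a h c + tripleDeriv₂ a h c * v / 2 - m / (12 * a ^ 3) ≤
      ∫ η, tripleAvg a h (c + η) ∂γ := by
  have cT : Continuous (tripleAvg a h) :=
    continuous_iff_continuousAt.2 fun x => (hasDerivAt_tripleAvg hc x).continuousAt
  have j0 : Integrable (fun _ : ℝ => tripleAvg a h c) γ := integrable_const _
  have j1 : Integrable (fun η => tripleDeriv a h c * η) γ := i1.const_mul _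
  have j2 : Integrable (fun η => tripleDeriv₂ a h c * η ^ 2 / 2) γ := (i2.const_mul _).div_const _
  have j3 : Integrable (fun η => |η| ^ 3 / (12 * a ^ 3)) γ := i3.div_const _
  have key : ∫ η, (tripleAvg a h c + tripleDeriv a h c * η + tripleDeriv₂ a h c * η ^ 2 / 2 -
      |η| ^ 3 / (12 * a ^ 3)) ∂γ ≤ ∫ η, tripleAvg a h (c + η) ∂γ :=
    integral_mono (((j0.add j1).add j2).sub j3)
      (integrable_of_mem_Icc (cT.comp (continuous_const_add c)) fun _ => tripleAvg_mem ha hc hb _)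
      fun η => tripleAvg_taylor_lower ha hc hb c η
  rw [integral_sub (f := fun η => tripleAvg a h c + tripleDeriv a h c * η +
      tripleDeriv₂ a h c * η ^ 2 / 2) ((j0.add j1).add j2) j3,
    integral_add (f := fun η => tripleAvg a h c + tripleDeriv a h c * η) (j0.add j1) j2,
    integral_add j0 j1, integral_const_mul, integral_div, integral_const_mul, integral_div, e1,
    e2] at key
  have : (∫ η, |η| ^ 3 ∂γ) / (12 * a ^ 3) ≤ m / (12 * a ^ 3) := by gcongr
  simp at key
  linarith

end

/-! ### Elementary calculus of sublinear expectations -/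

namespace SublinearExpectation

variable {Ω : Type*} (𝔼 : SublinearExpectation Ω)

lemma smul_mem {X : Ω → ℝ} (hX : X ∈ 𝔼.H) (c : ℝ) : (fun ω => c * X ω) ∈ 𝔼.H :=
  𝔼.H.smul_mem c hX

lemma add_mem {X Y : Ω → ℝ} (hX : X ∈ 𝔼.H) (hY : Y ∈ 𝔼.H) : (fun ω => X ω + Y ω) ∈ 𝔼.H :=
  𝔼.H.add_mem hX hY

lemma add_const_mem {X : Ω → ℝ} (hX : X ∈ 𝔼.H) (c : ℝ) : (fun ω => X ω + c) ∈ 𝔼.H :=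
  𝔼.H.add_mem hX (𝔼.const_mem c)

lemma E_add_le {X Y : Ω → ℝ} (hX : X ∈ 𝔼.H) (hY : Y ∈ 𝔼.H) :
    𝔼.E (fun ω => X ω + Y ω) ≤ 𝔼.E X + 𝔼.E Y := 𝔼.subadd X hX Y hY

lemma E_mul {X : Ω → ℝ} (hX : X ∈ 𝔼.H) {c : ℝ} (hc : 0 ≤ c) :
    𝔼.E (fun ω => c * X ω) = c * 𝔼.E X := 𝔼.pos_homog X hX c hc

lemma E_add_const {X : Ω → ℝ} (hX : X ∈ 𝔼.H) (c : ℝ) :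
    𝔼.E (fun ω => X ω + c) = 𝔼.E X + c := by
  refine le_antisymm ?_ ?_
  · have := 𝔼.E_add_le hX (𝔼.const_mem c)
    rwa [𝔼.const] at this
  · have := 𝔼.E_add_le (𝔼.add_const_mem hX c) (𝔼.const_mem (-c))
    rw [𝔼.const] at this
    simp only [add_neg_cancel_right] at this
    linarith

lemma E_nonneg {X : Ω → ℝ} (hX : X ∈ 𝔼.H) (h : ∀ ω, 0 ≤ X ω) : 0 ≤ 𝔼.E X := by
  rw [← 𝔼.const 0]
  exact 𝔼.mono _ (𝔼.const_mem 0) _ hX h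

lemma neg_E_neg_le {X : Ω → ℝ} (hX : X ∈ 𝔼.H) : -𝔼.E (-X) ≤ 𝔼.E X := by
  have := 𝔼.subadd X hX (-X) (𝔼.H.neg_mem hX)
  rw [add_neg_cancel, show (0 : Ω → ℝ) = fun _ => (0 : ℝ) from rfl, 𝔼.const] at this
  linarith

variable {𝔼} {X₀ : Ω → ℝ}

lemma sq_sub_mem (h1 : X₀ ∈ 𝔼.H) (h2 : (fun ω => X₀ ω ^ 2) ∈ 𝔼.H) (μ : ℝ) :
    (fun ω => (X₀ ω - μ) ^ 2) ∈ 𝔼.H := by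
  have := 𝔼.add_mem h2 (𝔼.add_const_mem (𝔼.smul_mem h1 (-2 * μ)) (μ ^ 2))
  convert! this using 2
  ring

lemma neg_sq_sub_mem (h1 : X₀ ∈ 𝔼.H) (h2 : (fun ω => X₀ ω ^ 2) ∈ 𝔼.H) (μ : ℝ) :
    (fun ω => -(X₀ ω - μ) ^ 2) ∈ 𝔼.H := 𝔼.H.neg_mem (sq_sub_mem h1 h2 μ)

/-- The expectation of `Y + t X` is a Lipschitz function of `t`. -/
lemma continuous_E_add_mul {Y : Ω → ℝ} (h1 : X₀ ∈ 𝔼.H) (hY : Y ∈ 𝔼.H) :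
    Continuous fun t : ℝ => 𝔼.E (fun ω => Y ω + t * X₀ ω) := by
  have hb : ∀ s : ℝ, 𝔼.E (fun ω => s * X₀ ω) ≤ |s| * (|𝔼.E X₀| + |𝔼.E (-X₀)|) := by
    intro s
    rcases le_total 0 s with hs | hs
    · rw [𝔼.E_mul h1 hs, abs_of_nonneg hs]
      gcongr
      linarith [le_abs_self (𝔼.E X₀), abs_nonneg (𝔼.E (-X₀))]
    · have e : (fun ω => s * X₀ ω) = fun ω => (-s) * (-X₀) ω := by
        funext ω
        simp
      rw [e, 𝔼.E_mul (𝔼.H.neg_mem h1) (by linarith), abs_of_nonpos hs]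
      gcongr
      · linarith
      · linarith [le_abs_self (𝔼.E (-X₀)), abs_nonneg (𝔼.E X₀)]
  have hm : ∀ t : ℝ, (fun ω => Y ω + t * X₀ ω) ∈ 𝔼.H := fun t => 𝔼.add_mem hY (𝔼.smul_mem h1 t)
  have hd : ∀ s t : ℝ, 𝔼.E (fun ω => Y ω + s * X₀ ω) - 𝔼.E (fun ω => Y ω + t * X₀ ω) ≤
      |s - t| * (|𝔼.E X₀| + |𝔼.E (-X₀)|) := by
    intro s t
    have := 𝔼.E_add_le (hm t) (𝔼.smul_mem h1 (s - t))
    have e : (fun ω => Y ω + t * X₀ ω + (s - t) * X₀ ω) = fun ω => Y ω + s * X₀ ω := by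
      funext ω
      ring
    rw [e] at this
    linarith [hb (s - t)]
  refine (LipschitzWith.of_dist_le_mul (K := (|𝔼.E X₀| + |𝔼.E (-X₀)|).toNNReal)
    fun s t => ?_).continuous
  rw [Real.dist_eq, Real.dist_eq, Real.coe_toNNReal _ (by positivity), mul_comm]
  refine abs_le.2 ⟨?_, hd s t⟩
  have := hd t s
  rw [abs_sub_comm] at this
  linarith

lemma continuous_E_sq_sub (h1 : X₀ ∈ 𝔼.H) (h2 : (fun ω => X₀ ω ^ 2) ∈ 𝔼.H) :
    Continuous fun μ : ℝ => 𝔼.E (fun ω => (X₀ ω - μ) ^ 2) := by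
  have e : (fun μ : ℝ => 𝔼.E (fun ω => (X₀ ω - μ) ^ 2)) =
      fun μ => 𝔼.E (fun ω => X₀ ω ^ 2 + (-2 * μ) * X₀ ω) + μ ^ 2 := by
    funext μ
    rw [← 𝔼.E_add_const (𝔼.add_mem h2 (𝔼.smul_mem h1 (-2 * μ)))]
    congr 1
    funext ω
    ring
  rw [e]
  have := (continuous_E_add_mul h1 h2).comp (f := fun μ : ℝ => -2 * μ) (by fun_prop)
  exact this.add (by fun_prop)

lemma continuous_E_neg_sq_sub (h1 : X₀ ∈ 𝔼.H) (h2 : (fun ω => X₀ ω ^ 2) ∈ 𝔼.H) :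
    Continuous fun μ : ℝ => 𝔼.E (fun ω => -(X₀ ω - μ) ^ 2) := by
  have h2' : (fun ω => -X₀ ω ^ 2) ∈ 𝔼.H := 𝔼.H.neg_mem h2
  have e : (fun μ : ℝ => 𝔼.E (fun ω => -(X₀ ω - μ) ^ 2)) =
      fun μ => 𝔼.E (fun ω => -X₀ ω ^ 2 + (2 * μ) * X₀ ω) + -μ ^ 2 := by
    funext μ
    rw [← 𝔼.E_add_const (𝔼.add_mem h2' (𝔼.smul_mem h1 (2 * μ)))]
    congr 1
    funext ω
    ring
  rw [e]
  have := (continuous_E_add_mul h1 h2').comp (f := fun μ : ℝ => 2 * μ) (by fun_prop)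
  exact this.add (by fun_prop)

lemma continuous_lowerSD (h1 : X₀ ∈ 𝔼.H) (h2 : (fun ω => X₀ ω ^ 2) ∈ 𝔼.H) :
    Continuous (𝔼.lowerSD X₀) :=
  (continuous_E_neg_sq_sub h1 h2).neg.sqrt

lemma continuous_upperSD (h1 : X₀ ∈ 𝔼.H) (h2 : (fun ω => X₀ ω ^ 2) ∈ 𝔼.H) :
    Continuous (𝔼.upperSD X₀) :=
  (continuous_E_sq_sub h1 h2).sqrt

lemma lowerSD_le_upperSD (h1 : X₀ ∈ 𝔼.H) (h2 : (fun ω => X₀ ω ^ 2) ∈ 𝔼.H) (μ : ℝ) :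
    𝔼.lowerSD X₀ μ ≤ 𝔼.upperSD X₀ μ :=
  Real.sqrt_le_sqrt (𝔼.neg_E_neg_le (sq_sub_mem h1 h2 μ))

lemma lowerMean_le_upperMean (h1 : X₀ ∈ 𝔼.H) : 𝔼.lowerMean X₀ ≤ 𝔼.upperMean X₀ :=
  𝔼.neg_E_neg_le h1

lemma upperSD_sq (h1 : X₀ ∈ 𝔼.H) (h2 : (fun ω => X₀ ω ^ 2) ∈ 𝔼.H) (μ : ℝ) :
    𝔼.upperSD X₀ μ ^ 2 = 𝔼.E (fun ω => (X₀ ω - μ) ^ 2) :=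
  Real.sq_sqrt (𝔼.E_nonneg (sq_sub_mem h1 h2 μ) fun _ => sq_nonneg _)

lemma lowerSD_sq {μ : ℝ} (h : 0 < 𝔼.lowerSD X₀ μ) :
    𝔼.lowerSD X₀ μ ^ 2 = -𝔼.E (fun ω => -(X₀ ω - μ) ^ 2) :=
  Real.sq_sqrt (Real.sqrt_pos.1 h).le

lemma NonDegenerate.exists_lowerSD_ge (h : 𝔼.NonDegenerate X₀) :
    ∃ σ : ℝ, 0 < σ ∧ ∀ μ ∈ 𝔼.meanSet X₀, σ ≤ 𝔼.lowerSD X₀ μ :=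
  ⟨_, h.2.2, fun μ hμ => csInf_le ⟨0, by rintro _ ⟨μ, -, rfl⟩; exact Real.sqrt_nonneg _⟩
    ⟨μ, hμ, rfl⟩⟩

lemma NonDegenerate.lowerSD_pos (h : 𝔼.NonDegenerate X₀) {μ : ℝ} (hμ : μ ∈ 𝔼.meanSet X₀) :
    0 < 𝔼.lowerSD X₀ μ := by
  obtain ⟨σ, h0, h1⟩ := h.exists_lowerSD_ge
  exact h0.trans_le (h1 μ hμ)

end SublinearExpectation

/-! ### Nearly optimal continuous controls -/

/-- A continuous switch: `0` up to `0`, `1` from `τ` on. -/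
noncomputable def ramp (τ b : ℝ) : ℝ := max 0 (min 1 (b / τ))

lemma continuous_ramp (τ : ℝ) : Continuous (ramp τ) := by
  unfold ramp
  fun_prop

lemma ramp_mem (τ b : ℝ) : ramp τ b ∈ Set.Icc (0 : ℝ) 1 :=
  ⟨le_max_left _ _, max_le zero_le_one (min_le_left _ _)⟩

lemma ramp_of_nonpos {τ b : ℝ} (hτ : 0 < τ) (hb : b ≤ 0) : ramp τ b = 0 :=
  max_eq_left ((min_le_right _ _).trans (div_nonpos_of_nonpos_of_nonneg hb hτ.le))

lemma mul_one_sub_ramp_le {τ b : ℝ} (hτ : 0 < τ) (hb : 0 ≤ b) : b * (1 - ramp τ b) ≤ τ := by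
  rcases le_total τ b with h | h
  · have : ramp τ b = 1 := by
      unfold ramp
      rw [min_eq_left ((one_le_div hτ).2 h)]
      norm_num
    rw [this]
    simpa using hτ.le
  · have := ramp_mem τ b
    nlinarith [this.1, this.2]

namespace SublinearExpectation

variable {Ω : Type*} (𝔼 : SublinearExpectation Ω) (X₀ : Ω → ℝ)

/-- A centering that is nearly optimal for the slope `b`. -/
noncomputable def centering (τ b : ℝ) : ℝ :=
  𝔼.lowerMean X₀ + (𝔼.upperMean X₀ - 𝔼.lowerMean X₀) * ramp τ b

/-- A scaling about `μ` that is nearly optimal for the curvature `b`. -/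
noncomputable def scaling (τ b μ : ℝ) : ℝ :=
  𝔼.lowerSD X₀ μ + (𝔼.upperSD X₀ μ - 𝔼.lowerSD X₀ μ) * ramp τ b

variable {𝔼 X₀}

lemma centering_mem (h1 : X₀ ∈ 𝔼.H) (τ b : ℝ) : 𝔼.centering X₀ τ b ∈ 𝔼.meanSet X₀ := by
  have h := lowerMean_le_upperMean h1
  have hr := ramp_mem τ b
  constructor <;> unfold centering <;> nlinarith [hr.1, hr.2]

lemma scaling_mem (h1 : X₀ ∈ 𝔼.H) (h2 : (fun ω => X₀ ω ^ 2) ∈ 𝔼.H) (τ b μ : ℝ) :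
    𝔼.scaling X₀ τ b μ ∈ Set.Icc (𝔼.lowerSD X₀ μ) (𝔼.upperSD X₀ μ) := by
  have h := lowerSD_le_upperSD h1 h2 μ
  have hr := ramp_mem τ b
  constructor <;> unfold scaling <;> nlinarith [hr.1, hr.2]

lemma continuous_centering (τ : ℝ) : Continuous (𝔼.centering X₀ τ) := by
  have := continuous_ramp τ
  unfold centering
  fun_prop

lemma continuous_scaling (h1 : X₀ ∈ 𝔼.H) (h2 : (fun ω => X₀ ω ^ 2) ∈ 𝔼.H) (τ : ℝ) :
    Continuous fun q : ℝ × ℝ => 𝔼.scaling X₀ τ q.1 q.2 := by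
  have := continuous_ramp τ
  have := continuous_lowerSD h1 h2
  have := continuous_upperSD h1 h2
  unfold scaling
  fun_prop

lemma sub_const_mem (h1 : X₀ ∈ 𝔼.H) (μ : ℝ) : (fun ω => X₀ ω - μ) ∈ 𝔼.H :=
  𝔼.H.sub_mem h1 (𝔼.const_mem μ)

/-- Centering at the upper mean for `b > 0`, at the lower mean for `b ≤ 0`, would give at most `0`.
The ramp errs only for `b` between `0` and `τ`, where the error carries the small factor `b`. -/
lemma E_mul_sub_centering_le (h1 : X₀ ∈ 𝔼.H) {τ : ℝ} (hτ : 0 < τ) (b : ℝ) :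
    𝔼.E (fun ω => b * (X₀ ω - 𝔼.centering X₀ τ b)) ≤
      τ * (𝔼.upperMean X₀ - 𝔼.lowerMean X₀) := by
  have hl := lowerMean_le_upperMean h1
  rcases le_total 0 b with hb | hb
  · rw [𝔼.E_mul (sub_const_mem h1 _) hb]
    have e := 𝔼.E_add_const h1 (-𝔼.centering X₀ τ b)
    simp only [← sub_eq_add_neg] at e
    rw [e]
    change b * (𝔼.upperMean X₀ - 𝔼.centering X₀ τ b) ≤ _
    unfold centering
    have := mul_one_sub_ramp_le hτ hb
    calc _ = (b * (1 - ramp τ b)) * (𝔼.upperMean X₀ - 𝔼.lowerMean X₀) := by ring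
      _ ≤ _ := by gcongr
  · have e : (fun ω => b * (X₀ ω - 𝔼.centering X₀ τ b)) =
        fun ω => (-b) * ((-X₀) ω + 𝔼.centering X₀ τ b) := by
      funext ω
      simp only [Pi.neg_apply]
      ring
    rw [e, 𝔼.E_mul (𝔼.add_const_mem (𝔼.H.neg_mem h1) _) (by linarith),
      𝔼.E_add_const (𝔼.H.neg_mem h1)]
    unfold centering
    rw [ramp_of_nonpos hτ hb]
    have : 𝔼.E (-X₀) = -𝔼.lowerMean X₀ := by unfold lowerMean; ring
    rw [this]
    have : 0 ≤ τ * (𝔼.upperMean X₀ - 𝔼.lowerMean X₀) := mul_nonneg hτ.le (by linarith)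
    linarith

/-- The same idea for the curvature: the upper standard deviation is the right scale for positive
`b`, the lower one for negative `b`, and the ramp loses `O(τ)` in between. -/
lemma E_mul_sq_le_scaling (h1 : X₀ ∈ 𝔼.H) (h2 : (fun ω => X₀ ω ^ 2) ∈ 𝔼.H) {τ : ℝ} (hτ : 0 < τ)
    (b μ : ℝ) (hμ : 0 < 𝔼.lowerSD X₀ μ) :
    𝔼.E (fun ω => b * (X₀ ω - μ) ^ 2) ≤
      b * 𝔼.scaling X₀ τ b μ ^ 2 + 2 * τ * 𝔼.upperSD X₀ μ ^ 2 := by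
  have hl := lowerSD_le_upperSD h1 h2 μ
  rcases le_total 0 b with hb | hb
  · rw [𝔼.E_mul (sq_sub_mem h1 h2 _) hb, ← upperSD_sq h1 h2]
    have hs := scaling_mem h1 h2 τ b μ
    have key : b * (𝔼.upperSD X₀ μ - 𝔼.scaling X₀ τ b μ) ≤ τ * 𝔼.upperSD X₀ μ := by
      unfold scaling
      calc _ = (b * (1 - ramp τ b)) * (𝔼.upperSD X₀ μ - 𝔼.lowerSD X₀ μ) := by ring
        _ ≤ τ * (𝔼.upperSD X₀ μ - 𝔼.lowerSD X₀ μ) := by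
            gcongr
            exact mul_one_sub_ramp_le hτ hb
        _ ≤ _ := by gcongr; linarith
    have hu : 0 ≤ 𝔼.upperSD X₀ μ := Real.sqrt_nonneg _
    have : b * (𝔼.upperSD X₀ μ ^ 2 - 𝔼.scaling X₀ τ b μ ^ 2) ≤ 2 * τ * 𝔼.upperSD X₀ μ ^ 2 := by
      calc _ = b * (𝔼.upperSD X₀ μ - 𝔼.scaling X₀ τ b μ) *
            (𝔼.upperSD X₀ μ + 𝔼.scaling X₀ τ b μ) := by ring
        _ ≤ τ * 𝔼.upperSD X₀ μ * (𝔼.upperSD X₀ μ + 𝔼.upperSD X₀ μ) := by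
            gcongr
            · linarith [hs.1]
            · exact hs.2
        _ = _ := by ring
    linarith
  · have e : (fun ω => b * (X₀ ω - μ) ^ 2) = fun ω => (-b) * (-(X₀ ω - μ) ^ 2) := by
      funext ω
      ring
    rw [e, 𝔼.E_mul (neg_sq_sub_mem h1 h2 μ) (by linarith)]
    unfold scaling
    rw [ramp_of_nonpos hτ hb, mul_zero, add_zero, lowerSD_sq hμ]
    have : 0 ≤ 2 * τ * 𝔼.upperSD X₀ μ ^ 2 := by positivity
    linarith

/-- With the nearly optimal centering and scaling, the expectation of a quadratic function of the
normalized variable is at most what it would be for mean `0` and variance `1`. -/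
lemma NonDegenerate.exists_quadratic_bound (h : 𝔼.NonDegenerate X₀) :
    ∃ C : ℝ, ∀ τ > 0, ∀ b₁ b₂ N : ℝ, 1 ≤ N →
      (fun ω => b₁ * ((X₀ ω - 𝔼.centering X₀ τ b₁) /
        𝔼.scaling X₀ τ b₂ (𝔼.centering X₀ τ b₁) / N) + b₂ * ((X₀ ω - 𝔼.centering X₀ τ b₁) /
        𝔼.scaling X₀ τ b₂ (𝔼.centering X₀ τ b₁) / N) ^ 2 / 2) ∈ 𝔼.H ∧
      𝔼.E (fun ω => b₁ * ((X₀ ω - 𝔼.centering X₀ τ b₁) /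
        𝔼.scaling X₀ τ b₂ (𝔼.centering X₀ τ b₁) / N) + b₂ * ((X₀ ω - 𝔼.centering X₀ τ b₁) /
        𝔼.scaling X₀ τ b₂ (𝔼.centering X₀ τ b₁) / N) ^ 2 / 2) ≤ b₂ / (2 * N ^ 2) + τ * C := by
  obtain ⟨h1, h2, -⟩ := id h
  obtain ⟨σ, hσ, hσ'⟩ := h.exists_lowerSD_ge
  -- The upper variances are bounded on the compact mean interval. With the lower bound `σ` this
  -- makes the constant independent of `τ`, of the two coefficients and of `N`.
  obtain ⟨Q, hQ⟩ := isCompact_Icc.exists_bound_of_continuousOn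
    (s := 𝔼.meanSet X₀) ((continuous_upperSD h1 h2).pow 2).continuousOn
  refine ⟨(𝔼.upperMean X₀ - 𝔼.lowerMean X₀) / σ + Q / σ ^ 2, fun τ hτ b₁ b₂ N hN => ?_⟩
  set m := 𝔼.centering X₀ τ b₁ with hm
  set s := 𝔼.scaling X₀ τ b₂ m with hs
  have hmm : m ∈ 𝔼.meanSet X₀ := centering_mem h1 τ b₁
  have hsm := scaling_mem h1 h2 τ b₂ m
  have hσs : σ ≤ s := (hσ' m hmm).trans hsm.1
  have hs0 : 0 < s := hσ.trans_le hσs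
  have hN0 : 0 < N := one_pos.trans_le hN
  have hQm : 𝔼.upperSD X₀ m ^ 2 ≤ Q := (le_abs_self _).trans (hQ m hmm)
  have hQ0 : 0 ≤ Q := (sq_nonneg _).trans hQm
  have hl := lowerMean_le_upperMean h1
  have e : (fun ω => b₁ * ((X₀ ω - m) / s / N) + b₂ * ((X₀ ω - m) / s / N) ^ 2 / 2) =
      fun ω => (1 / (s * N)) * (b₁ * (X₀ ω - m)) +
        (1 / (2 * s ^ 2 * N ^ 2)) * (b₂ * (X₀ ω - m) ^ 2) := by
    funext ω
    field_simp
  have m1 := 𝔼.smul_mem (sub_const_mem h1 m) b₁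
  have m2 := 𝔼.smul_mem (sq_sub_mem h1 h2 m) b₂
  rw [e]
  refine ⟨𝔼.add_mem (𝔼.smul_mem m1 _) (𝔼.smul_mem m2 _), ?_⟩
  refine (𝔼.E_add_le (𝔼.smul_mem m1 _) (𝔼.smul_mem m2 _)).trans ?_
  rw [𝔼.E_mul m1 (by positivity), 𝔼.E_mul m2 (by positivity)]
  have k1 : 𝔼.E (fun ω => b₁ * (X₀ ω - m)) ≤ _ := E_mul_sub_centering_le h1 hτ b₁
  have k2 := E_mul_sq_le_scaling h1 h2 hτ b₂ m (hσ.trans_le (hσ' m hmm))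
  rw [← hs] at k2
  have hd : 0 ≤ 𝔼.upperMean X₀ - 𝔼.lowerMean X₀ := by linarith
  have l1 : 1 / (s * N) * 𝔼.E (fun ω => b₁ * (X₀ ω - m)) ≤
      τ * ((𝔼.upperMean X₀ - 𝔼.lowerMean X₀) / σ) := by
    calc _ ≤ 1 / (s * N) * (τ * (𝔼.upperMean X₀ - 𝔼.lowerMean X₀)) := by gcongr
      _ ≤ 1 / (σ * 1) * (τ * (𝔼.upperMean X₀ - 𝔼.lowerMean X₀)) := by gcongr
      _ = _ := by ring
  have l2 : 1 / (2 * s ^ 2 * N ^ 2) * 𝔼.E (fun ω => b₂ * (X₀ ω - m) ^ 2) ≤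
      b₂ / (2 * N ^ 2) + τ * (Q / σ ^ 2) := by
    calc _ ≤ 1 / (2 * s ^ 2 * N ^ 2) * (b₂ * s ^ 2 + 2 * τ * Q) := by
            have : 2 * τ * 𝔼.upperSD X₀ m ^ 2 ≤ 2 * τ * Q := by gcongr
            have := k2.trans (add_le_add_right this _)
            gcongr
      _ = b₂ / (2 * N ^ 2) + 1 / (s ^ 2 * N ^ 2) * (τ * Q) := by field_simp
      _ ≤ b₂ / (2 * N ^ 2) + 1 / (σ ^ 2 * 1 ^ 2) * (τ * Q) := by gcongr
      _ = _ := by ring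
  linarith

end SublinearExpectation

/-! ### The truncated remainder and the state of the controlled walk -/

/-- The Taylor remainder in terms of the truncated moment. -/
lemma min_cube_sq_le {a p N u ξ : ℝ} (ha : 0 < a) (ha1 : 3 * a ≤ 1) (hp : p ∈ Set.Icc (2 : ℝ) 3)
    (hN : 1 ≤ N) (hu : |u| ≤ |ξ| / N) :
    min (|u| ^ 3 / (12 * a ^ 3)) (u ^ 2 / (2 * a ^ 2)) ≤
      4.5 * (3 * a) ^ (-p) * N ^ (-p) * min (|ξ| ^ p) (N ^ (p - 2) * ξ ^ 2) := by
  have hN0 : 0 < N := one_pos.trans_le hN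
  have hd : 0 < 3 * a := by positivity
  -- In units of `3a` the remainder is at most `4.5 * min (b ^ 3) (b ^ 2)`, and `min (b ^ 3) (b ^ 2)
  -- ≤ b ^ p` for `p` in `[2, 3]`. The factor `4.5 = 9/2` is that of the quadratic term; the cubic
  -- term would only need `9/4`.
  set b := |ξ| / N / (3 * a) with hb
  have hb0 : 0 ≤ b := by positivity
  have hub : |u| ≤ b * (3 * a) := by rw [hb]; field_simp; rwa [le_div_iff₀ hN0] at hu
  have h3 : |u| ^ 3 / (12 * a ^ 3) ≤ 4.5 * b ^ 3 := by
    rw [div_le_iff₀ (by positivity)]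
    calc |u| ^ 3 ≤ (b * (3 * a)) ^ 3 := by gcongr
      _ = 27 * (b ^ 3 * a ^ 3) := by ring
      _ ≤ 54 * (b ^ 3 * a ^ 3) := by gcongr; norm_num
      _ = _ := by ring
  have h2 : u ^ 2 / (2 * a ^ 2) ≤ 4.5 * b ^ 2 := by
    rw [div_le_iff₀ (by positivity), ← sq_abs]
    calc |u| ^ 2 ≤ (b * (3 * a)) ^ 2 := by gcongr
      _ = _ := by ring
  have hbp : b ^ p = (3 * a) ^ (-p) * N ^ (-p) * |ξ| ^ p := by
    rw [hb, Real.div_rpow (by positivity) hd.le, Real.div_rpow (abs_nonneg _) hN0.le,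
      Real.rpow_neg hd.le, Real.rpow_neg hN0.le]
    field_simp
  rw [mul_min_of_nonneg _ _ (by positivity)]
  refine le_min ?_ ?_
  · rw [mul_assoc, mul_assoc, ← mul_assoc ((3 * a) ^ (-p)), ← hbp]
    rcases le_total b 1 with h | h
    · refine (min_le_left _ _).trans (h3.trans ?_)
      gcongr
      rw [← Real.rpow_natCast]
      rcases hb0.eq_or_lt with h0 | h0
      · rw [← h0, Real.zero_rpow (by norm_num), Real.zero_rpow (by linarith [hp.1])]
      · exact Real.rpow_le_rpow_of_exponent_ge h0 h (by simpa using hp.2)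
    · refine (min_le_right _ _).trans (h2.trans ?_)
      gcongr
      rw [← Real.rpow_natCast]
      exact Real.rpow_le_rpow_of_exponent_le h (by simpa using hp.1)
  · refine (min_le_right _ _).trans (h2.trans ?_)
    have e1 : N ^ (-p) * N ^ (p - 2) = (N ^ 2)⁻¹ := by
      rw [← Real.rpow_add hN0, show -p + (p - 2) = -(2 : ℝ) by ring, Real.rpow_neg hN0.le]
      norm_cast
    -- For the truncated part the exponent `2` of the scale is worsened to `p`, which is where `3 *
    -- a ≤ 1` enters.
    have e2 : ((3 * a) ^ 2)⁻¹ ≤ (3 * a) ^ (-p) := by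
      rw [show ((3 * a) ^ 2)⁻¹ = (3 * a) ^ (-(2 : ℝ)) by rw [Real.rpow_neg hd.le]; norm_cast]
      exact Real.rpow_le_rpow_of_exponent_ge hd ha1 (by linarith [hp.1])
    calc 4.5 * b ^ 2 = 4.5 * ((3 * a) ^ 2)⁻¹ * (N ^ 2)⁻¹ * ξ ^ 2 := by
          rw [hb, ← sq_abs ξ]
          field_simp
      _ ≤ 4.5 * (3 * a) ^ (-p) * (N ^ 2)⁻¹ * ξ ^ 2 := by gcongr
      _ = _ := by rw [← e1]; ring

/-- The positions (at the times `1, …, k`, followed by zeros) and the present position of the walk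
whose `k`-th step is the `k`-th variable centered by `μ k` and scaled by `σ k` and `N`, where `μ k`
and `σ k` depend on the past positions and the present one. -/
noncomputable def walkState (N : ℝ) (μ σ : ℕ → (ℕ → ℝ) × ℝ → ℝ) :
    (k : ℕ) → (Fin k → ℝ) → (ℕ → ℝ) × ℝ
  | 0, _ => (0, 0)
  | k + 1, x =>
    (Function.update (walkState N μ σ k (Fin.init x)).1 k ((walkState N μ σ k (Fin.init x)).2 +
      (x (Fin.last k) - μ k (walkState N μ σ k (Fin.init x))) /
        σ k (walkState N μ σ k (Fin.init x)) / N),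
      (walkState N μ σ k (Fin.init x)).2 +
      (x (Fin.last k) - μ k (walkState N μ σ k (Fin.init x))) /
        σ k (walkState N μ σ k (Fin.init x)) / N)

lemma continuous_walkState {N : ℝ} {μ σ : ℕ → (ℕ → ℝ) × ℝ → ℝ} (hμ : ∀ k, Continuous (μ k))
    (hσ : ∀ k, Continuous (σ k)) (hσ0 : ∀ k q, σ k q ≠ 0) (k : ℕ) :
    Continuous (walkState N μ σ k) := by
  induction k with
  | zero => exact continuous_const
  | succ k ih =>
    have hi : Continuous fun x : Fin (k + 1) → ℝ => walkState N μ σ k (Fin.init x) :=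
      ih.comp (by unfold Fin.init; fun_prop)
    have hc : Continuous fun x : Fin (k + 1) → ℝ => (walkState N μ σ k (Fin.init x)).2 +
        (x (Fin.last k) - μ k (walkState N μ σ k (Fin.init x))) /
        σ k (walkState N μ σ k (Fin.init x)) / N := by
      refine (continuous_snd.comp hi).add (Continuous.div_const (Continuous.div ?_ ?_ ?_) _)
      · exact (continuous_apply _).sub ((hμ k).comp hi)
      · exact (hσ k).comp hi
      · exact fun x => hσ0 k _
    exact ((continuous_fst.comp hi).update k hc).prodMk hc

lemma snoc_firstVars {Ω : Type*} (X : ℕ → Ω → ℝ) (k : ℕ) (ω : Ω) :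
    (Fin.snoc (firstVars X k ω) (X k ω) : Fin (k + 1) → ℝ) = firstVars X (k + 1) ω := by
  conv_rhs => rw [← Fin.snoc_init_self (firstVars X (k + 1) ω)]
  rfl

/-- Coordinate `i` of the recorded path is the position at time `i + 1`, hence the sum of `i + 1`
steps; the position at time `0` is not recorded. -/
lemma walkState_firstVars {Ω : Type*} (X : ℕ → Ω → ℝ) (N : ℝ) (μ σ : ℕ → (ℕ → ℝ) × ℝ → ℝ)
    (ω : Ω) (w : ℕ → ℝ)
    (hw : ∀ k, w k = (X k ω - μ k (walkState N μ σ k (firstVars X k ω))) /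
      σ k (walkState N μ σ k (firstVars X k ω)) / N) (k : ℕ) :
    (walkState N μ σ k (firstVars X k ω)).2 = ∑ j ∈ Finset.range k, w j ∧
    ∀ i < k, (walkState N μ σ k (firstVars X k ω)).1 i = ∑ j ∈ Finset.range (i + 1), w j := by
  induction k with
  | zero => exact ⟨by simp [walkState], by simp⟩
  | succ k ih =>
    have e : (walkState N μ σ (k + 1) (firstVars X (k + 1) ω)).2 =
        ∑ j ∈ Finset.range (k + 1), w j := by
      rw [Finset.sum_range_succ, ← ih.1, hw k]
      rfl
    refine ⟨e, fun i hi => ?_⟩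
    have e' : (walkState N μ σ (k + 1) (firstVars X (k + 1) ω)).1 =
      Function.update (walkState N μ σ k (firstVars X k ω)).1 k
        (walkState N μ σ (k + 1) (firstVars X (k + 1) ω)).2 := rfl
    rw [e', e]
    rcases Nat.lt_succ_iff_lt_or_eq.1 hi with hi | rfl
    · rw [Function.update_of_ne hi.ne]
      exact ih.2 i hi
    · rw [Function.update_self]

/-! ### Exchange of steps under the sublinear expectation -/

namespace SublinearExpectation

variable {Ω : Type*} {𝔼 : SublinearExpectation Ω} {X₀ : Ω → ℝ} {X : ℕ → Ω → ℝ}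

/-- The independence axiom contains a membership clause; it is applied to a test function that
ignores the second variable. -/
lemma IIDWith.mem_of_continuous (h : 𝔼.IIDWith X₀ X) {k : ℕ} (hk : 1 ≤ k) {ψ : (Fin k → ℝ) → ℝ}
    (hc : Continuous ψ) (hb : ∀ x, ψ x ∈ Set.Icc (0 : ℝ) 1) :
    (fun ω => ψ (firstVars X k ω)) ∈ 𝔼.H :=
  (h.1 k hk (BoundedContinuousFunction.ofNormedAddCommGroup (fun q : (Fin k → ℝ) × ℝ => ψ q.1)
    (hc.comp continuous_fst) 1 fun q => abs_le.2 ⟨by linarith [(hb q.1).1], (hb q.1).2⟩)).1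

lemma SameDistrib.mem_and_eq {Y : Ω → ℝ} (h : 𝔼.SameDistrib Y X₀) {ψ : ℝ → ℝ}
    (hc : Continuous ψ) (hb : ∀ x, ψ x ∈ Set.Icc (0 : ℝ) 1) :
    (fun ω => ψ (Y ω)) ∈ 𝔼.H ∧ (fun ω => ψ (X₀ ω)) ∈ 𝔼.H ∧
      𝔼.E (fun ω => ψ (Y ω)) = 𝔼.E (fun ω => ψ (X₀ ω)) :=
  h (BoundedContinuousFunction.ofNormedAddCommGroup ψ hc 1
    fun q => abs_le.2 ⟨by linarith [(hb q).1], (hb q).2⟩)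

/-- A bound for one step of a sequence of functions of i.i.d. variables adds up. -/
lemma IIDWith.E_le_add (h : 𝔼.IIDWith X₀ X) (v : (k : ℕ) → (Fin k → ℝ) → ℝ)
    (hc : ∀ k, Continuous (v k)) (hb : ∀ k x, v k x ∈ Set.Icc (0 : ℝ) 1) (n : ℕ) (r : ℝ)
    (hstep : ∀ k < n, ∀ x : Fin k → ℝ,
      𝔼.E (fun ω => v (k + 1) (Fin.snoc x (X₀ ω))) ≤ v k x + r) (x₀ : Fin 0 → ℝ) (k : ℕ)
    (hk : k ≤ n) : 𝔼.E (fun ω => v k (firstVars X k ω)) ≤ v 0 x₀ + k * r := by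
  have hcs : ∀ (k : ℕ) (x : Fin k → ℝ), Continuous fun t : ℝ => v (k + 1) (Fin.snoc x t) :=
    fun k x => (hc (k + 1)).comp (Continuous.finSnoc (by fun_prop) continuous_id)
  have hX : ∀ k < n, ∀ x : Fin k → ℝ,
      𝔼.E (fun ω => v (k + 1) (Fin.snoc x (X k ω))) ≤ v k x + r := fun k hk x => by
    rw [((h.2 k).mem_and_eq (hcs k x) fun _ => hb _ _).2.2]
    exact hstep k hk x
  induction k with
  | zero =>
    rw [Nat.cast_zero, zero_mul, add_zero, show (fun ω => v 0 (firstVars X 0 ω)) = fun _ => v 0 x₀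
      from funext fun ω => congrArg _ (Subsingleton.elim _ _), 𝔼.const]
  | succ k ih =>
    have ih := ih (by omega)
    simp_rw [← snoc_firstVars]
    -- Independence is only postulated from the second variable on. The first step conditions on
    -- nothing and needs identical distribution alone.
    rcases Nat.eq_zero_or_pos k with rfl | hk0
    · rw [show (fun ω => v (0 + 1) (Fin.snoc (firstVars X 0 ω) (X 0 ω))) =
        fun ω => v (0 + 1) (Fin.snoc x₀ (X 0 ω)) from
        funext fun ω => by rw [Subsingleton.elim (firstVars X 0 ω) x₀]]
      refine (hX 0 hk x₀).trans_eq ?_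
      push_cast
      ring
    · obtain ⟨-, h2, h3⟩ := h.1 k hk0 (BoundedContinuousFunction.ofNormedAddCommGroup
        (fun q : (Fin k → ℝ) × ℝ => v (k + 1) (Fin.snoc q.1 q.2))
        ((hc (k + 1)).comp (Continuous.finSnoc continuous_fst continuous_snd)) 1
        fun q => abs_le.2 ⟨by linarith [(hb (k + 1) (Fin.snoc q.1 q.2)).1], (hb _ _).2⟩)
      simp only [BoundedContinuousFunction.coe_ofNormedAddCommGroup] at h2 h3
      have hm := h.mem_of_continuous hk0 (hc k) (hb k)
      rw [h3]
      refine (𝔼.mono _ h2 _ (𝔼.add_const_mem hm r) fun ω => hX k hk _).trans ?_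
      rw [𝔼.E_add_const hm]
      push_cast
      linarith

lemma upperProb_le_of_nonneg (n : ℕ) (A : Set Ω) {ψ : (Fin n → ℝ) → ℝ}
    (hm : (fun ω => ψ (firstVars X n ω)) ∈ 𝔼.H)
    (h : ∀ ω, A.indicator (fun _ => (1 : ℝ)) ω ≤ ψ (firstVars X n ω)) :
    𝔼.upperProb X n A ≤ 𝔼.E (fun ω => ψ (firstVars X n ω)) := by
  refine csInf_le ⟨0, ?_⟩ ⟨ψ, hm, h, rfl⟩
  rintro _ ⟨ψ', hm', h', rfl⟩
  exact 𝔼.E_nonneg hm' fun ω => (Set.indicator_nonneg (fun _ _ => zero_le_one) ω).trans (h' ω)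

lemma upperProb_nonneg (n : ℕ) (A : Set Ω) : 0 ≤ 𝔼.upperProb X n A := by
  refine Real.sInf_nonneg ?_
  rintro _ ⟨ψ', hm', h', rfl⟩
  exact 𝔼.E_nonneg hm' fun ω => (Set.indicator_nonneg (fun _ _ => zero_le_one) ω).trans (h' ω)

lemma upperProb_le_one (n : ℕ) (A : Set Ω) : 𝔼.upperProb X n A ≤ 1 := by
  have := upperProb_le_of_nonneg (𝔼 := 𝔼) (X := X) n A (ψ := fun _ => 1) (𝔼.const_mem 1)
    (Set.indicator_le_self' fun _ _ => zero_le_one)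
  rwa [𝔼.const] at this

/-- One step of the game: with the nearly optimal centering and scaling, the value under the
sublinear expectation exceeds the Gaussian one only by the Taylor remainders. -/
lemma exists_step_bound (h : 𝔼.NonDegenerate X₀) {p N : ℝ} (hp : p ∈ Set.Icc (2 : ℝ) 3)
    (hN : 1 ≤ N) {Γ : ℝ} (hΓ : 𝔼.gammaTrunc X₀ p N < ENNReal.ofReal Γ) :
    ∃ C : ℝ, ∀ τ > 0, ∀ a > 0, 3 * a ≤ 1 → ∀ q : ℝ → ℝ, Continuous q →
      (∀ x, q x ∈ Set.Icc (0 : ℝ) 1) → ∀ c : ℝ, ∀ G : Ω → ℝ, G ∈ 𝔼.H →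
      (∀ ω, G ω ≤ tripleAvg a q (c + (X₀ ω - 𝔼.centering X₀ τ (tripleDeriv a q c)) /
        𝔼.scaling X₀ τ (tripleDeriv₂ a q c) (𝔼.centering X₀ τ (tripleDeriv a q c)) / N)) →
      𝔼.E G ≤ tripleAvg a q c + tripleDeriv₂ a q c / (2 * N ^ 2) + τ * C +
        4.5 * (3 * a) ^ (-p) * N ^ (-p) * Γ := by
  obtain ⟨C, hC⟩ := h.exists_quadratic_bound
  refine ⟨C, fun τ hτ a ha ha1 q hq hqb c G hG hGle => ?_⟩
  have hN0 : 0 < N := one_pos.trans_le hN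
  obtain ⟨hm, hE⟩ := hC τ hτ (tripleDeriv a q c) (tripleDeriv₂ a q c) N hN
  set m := 𝔼.centering X₀ τ (tripleDeriv a q c)
  set s := 𝔼.scaling X₀ τ (tripleDeriv₂ a q c) m with hs
  have hmm : m ∈ 𝔼.meanSet X₀ := centering_mem h.1 τ _
  have hl := h.lowerSD_pos hmm
  have hls : 𝔼.lowerSD X₀ m ≤ s := (scaling_mem h.1 h.2.1 τ _ m).1
  -- The truncated moment is an outer expectation and its integrand need not lie in `H`. The strict
  -- bound by `Γ` yields a majorant in `H` to compute with.
  obtain ⟨Z, hZ, hZle, hZE⟩ : ∃ Z ∈ 𝔼.H, (∀ ω, min (|𝔼.xiZero X₀ m ω| ^ p)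
      (N ^ (p - 2) * 𝔼.xiZero X₀ m ω ^ 2) ≤ Z ω) ∧ 𝔼.E Z ≤ Γ := by
    have h1 := (le_iSup₂ (f := fun μ (_ : μ ∈ 𝔼.meanSet X₀) => 𝔼.upperE (fun ω =>
      min (|𝔼.xiZero X₀ μ ω| ^ p) (N ^ (p - 2) * 𝔼.xiZero X₀ μ ω ^ 2))) m hmm).trans_lt hΓ
    unfold upperE at h1
    simp only [iInf_lt_iff] at h1
    obtain ⟨Z, hZ, hZle, hlt⟩ := h1
    refine ⟨Z, hZ, hZle, ?_⟩
    by_contra hcon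
    exact absurd hlt (not_lt.2 (ENNReal.ofReal_le_ofReal (not_le.1 hcon).le))
  set K := 4.5 * (3 * a) ^ (-p) * N ^ (-p) with hK
  have hK0 : 0 ≤ K := by positivity
  have hle : ∀ ω, G ω ≤ ((tripleDeriv a q c * ((X₀ ω - m) / s / N) +
      tripleDeriv₂ a q c * ((X₀ ω - m) / s / N) ^ 2 / 2) + K * Z ω) + tripleAvg a q c := fun ω => by
    have t1 := tripleAvg_taylor_upper ha hq hqb c ((X₀ ω - m) / s / N)
    have t2 := min_cube_sq_le (u := (X₀ ω - m) / s / N) (ξ := 𝔼.xiZero X₀ m ω) ha ha1 hp hN (by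
      rw [abs_div, abs_of_pos hN0]
      unfold xiZero
      rw [abs_div, abs_div, abs_of_pos hl, abs_of_pos (hl.trans_le hls)]
      gcongr)
    rw [← hK] at t2
    have t3 : K * min (|𝔼.xiZero X₀ m ω| ^ p) (N ^ (p - 2) * 𝔼.xiZero X₀ m ω ^ 2) ≤ K * Z ω :=
      mul_le_mul_of_nonneg_left (hZle ω) hK0
    have := hGle ω
    linarith
  refine (𝔼.mono _ hG _ (𝔼.add_const_mem (𝔼.add_mem hm (𝔼.smul_mem hZ K)) _) hle).trans ?_
  rw [𝔼.E_add_const (𝔼.add_mem hm (𝔼.smul_mem hZ K))]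
  have := 𝔼.E_add_le hm (𝔼.smul_mem hZ K)
  rw [𝔼.E_mul hZ hK0] at this
  have : K * 𝔼.E Z ≤ K * Γ := by gcongr
  linarith

/-- The comparison of the controlled walk with the Gaussian-like walk of step law `γ`. -/
theorem exists_admissible_upperProb_le (h : 𝔼.NonDegenerate X₀) (hX : 𝔼.IIDWith X₀ X) {n : ℕ}
    (hn : 1 ≤ n) {p : ℝ} (hp : p ∈ Set.Icc (2 : ℝ) 3) {Γ : ℝ}
    (hΓ : 𝔼.gammaTrunc X₀ p √(n : ℝ) < ENNReal.ofReal Γ) {γ : Measure ℝ} [IsProbabilityMeasure γ]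
    (i1 : Integrable (fun η => η) γ) (i2 : Integrable (fun η => η ^ 2) γ)
    (i3 : Integrable (fun η => |η| ^ 3) γ) {m₃ : ℝ} (e1 : ∫ η, η ∂γ = 0)
    (e2 : ∫ η, η ^ 2 ∂γ = 1 / n) (e3 : ∫ η, |η| ^ 3 ∂γ ≤ m₃) {f g : (ℕ → ℝ) → ℝ}
    (hf : Continuous f) (hfb : ∀ d, f d ∈ Set.Icc (0 : ℝ) 1) (hg : Continuous g)
    (hgb : ∀ d, g d ∈ Set.Icc (0 : ℝ) 1) {δ : ℝ} (hδ : 0 < δ) (hδ1 : δ ≤ 1)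
    (hfg : ∀ d y, (∀ i < n, |d i - y i| ≤ 2 * δ) → f d ≤ g y) {ε : ℝ} (hε : 0 < ε) :
    ∃ m s : (i : Fin n) → (Fin (i : ℕ) → ℝ) → ℝ, 𝔼.Admissible X₀ n m s ∧
      ∀ A : Set Ω, (∀ ω ∈ A, ∀ d : ℕ → ℝ, (∀ i : Fin n, d i = ∑ j ∈ Finset.Iic i,
        (X j ω - m j (firstVars X j ω)) / s j (firstVars X j ω) / √(n : ℝ)) → 1 ≤ f d) →
      𝔼.upperProb X n A ≤ walkValue γ g n 0 0 0 + n * (4.5 * δ ^ (-p) * √(n : ℝ) ^ (-p) * Γ +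
        9 / 4 * m₃ / δ ^ 3) + ε := by
  set N := √(n : ℝ) with hNdef
  have hn0 : (0 : ℝ) < n := by exact_mod_cast hn
  have hN : 1 ≤ N := Real.one_le_sqrt.2 (by exact_mod_cast hn)
  have hN2 : N ^ 2 = n := Real.sq_sqrt hn0.le
  obtain ⟨C, hC⟩ := exists_step_bound h hp hN hΓ
  obtain ⟨a, ha, rfl⟩ : ∃ a, 0 < a ∧ δ = 3 * a := ⟨δ / 3, by positivity, by ring⟩
  -- The ramp width is chosen last, so that the loss from continuous controls stays below `ε` after
  -- `n` steps.
  obtain ⟨τ, hτ, hτC⟩ : ∃ τ > 0, n * (τ * C) ≤ ε := by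
    refine ⟨ε / (n * (|C| + 1)), by positivity, ?_⟩
    calc _ ≤ n * (ε / (n * (|C| + 1)) * (|C| + 1)) := by
          gcongr
          linarith [le_abs_self C]
      _ = ε := by field_simp
  -- `Q k d` is the value just after the `k`-th step and before its label is chosen. Its triple
  -- average is what both kinds of step are inserted into.
  let Q : ℕ → (ℕ → ℝ) → ℝ → ℝ := fun k =>
    relabelSup (3 * a) k (gameValue (3 * a) γ f (n - (k + 1)) (k + 1))
  have hQc : ∀ k, Continuous fun q : (ℕ → ℝ) × ℝ => Q k q.1 q.2 := fun k =>
    continuous_relabelSup k (gameValue_regular hf hfb _ _).1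
  have hQc' : ∀ k d, Continuous (Q k d) := fun k d =>
    (hQc k).comp (f := fun x : ℝ => (d, x)) (by fun_prop)
  have hQb : ∀ k d x, Q k d x ∈ Set.Icc (0 : ℝ) 1 := fun k =>
    relabelSup_mem k (gameValue_regular hf hfb _ _).2
  let μ : ℕ → (ℕ → ℝ) × ℝ → ℝ := fun k q => 𝔼.centering X₀ τ (tripleDeriv a (Q k q.1) q.2)
  let σ : ℕ → (ℕ → ℝ) × ℝ → ℝ := fun k q => 𝔼.scaling X₀ τ (tripleDeriv₂ a (Q k q.1) q.2) (μ k q)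
  have hμc : ∀ k, Continuous (μ k) := fun k =>
    (continuous_centering τ).comp (continuous_tripleDeriv_param a (hQc k))
  have hσc : ∀ k, Continuous (σ k) := fun k =>
    (continuous_scaling h.1 h.2.1 τ).comp
      ((continuous_tripleDeriv₂_param a (hQc k)).prodMk (hμc k))
  have hμm : ∀ k q, μ k q ∈ 𝔼.meanSet X₀ := fun k q => centering_mem h.1 _ _
  have hσm : ∀ k q, σ k q ∈ Set.Icc (𝔼.lowerSD X₀ (μ k q)) (𝔼.upperSD X₀ (μ k q)) :=
    fun k q => scaling_mem h.1 h.2.1 _ _ _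
  have hσ0 : ∀ k q, σ k q ≠ 0 := fun k q =>
    ((h.lowerSD_pos (hμm k q)).trans_le (hσm k q).1).ne'
  let S := walkState N μ σ
  have hS : ∀ k, Continuous (S k) := continuous_walkState hμc hσc hσ0
  -- The interpolation: the first `k` steps are controlled ones, labelled by their exact positions,
  -- and the remaining `n - k` are Gaussian steps of the game.
  let V : (k : ℕ) → (Fin k → ℝ) → ℝ := fun k x =>
    tripleAvg a (gameValue (3 * a) γ f (n - k) k (S k x).1) (S k x).2
  have hVc : ∀ k, Continuous (V k) := fun k =>
    (continuous_tripleAvg_param a (gameValue_regular hf hfb _ _).1).comp (hS k)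
  have hgc : ∀ j k d, Continuous (gameValue (3 * a) γ f j k d) := fun j k d =>
    (gameValue_regular hf hfb _ _).1.comp (f := fun x : ℝ => (d, x)) (by fun_prop)
  have hVb : ∀ k x, V k x ∈ Set.Icc (0 : ℝ) 1 := fun k x =>
    tripleAvg_mem ha (hgc _ _ _) ((gameValue_regular hf hfb _ _).2 _) _
  have hstep : ∀ k < n, ∀ x : Fin k → ℝ, 𝔼.E (fun ω => V (k + 1) (Fin.snoc x (X₀ ω))) ≤
      V k x + (4.5 * (3 * a) ^ (-p) * N ^ (-p) * Γ + m₃ / (12 * a ^ 3) + τ * C) := by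
    intro k hk x
    have hmem : (fun ω => V (k + 1) (Fin.snoc x (X₀ ω))) ∈ 𝔼.H :=
      ((hX.2 0).mem_and_eq (ψ := fun t => V (k + 1) (Fin.snoc x t))
        ((hVc (k + 1)).comp (Continuous.finSnoc (by fun_prop) continuous_id)) fun _ => hVb _ _).2.1
    have b1 := hC τ hτ a ha hδ1 (Q k (S k x).1) (hQc' _ _) (hQb _ _) (S k x).2 _ hmem
      (fun ω => by
        have := tripleAvg_gameValue_le (γ := γ) ha hf hfb (n - (k + 1)) k (S k x).1
          ((S k x).2 + (X₀ ω - μ k (S k x)) / σ k (S k x) / N)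
        refine le_of_eq_of_le ?_ this
        simp only [V, S, walkState, Fin.init_snoc, Fin.snoc_last])
    have b2 := integral_tripleAvg_ge (γ := γ) ha (hQc' k (S k x).1) (hQb k (S k x).1) (S k x).2
      (1 / n) m₃ i1 i2 i3 e1 e2 e3
    have b3 := tripleAvg_gameValue_succ (γ := γ) ha hf hfb (n - (k + 1)) k (S k x).1 (S k x).2
    have b4 : V k x = ∫ η, tripleAvg a (Q k (S k x).1) ((S k x).2 + η) ∂γ := by
      rw [← b3, show n - (k + 1) + 1 = n - k by omega]
    rw [b4]
    have b5 : tripleDeriv₂ a (Q k (S k x).1) (S k x).2 / (2 * N ^ 2) =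
      tripleDeriv₂ a (Q k (S k x).1) (S k x).2 * (1 / n) / 2 := by
      rw [hN2]
      field_simp
    rw [b5] at b1
    linarith
  have hfin := hX.E_le_add V hVc hVb n _ hstep 0 n le_rfl
  -- At time `0` the averaging acts as an initial displacement of at most `δ`, which the comparison
  -- of game and walk tolerates.
  have hV0 : V 0 0 ≤ walkValue γ g n 0 0 0 := by
    have : tripleAvg a (gameValue (3 * a) γ f n 0 0) 0 ≤
        tripleAvg a (fun _ => walkValue γ g n 0 0 0) 0 :=
      tripleAvg_mono ha (hgc _ _ _) continuous_const fun t ht =>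
        gameValue_le_walkValue hδ.le hf hfb hg hgb n hfg n 0 rfl 0 0 0 t ht (by simp)
    rwa [tripleAvg_const ha] at this
  refine ⟨fun i x => μ i (S i x), fun i x => σ i (S i x), fun i =>
    ⟨(hμc _).comp (hS _), (hσc _).comp (hS _), fun x => ⟨hμm _ _, hσm _ _⟩⟩, fun A hA => ?_⟩
  refine (upperProb_le_of_nonneg n A (hX.mem_of_continuous hn (hVc n) (hVb n)) fun ω => ?_).trans
    (hfin.trans ?_)
  · refine Set.indicator_le' (fun ω hω => ?_) (fun ω _ => (hVb _ _).1) ω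
    -- With no steps left the value does not depend on the position, so the averaging has no effect
    -- and the exact reward remains.
    have hVn : V n (firstVars X n ω) = f (S n (firstVars X n ω)).1 := by
      simp only [V, Nat.sub_self]
      exact tripleAvg_const ha _ _
    rw [hVn]
    refine hA ω hω _ fun i => ?_
    rw [(walkState_firstVars X N μ σ ω _ (fun _ => rfl) n).2 i i.2, Nat.range_succ_eq_Iic,
      ← Fin.map_valEmbedding_Iic, Finset.sum_map]
    rfl
  · have e : 9 / 4 * m₃ / (3 * a) ^ 3 = m₃ / (12 * a ^ 3) := by
      field_simp
      ring
    rw [e]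
    linarith

end SublinearExpectation

/-! ### The third absolute Gaussian moment -/

/-- The power series of `cosh` has nonnegative terms and is cut after the fourth power. -/
lemma pow_four_le_cosh (x : ℝ) : x ^ 4 ≤ 24 * (Real.cosh x - 1 - x ^ 2 / 2) := by
  have := sum_le_hasSum (Finset.range 3) (fun i _ => by
    rw [pow_mul]; positivity) (Real.hasSum_cosh x)
  simp [Finset.sum_range_succ, Nat.factorial] at this
  linarith

lemma exp_half_le : Real.exp (1 / 2) ≤ 1.65 := by
  have h : Real.exp (1 / 2) ^ 2 ≤ 1.65 ^ 2 := by
    rw [← Real.exp_nat_mul]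
    norm_num
    linarith [Real.exp_one_lt_d9]
  exact le_of_sq_le_sq h (by norm_num)

section GaussianMoments

variable (v : ℝ≥0)

lemma integrable_pow_gaussianReal (k : ℕ) : Integrable (fun x => x ^ k) (gaussianReal 0 v) :=
  ((memLp_id_gaussianReal' (k : ℝ≥0∞) (by simp)).integrable_norm_pow' (f := id)).mono'
    (by fun_prop) (Filter.Eventually.of_forall fun x => by simp)

lemma integral_sq_gaussianReal : ∫ x, x ^ 2 ∂gaussianReal 0 v = v := by
  have := variance_fun_id_gaussianReal (μ := 0) (v := v)
  rw [variance_of_integral_eq_zero (by fun_prop) (by simp)] at this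
  exact this

lemma integral_exp_mul_gaussianReal (t : ℝ) :
    ∫ x, Real.exp (t * x) ∂gaussianReal 0 v = Real.exp (v * t ^ 2 / 2) := by
  have := congrFun (mgf_fun_id_gaussianReal (μ := 0) (v := v)) t
  simpa [mgf] using this

/-- For the standardized `y`, `|y|³ ≤ (y² + y⁴)/2`, and the `cosh` bound turns this into `12 cosh y
- 12 - 11/2 y²`. As `E cosh y = exp (1/2) ≤ 1.65`, the expectation is at most `19.8 - 12 - 5.5 =
2.3`. -/
lemma integral_abs_cube_gaussianReal_le :
    ∫ x, |x| ^ 3 ∂gaussianReal 0 v ≤ 2.3 * (v * √(v : ℝ)) := by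
  rcases eq_or_ne v 0 with rfl | hv
  · simp
  have hv0 : (0 : ℝ) < v := lt_of_le_of_ne v.2 fun h => hv (NNReal.coe_eq_zero.1 h.symm)
  set r := √(v : ℝ) with hr
  have hr0 : 0 < r := Real.sqrt_pos.2 hv0
  have hr2 : r ^ 2 = v := Real.sq_sqrt hv0.le
  have hle : ∀ x : ℝ, |x| ^ 3 ≤ r ^ 3 * (12 * ((Real.exp (r⁻¹ * x) + Real.exp (-r⁻¹ * x)) / 2) - 12)
      - 11 / 2 * r * x ^ 2 := by
    intro x
    have h1 := pow_four_le_cosh (r⁻¹ * x)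
    rw [Real.cosh_eq, ← neg_mul] at h1
    set e := (Real.exp (r⁻¹ * x) + Real.exp (-r⁻¹ * x)) / 2
    set y := r⁻¹ * x with hy
    have hx : x = r * y := by rw [hy]; field_simp
    have h2 : |y| ^ 3 ≤ (y ^ 2 + y ^ 4) / 2 := by
      have a1 : y ^ 2 = |y| ^ 2 := (sq_abs y).symm
      have a2 : y ^ 4 = |y| ^ 4 := (Even.pow_abs (by decide) y).symm
      rw [a1, a2]
      nlinarith [mul_nonneg (sq_nonneg |y|) (sq_nonneg (|y| - 1))]
    rw [hx, abs_mul, abs_of_pos hr0, mul_pow, mul_pow]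
    have : r ^ 3 * |y| ^ 3 ≤ r ^ 3 * (12 * e - 12 - 11 / 2 * y ^ 2) := by
      gcongr
      linarith
    linarith
  have j1 := integrable_exp_mul_gaussianReal (μ := 0) (v := v) (r⁻¹)
  have j2 := integrable_exp_mul_gaussianReal (μ := 0) (v := v) (-r⁻¹)
  have j3 : Integrable (fun x => r ^ 3 * (12 * ((Real.exp (r⁻¹ * x) + Real.exp (-r⁻¹ * x)) / 2) - 12))
      (gaussianReal 0 v) :=
    ((((j1.add j2).div_const 2).const_mul 12).sub (integrable_const 12)).const_mul _
  have j4 : Integrable (fun x => 11 / 2 * r * x ^ 2) (gaussianReal 0 v) :=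
    (integrable_pow_gaussianReal v 2).const_mul _
  have j0 : Integrable (fun x => |x| ^ 3) (gaussianReal 0 v) := by
    simpa using (integrable_pow_gaussianReal v 3).abs
  refine (integral_mono j0 (j3.sub j4) hle).trans ?_
  have e1 := integral_sub j3 j4
  simp only [Pi.sub_apply]
  rw [e1, integral_const_mul, integral_const_mul, integral_sq_gaussianReal,
    integral_sub (f := fun x => 12 * ((Real.exp (r⁻¹ * x) + Real.exp (-r⁻¹ * x)) / 2))
      (((j1.add j2).div_const 2).const_mul 12) (integrable_const 12),
    integral_const_mul, integral_div, integral_add j1 j2, integral_exp_mul_gaussianReal, integral_exp_mul_gaussianReal, ← hr2]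
  have e3 : r ^ 2 * r⁻¹ ^ 2 / 2 = 1 / 2 := by field_simp
  have e4 : r ^ 2 * (-r⁻¹) ^ 2 / 2 = 1 / 2 := by field_simp
  rw [e3, e4]
  simp only [integral_const, probReal_univ, one_smul]
  have := exp_half_le
  have : r ^ 3 * (12 * Real.exp (1 / 2)) ≤ r ^ 3 * (12 * 1.65) := by gcongr
  nlinarith

end GaussianMoments

/-! ### Increments and maximal inequality of the Wiener process -/

namespace IsWienerProcess

variable {Ω' : Type*} [MeasurableSpace Ω'] {P' : Measure Ω'}
  {B : Ω' → C(unitInterval, ℝ)}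

lemma aemeasurable (hB : IsWienerProcess P' B) (t : unitInterval) :
    AEMeasurable (fun ω => B ω t) P' := (hB.law t).aemeasurable

lemma map_eval (hB : IsWienerProcess P' B) (t : unitInterval) :
    P'.map (fun ω => B ω t) = gaussianReal 0 (Real.toNNReal t) := by
  rw [(hB.law t).map_eq]
  congr 1
  exact NNReal.eq (max_eq_left t.2.1).symm

lemma ae_zero (hB : IsWienerProcess P' B) : ∀ᵐ ω ∂P', B ω 0 = 0 := by
  have h1 : ∀ᵐ x ∂(P'.map fun ω => B ω 0), x = 0 := by
    rw [hB.map_eval]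
    simp [ae_dirac_eq]
  exact ae_of_ae_map (hB.aemeasurable 0) h1

lemma neg (hB : IsWienerProcess P' B) : IsWienerProcess P' (fun ω => -B ω) where
  indep := by
    have := hB.indep.neg
    exact this
  law t := by
    refine ⟨(hB.aemeasurable t).neg, ?_⟩
    have h1 := gaussianReal_map_neg (μ := 0) (v := Real.toNNReal t)
    rw [← hB.map_eval, AEMeasurable.map_map_of_aemeasurable (by fun_prop)
      (hB.aemeasurable t), neg_zero, ← hB.map_eval, (hB.law t).map_eq] at h1
    exact h1

variable [IsProbabilityMeasure P']

/-- `B t` is the sum of the independent variables `B s` and `B t - B s`; since the characteristic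
function of `B s` has no zeros, that of the increment is obtained by division. -/
lemma hasLaw_sub (hB : IsWienerProcess P' B) {s t : unitInterval} (hst : s ≤ t) :
    HasLaw (fun ω => B ω t - B ω s) (gaussianReal 0 (Real.toNNReal (t - s))) P' where
  aemeasurable := (hB.aemeasurable t).sub (hB.aemeasurable s)
  map_eq := by
    have hi := hB.indep.indepFun_eval_sub (bot_le : (⊥ : unitInterval) ≤ s) hst
      hB.ae_zero
    have h1 := hi.charFun_map_add_eq_mul (hB.aemeasurable s)
      ((hB.aemeasurable t).sub (hB.aemeasurable s))
    have e : ((fun ω => B ω s) + ((fun ω => B ω t) - fun ω => B ω s)) = fun ω => B ω t := by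
      funext ω
      simp
    rw [e, hB.map_eval, hB.map_eval] at h1
    have hms : AEMeasurable (fun ω => B ω t - B ω s) P' :=
      (hB.aemeasurable t).sub (hB.aemeasurable s)
    have := Measure.isProbabilityMeasure_map hms
    refine Measure.ext_of_charFun (funext fun x => ?_)
    have h2 := congrFun h1 x
    rw [Pi.mul_apply, charFun_gaussianReal, charFun_gaussianReal] at h2
    change _ = _ * charFun (P'.map fun ω => B ω t - B ω s) x at h2
    rw [charFun_gaussianReal, ← mul_right_inj' (Complex.exp_ne_zero _), ← h2, ← Complex.exp_add]
    congr 1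
    have hts : (s : ℝ) ≤ t := hst
    rw [Real.coe_toNNReal (t - s : ℝ) (by linarith), Real.coe_toNNReal _ s.2.1,
      Real.coe_toNNReal _ t.2.1]
    push_cast
    ring

/-- The exponential maximal inequality along a sequence of times. -/
lemma measure_max_le (hB : IsWienerProcess P' B) {t : ℕ → unitInterval} (ht : Monotone t) (N : ℕ)
    (a lam : ℝ) (hlam : 0 < lam) :
    P' {ω | ∃ k ≤ N, a ≤ B ω (t (k + 1)) - B ω (t 0)} ≤
      ENNReal.ofReal (Real.exp (lam ^ 2 * (t (N + 1) - t 0) / 2 - lam * a)) := by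
  let ξ : ℕ → Ω' → ℝ := fun i ω => B ω (t (i + 1)) - B ω (t i)
  have hξm : ∀ i, AEMeasurable (ξ i) P' := fun i =>
    (hB.aemeasurable _).sub (hB.aemeasurable _)
  -- `B` is only almost everywhere measurable, while a natural filtration needs measurable
  -- variables, so the increments are replaced by measurable versions.
  let η : ℕ → Ω' → ℝ := fun i => (hξm i).mk
  have hη : ∀ i, StronglyMeasurable (η i) := fun i => (hξm i).measurable_mk.stronglyMeasurable
  have hξη : ∀ i, ξ i =ᵐ[P'] η i := fun i => (hξm i).ae_eq_mk
  have hind : iIndepFun η P' := (hB.indep.nat ht).congr hξη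
  have hsum : ∀ᵐ ω ∂P', ∀ k, ∑ i ∈ Finset.range (k + 1), η i ω = B ω (t (k + 1)) - B ω (t 0) := by
    filter_upwards [ae_all_iff.2 hξη] with ω hω k
    rw [← Finset.sum_range_sub (fun i => B ω (t i))]
    exact Finset.sum_congr rfl fun i _ => (hω i).symm
  let M : ℕ → Ω' → ℝ := fun k ω => Real.exp (lam * ∑ i ∈ Finset.range (k + 1), η i ω)
  have hlaw : ∀ k, HasLaw (fun ω => ∑ i ∈ Finset.range (k + 1), η i ω)
      (gaussianReal 0 (Real.toNNReal (t (k + 1) - t 0))) P' := fun k =>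
    (hB.hasLaw_sub (ht (Nat.zero_le (k + 1)))).congr (by filter_upwards [hsum] with ω h using h k)
  have hMint : ∀ k, Integrable (M k) P' := fun k => by
    have := integrable_exp_mul_gaussianReal (μ := 0)
      (v := Real.toNNReal (t (k + 1) - t 0)) lam
    rw [← (hlaw k).map_eq] at this
    exact this.comp_aemeasurable (hlaw k).aemeasurable
  have hlawη : ∀ k, HasLaw (η k) (gaussianReal 0 (Real.toNNReal (t (k + 1) - t k))) P' := fun k =>
    (hB.hasLaw_sub (ht (Nat.le_succ k))).congr (hξη k).symm
  have hEint : ∀ k, Integrable (fun ω => Real.exp (lam * η k ω)) P' := fun k => by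
    have := integrable_exp_mul_gaussianReal (μ := 0)
      (v := Real.toNNReal (t (k + 1) - t k)) lam
    rw [← (hlawη k).map_eq] at this
    exact this.comp_aemeasurable (hlawη k).aemeasurable
  let 𝒢 := Filtration.natural η hη
  have hMad : StronglyAdapted 𝒢 M := fun k => by
    refine Real.continuous_exp.comp_stronglyMeasurable (StronglyMeasurable.const_mul ?_ lam)
    refine Finset.stronglyMeasurable_fun_sum _ fun i hi => ?_
    exact (Filtration.stronglyAdapted_natural hη i).mono
      (𝒢.mono (Nat.lt_succ_iff.1 (Finset.mem_range.1 hi)))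
  have hsub : Submartingale M 𝒢 P' := by
    refine submartingale_nat hMad hMint fun k => ?_
    have hprod : M (k + 1) = M k * fun ω => Real.exp (lam * η (k + 1) ω) := by
      funext ω
      simp only [M, Pi.mul_apply]
      rw [← Real.exp_add, Finset.sum_range_succ _ (k + 1), mul_add]
    have h1 := condExp_mul_of_stronglyMeasurable_left (μ := P') (hMad k)
      (by rw [← hprod]; exact hMint (k + 1)) (hEint (k + 1))
    have h2 : P'[fun ω => Real.exp (lam * η (k + 1) ω) | 𝒢 k] =ᵐ[P'] fun _ =>
        ∫ ω, Real.exp (lam * η (k + 1) ω) ∂P' := by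
      refine condExp_indep_eq (hη (k + 1)).measurable.comap_le (𝒢.le k) ?_
        (hind.indep_comap_natural_of_lt hη (Nat.lt_succ_self k))
      exact Real.continuous_exp.comp_stronglyMeasurable
        ((comap_measurable (η (k + 1))).stronglyMeasurable.const_mul lam)
    rw [hprod]
    filter_upwards [h1, h2] with ω h1 h2
    rw [h1, Pi.mul_apply, h2]
    -- The next factor is independent of the past with mean at least `1`, which is the submartingale
    -- property needed for Doob's inequality.
    have h3 : 1 ≤ ∫ ω, Real.exp (lam * η (k + 1) ω) ∂P' := by
      have e := integral_map (hlawη (k + 1)).aemeasurable (f := fun x => Real.exp (lam * x))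
        (by fun_prop)
      rw [← e, (hlawη (k + 1)).map_eq, integral_exp_mul_gaussianReal]
      exact Real.one_le_exp (by positivity)
    exact le_mul_of_one_le_right (Real.exp_pos _).le h3
  have hmax := maximal_ineq hsub (fun k ω => (Real.exp_pos _).le)
    (ε := (Real.exp (lam * a)).toNNReal) N
  have hEN : ∫ ω, M N ω ∂P' = Real.exp (lam ^ 2 * (t (N + 1) - t 0) / 2) := by
    have e := integral_map (hlaw N).aemeasurable (f := fun x => Real.exp (lam * x)) (by fun_prop)
    have h0 : ((t 0 : unitInterval) : ℝ) ≤ t (N + 1) := ht (Nat.zero_le _)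
    rw [← e, (hlaw N).map_eq, integral_exp_mul_gaussianReal, Real.coe_toNNReal _ (by linarith)]
    congr 1
    ring
  have hle : P' {ω | ∃ k ≤ N, a ≤ B ω (t (k + 1)) - B ω (t 0)} ≤
      P' {ω | ((Real.exp (lam * a)).toNNReal : ℝ) ≤
        (Finset.range (N + 1)).sup' Finset.nonempty_range_add_one fun k => M k ω} := by
    refine measure_mono_ae ?_
    filter_upwards [hsum] with ω hω
    rintro ⟨k, hk, hak⟩
    refine (Finset.le_sup'_iff _).2 ⟨k, Finset.mem_range.2 (by omega), ?_⟩
    rw [Real.coe_toNNReal _ (Real.exp_pos _).le]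
    simp only [M, hω k]
    gcongr
  refine hle.trans ?_
  rw [Real.exp_sub, ENNReal.ofReal_div_of_pos (Real.exp_pos _), ENNReal.le_div_iff_mul_le
    (Or.inl (by simp [Real.exp_pos])) (Or.inl ENNReal.ofReal_ne_top), mul_comm]
  refine hmax.trans (ENNReal.ofReal_le_ofReal ?_)
  rw [← hEN]
  exact setIntegral_le_integral (hMint N) (Filter.Eventually.of_forall fun ω => (Real.exp_pos _).le)

end IsWienerProcess

lemma integral_comp_prodMk_of_indepFun {Ω' β : Type*} [MeasurableSpace Ω'] {P' : Measure Ω'}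
    [IsProbabilityMeasure P'] [TopologicalSpace β] [SecondCountableTopology β] [MeasurableSpace β]
    [BorelSpace β] {U : Ω' → β} {V : Ω' → ℝ} (hU : AEMeasurable U P') (hV : AEMeasurable V P')
    (h : IndepFun U V P') {F : β × ℝ → ℝ} (hF : Continuous F) (hb : ∀ q, F q ∈ Set.Icc (0 : ℝ) 1) :
    ∫ ω, F (U ω, V ω) ∂P' = ∫ ω, ∫ v, F (U ω, v) ∂(P'.map V) ∂P' := by
  have := Measure.isProbabilityMeasure_map hU
  have := Measure.isProbabilityMeasure_map hV
  have hF' : StronglyMeasurable F := hF.measurable.stronglyMeasurable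
  rw [← integral_map (f := F) (hU.prodMk hV) hF'.aestronglyMeasurable,
    (indepFun_iff_map_prod_eq_prod_map_map hU hV).1 h, integral_prod]
  · rw [integral_map hU]
    exact hF'.integral_prod_right'.aestronglyMeasurable
  · refine Integrable.of_bound (C := 1) hF'.aestronglyMeasurable ?_
    exact Filter.Eventually.of_forall fun q => abs_le.2 ⟨by linarith [(hb q).1], (hb q).2⟩

/-! ### The Gaussian walk realized by independent variables, and oscillation over an interval -/

/-- The partial sums of `z` up to the `k`-th one (followed by zeros) and the `k`-th one. -/
noncomputable def partialPath (k : ℕ) (z : ℕ → ℝ) : (ℕ → ℝ) × ℝ :=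
  (fun i => if i < k then ∑ j ∈ Finset.range (i + 1), z j else 0, ∑ j ∈ Finset.range k, z j)

lemma update_partialPath (k : ℕ) (z : ℕ → ℝ) :
    Function.update (partialPath k z).1 k ((partialPath k z).2 + z k) =
      (partialPath (k + 1) z).1 := by
  funext i
  rcases lt_trichotomy i k with h | rfl | h
  · rw [Function.update_of_ne h.ne]
    simp only [partialPath]
    rw [if_pos h, if_pos (by omega)]
  · rw [Function.update_self]
    simp only [partialPath]
    rw [if_pos (by omega), Finset.sum_range_succ]
  · rw [Function.update_of_ne h.ne']
    simp only [partialPath]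
    rw [if_neg (by omega), if_neg (by omega)]

lemma indepFun_partialPath {Ω' : Type*} [MeasurableSpace Ω'] {P' : Measure Ω'}
    [IsProbabilityMeasure P'] {ξ : ℕ → Ω' → ℝ} (hm : ∀ i, AEMeasurable (ξ i) P')
    (hi : iIndepFun ξ P') (k : ℕ) :
    AEMeasurable (fun ω => partialPath k (fun i => ξ i ω)) P' ∧
    IndepFun (fun ω => partialPath k (fun i => ξ i ω)) (ξ k) P' := by
  have h := hi.indepFun_finset₀ (Finset.range k) {k} (by simp) hm
  have hΦ : Measurable fun u : Finset.range k → ℝ =>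
      partialPath k (fun i => if hi : i ∈ Finset.range k then u ⟨i, hi⟩ else 0) := by
    have h0 : ∀ i, Measurable fun u : Finset.range k → ℝ =>
        if hi : i ∈ Finset.range k then u ⟨i, hi⟩ else 0 := by
      intro i
      by_cases hi : i ∈ Finset.range k
      · simp only [hi, dif_pos]
        exact measurable_pi_apply _
      · simp only [hi, dif_neg, not_false_eq_true]
        exact measurable_const
    refine Measurable.prodMk (measurable_pi_iff.2 fun i => ?_)
      (Finset.measurable_sum _ fun j _ => h0 j)
    by_cases hi : i < k
    · simp only [hi, if_true]
      exact Finset.measurable_sum _ fun j _ => h0 j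
    · simp only [hi, if_false]
      exact measurable_const
  have hΨ : Measurable fun u : ({k} : Finset ℕ) → ℝ => u ⟨k, by simp⟩ := measurable_pi_apply _
  have e : (fun u : Finset.range k → ℝ =>
      partialPath k (fun i => if hi : i ∈ Finset.range k then u ⟨i, hi⟩ else 0)) ∘
      (fun ω (i : Finset.range k) => ξ i ω) = fun ω => partialPath k (fun i => ξ i ω) := by
    funext ω
    have hs : ∀ m ≤ k, ∑ j ∈ Finset.range m,
        (if hi : j ∈ Finset.range k then ξ ((⟨j, hi⟩ : Finset.range k) : ℕ) ω else 0) =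
        ∑ j ∈ Finset.range m, ξ j ω := fun m hm => Finset.sum_congr rfl fun j hj => by
      rw [dif_pos (Finset.mem_range.2 ((Finset.mem_range.1 hj).trans_le hm))]
    simp only [Function.comp_apply, partialPath]
    refine Prod.ext (funext fun i => ?_) (hs k le_rfl)
    by_cases hi : i < k
    · simp only [hi, if_true]
      exact hs _ hi
    · simp only [hi, if_false]
  refine ⟨?_, ?_⟩
  · rw [← e]
    exact hΦ.comp_aemeasurable (aemeasurable_pi_lambda _ fun i => hm i)
  · have := h.comp hΦ hΨ
    rw [e] at this
    exact this

/-- `walkValue` is the expectation of `g` at the path of partial sums of independent variables of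
law `γ`. -/
lemma walkValue_eq_integral {Ω' : Type*} [MeasurableSpace Ω'] {P' : Measure Ω'}
    [IsProbabilityMeasure P'] {ξ : ℕ → Ω' → ℝ} (hm : ∀ i, AEMeasurable (ξ i) P')
    (hi : iIndepFun ξ P') {γ : Measure ℝ} [IsProbabilityMeasure γ] {n : ℕ}
    (hγ : ∀ k < n, P'.map (ξ k) = γ) {g : (ℕ → ℝ) → ℝ} (hg : Continuous g)
    (hgb : ∀ d, g d ∈ Set.Icc (0 : ℝ) 1) :
    walkValue γ g n 0 0 0 = ∫ ω, g (partialPath n (fun i => ξ i ω)).1 ∂P' := by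
  -- Each unfolding of `walkValue` averages over the next step, which is independent of the path so
  -- far. The integral at time `k` therefore does not depend on `k`.
  have key : ∀ j k, j + k = n → ∫ ω, walkValue γ g j k (partialPath k (fun i => ξ i ω)).1
      (partialPath k (fun i => ξ i ω)).2 ∂P' = ∫ ω, g (partialPath n (fun i => ξ i ω)).1 ∂P' := by
    intro j
    induction j with
    | zero =>
      intro k hk
      rw [zero_add] at hk
      subst hk
      rfl
    | succ j ih =>
      intro k hk
      rw [← ih (k + 1) (by omega)]
      obtain ⟨c, b⟩ := walkValue_regular (γ := γ) hg hgb j (k + 1)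
      obtain ⟨mU, iU⟩ := indepFun_partialPath hm hi k
      have := integral_comp_prodMk_of_indepFun mU (hm k) iU
        (F := fun q : ((ℕ → ℝ) × ℝ) × ℝ => walkValue γ g j (k + 1)
          (Function.update q.1.1 k (q.1.2 + q.2)) (q.1.2 + q.2))
        (c.comp (f := fun q : ((ℕ → ℝ) × ℝ) × ℝ =>
          (Function.update q.1.1 k (q.1.2 + q.2), q.1.2 + q.2))
          (Continuous.prodMk (Continuous.update (by fun_prop) k (by fun_prop)) (by fun_prop)))
        fun _ => b _ _
      rw [hγ k (by omega)] at this
      refine this.symm.trans (integral_congr_ae (Filter.Eventually.of_forall fun ω => ?_))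
      simp only
      rw [update_partialPath k fun i => ξ i ω]
      congr 1
      simp only [partialPath, Finset.sum_range_succ]
  rw [← key n 0 rfl]
  have : ∀ z : ℕ → ℝ, partialPath 0 z = 0 := fun z => by
    ext <;> simp [partialPath]
  simp [this]

namespace IsWienerProcess

variable {Ω' : Type*} [MeasurableSpace Ω'] {P' : Measure Ω'} [IsProbabilityMeasure P']
  {B : Ω' → C(unitInterval, ℝ)}

/-- Dyadic times give an increasing sequence of events to which the discrete inequality applies with
the same bound. By continuity of the paths they exhaust the event over all times. -/
lemma measure_exists_lt_sub_le (hB : IsWienerProcess P' B) {s t : unitInterval} (hst : s < t)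
    {a : ℝ} (ha : 0 < a) :
    P' {ω | ∃ u, s ≤ u ∧ u ≤ t ∧ a < B ω u - B ω s} ≤
      ENNReal.ofReal (Real.exp (-(a ^ 2 / (2 * (t - s))))) := by
  have hst' : (0 : ℝ) < t - s := sub_pos.2 hst
  have hθ : ∀ θ ∈ Set.Icc (0 : ℝ) 1, (s : ℝ) + θ * (t - s) ∈ unitInterval := fun θ hθ => by
    have := s.2.1
    have := t.2.2
    constructor <;> nlinarith [hθ.1, hθ.2]
  have hmem : ∀ r k : ℕ, min ((k : ℝ) / 2 ^ r) 1 ∈ Set.Icc (0 : ℝ) 1 := fun r k =>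
    ⟨le_min (by positivity) zero_le_one, min_le_right _ _⟩
  let τ : ℕ → ℕ → unitInterval := fun r k => ⟨s + min ((k : ℝ) / 2 ^ r) 1 * (t - s), hθ _ (hmem r k)⟩
  have hτ : ∀ r, Monotone (τ r) := fun r k l hkl => by
    change (s : ℝ) + min ((k : ℝ) / 2 ^ r) 1 * (t - s) ≤ s + min ((l : ℝ) / 2 ^ r) 1 * (t - s)
    gcongr
  have hτ0 : ∀ r, τ r 0 = s := fun r => Subtype.ext (by simp [τ])
  have hτ1 : ∀ r, τ r (2 ^ r - 1 + 1) = t := fun r => Subtype.ext (by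
    rw [Nat.sub_add_cancel Nat.one_le_two_pow]
    simp [τ])
  have hτ2 : ∀ r k, τ (r + 1) (2 * k) = τ r k := fun r k => Subtype.ext (by
    have : ((2 * k : ℕ) : ℝ) / 2 ^ (r + 1) = k / 2 ^ r := by
      rw [pow_succ]
      push_cast
      field_simp
    simp only [τ]
    rw [this])
  let A : ℕ → Set Ω' := fun r => {ω | ∃ k ≤ 2 ^ r - 1, a ≤ B ω (τ r (k + 1)) - B ω (τ r 0)}
  have hA : Monotone A := by
    refine monotone_nat_of_le_succ fun r ω => ?_
    rintro ⟨k, hk, hak⟩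
    have := Nat.one_le_two_pow (n := r)
    refine ⟨2 * k + 1, by rw [pow_succ]; omega, ?_⟩
    rw [show 2 * k + 1 + 1 = 2 * (k + 1) by ring, hτ2, hτ0]
    rwa [hτ0] at hak
  have hsub : {ω | ∃ u, s ≤ u ∧ u ≤ t ∧ a < B ω u - B ω s} ⊆ ⋃ r, A r := by
    rintro ω ⟨u, hsu, hut, hau⟩
    have hsu' : (s : ℝ) < u := by
      refine lt_of_le_of_ne hsu fun h => ?_
      rw [Subtype.ext h, sub_self] at hau
      linarith
    have hut' : (u : ℝ) ≤ t := hut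
    set θ := ((u : ℝ) - s) / (t - s) with hθdef
    have hθ0 : 0 < θ := div_pos (by linarith) hst'
    have hθ1 : θ ≤ 1 := (div_le_one hst').2 (by linarith)
    have hceil : ∀ r : ℕ, ⌈θ * 2 ^ r⌉₊ ≤ 2 ^ r := fun r => Nat.ceil_le.2 (by
      push_cast
      exact mul_le_of_le_one_left (by positivity) hθ1)
    have hpos : ∀ r : ℕ, 0 < ⌈θ * 2 ^ r⌉₊ := fun r => Nat.ceil_pos.2 (by positivity)
    have hlim : Filter.Tendsto (fun r : ℕ => τ r ⌈θ * 2 ^ r⌉₊) Filter.atTop (nhds u) := by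
      rw [tendsto_subtype_rng]
      have h1 : Filter.Tendsto (fun r : ℕ => ((⌈θ * 2 ^ r⌉₊ : ℕ) : ℝ) / 2 ^ r) Filter.atTop
          (nhds θ) :=
        (tendsto_nat_ceil_mul_div_atTop (R := ℝ) hθ0.le).comp
          (tendsto_pow_atTop_atTop_of_one_lt (by norm_num : (1 : ℝ) < 2))
      have h2 : Filter.Tendsto (fun r : ℕ => (s : ℝ) + min (((⌈θ * 2 ^ r⌉₊ : ℕ) : ℝ) / 2 ^ r) 1 *
          (t - s)) Filter.atTop (nhds (s + min θ 1 * (t - s))) :=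
        ((h1.min tendsto_const_nhds).mul_const _).const_add _
      have e : (s : ℝ) + min θ 1 * (t - s) = u := by
        rw [min_eq_left hθ1, hθdef]
        field_simp
        ring
      rwa [e] at h2
    have hB' : Filter.Tendsto (fun r : ℕ => B ω (τ r ⌈θ * 2 ^ r⌉₊) - B ω s) Filter.atTop
        (nhds (B ω u - B ω s)) :=
      (((B ω).continuous.tendsto u).comp hlim).sub_const _
    -- The strict inequality at `u` survives at a nearby dyadic time. Rounding up keeps its index
    -- positive, as required by the form `k + 1` in the discrete event.
    obtain ⟨r, hr⟩ := (hB'.eventually (lt_mem_nhds hau)).exists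
    refine Set.mem_iUnion.2 ⟨r, ⌈θ * 2 ^ r⌉₊ - 1, Nat.sub_le_sub_right (hceil r) 1, ?_⟩
    rw [Nat.sub_add_cancel (hpos r), hτ0]
    exact hr.le
  refine (measure_mono hsub).trans ?_
  rw [hA.measure_iUnion]
  refine iSup_le fun r => ?_
  -- The parameter `a / (t - s)` minimizes the exponent `lam² (t - s) / 2 - lam * a`.
  refine (hB.measure_max_le (hτ r) (2 ^ r - 1) a (a / (t - s)) (by positivity)).trans ?_
  rw [hτ0, hτ1]
  refine ENNReal.ofReal_le_ofReal (Real.exp_le_exp.2 (le_of_eq ?_))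
  field_simp
  ring

lemma measure_exists_lt_abs_sub_le (hB : IsWienerProcess P' B) {s t : unitInterval} (hst : s < t)
    {a : ℝ} (ha : 0 < a) :
    P' {ω | ∃ u, s ≤ u ∧ u ≤ t ∧ a < |B ω u - B ω s|} ≤
      2 * ENNReal.ofReal (Real.exp (-(a ^ 2 / (2 * (t - s))))) := by
  have h1 := hB.measure_exists_lt_sub_le hst ha
  have h2 := hB.neg.measure_exists_lt_sub_le hst ha
  rw [two_mul]
  refine (measure_mono ?_).trans ((measure_union_le _ _).trans (add_le_add h1 h2))
  rintro ω ⟨u, hsu, hut, hau⟩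
  rcases lt_abs.1 hau with h | h
  · exact Or.inl ⟨u, hsu, hut, h⟩
  · refine Or.inr ⟨u, hsu, hut, ?_⟩
    simp only [ContinuousMap.neg_apply]
    linarith

end IsWienerProcess

/-! ### Broken lines, grid values and the Wiener process between grid times -/

/-- The time `k / n` (or `1` if `k > n`). -/
noncomputable def gridTime (n k : ℕ) : unitInterval :=
  ⟨min ((k : ℝ) / n) 1, le_min (by positivity) zero_le_one, min_le_right _ _⟩

lemma gridTime_mono (n : ℕ) : Monotone (gridTime n) := fun k l hkl => by
  change min ((k : ℝ) / n) 1 ≤ min ((l : ℝ) / n) 1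
  gcongr

lemma gridTime_zero (n : ℕ) : gridTime n 0 = 0 := Subtype.ext (by simp [gridTime])

lemma coe_gridTime {n k : ℕ} (hn : 1 ≤ n) (hk : k ≤ n) : (gridTime n k : ℝ) = k / n :=
  min_eq_left ((div_le_one (by exact_mod_cast hn)).2 (by exact_mod_cast hk))

lemma gridTime_lt {n k : ℕ} (hn : 1 ≤ n) (hk : k < n) : gridTime n k < gridTime n (k + 1) := by
  rw [← Subtype.coe_lt_coe, coe_gridTime hn hk.le, coe_gridTime hn hk]
  have : (0 : ℝ) < n := by exact_mod_cast hn
  push_cast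
  gcongr
  linarith

lemma gridTime_sub {n k : ℕ} (hn : 1 ≤ n) (hk : k < n) :
    ((gridTime n (k + 1) : unitInterval) : ℝ) - gridTime n k = 1 / n := by
  rw [coe_gridTime hn hk.le, coe_gridTime hn hk]
  push_cast
  ring

/-- The values of the broken lines in `D` at the times `1 / n, …, n / n`. -/
def gridValues (n : ℕ) (D : Set C(unitInterval, ℝ)) : Set (Fin n → ℝ) :=
  {P | ∃ v : Fin n → ℝ, brokenLine v ∈ D ∧ ∀ i, P i = ∑ j ∈ Finset.Iic i, v j}

lemma exists_gridTime {n : ℕ} (hn : 1 ≤ n) (t : unitInterval) :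
    ∃ k < n, gridTime n k ≤ t ∧ t ≤ gridTime n (k + 1) := by
  have hn0 : (0 : ℝ) < n := by exact_mod_cast hn
  have key : ∀ k < n, (k : ℝ) ≤ n * t → (n * t : ℝ) ≤ k + 1 →
      gridTime n k ≤ t ∧ t ≤ gridTime n (k + 1) := fun k hk h1 h2 => by
    rw [← Subtype.coe_le_coe, ← Subtype.coe_le_coe, coe_gridTime hn hk.le, coe_gridTime hn hk,
      div_le_iff₀ hn0, le_div_iff₀ hn0]
    push_cast
    constructor <;> linarith
  have h0 : (0 : ℝ) ≤ n * t := mul_nonneg hn0.le t.2.1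
  rcases t.2.2.eq_or_lt with h1 | h1
  · refine ⟨n - 1, by omega, key (n - 1) (by omega) ?_ ?_⟩
    · rw [h1, Nat.cast_sub hn]
      push_cast
      linarith
    · rw [h1, Nat.cast_sub hn]
      push_cast
      linarith
  · have hk : ⌊(n * t : ℝ)⌋₊ < n := (Nat.floor_lt h0).2 (by nlinarith)
    exact ⟨_, hk, key _ hk (Nat.floor_le h0) (Nat.lt_floor_add_one _).le⟩

lemma brokenLine_eq {n : ℕ} (v : Fin n → ℝ) (t : unitInterval) {k : ℕ}
    (h1 : (k : ℝ) ≤ n * t) (h2 : (n * t : ℝ) ≤ k + 1) :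
    brokenLine v t = (1 - (n * t - k)) * ∑ j : Fin n, (if (j : ℕ) < k then v j else 0) +
      (n * t - k) * ∑ j : Fin n, (if (j : ℕ) < k + 1 then v j else 0) := by
  change ∑ i : Fin n, v i * max 0 (min 1 ((n : ℝ) * (t : ℝ) - ((i : ℕ) : ℝ))) = _
  rw [Finset.mul_sum, Finset.mul_sum, ← Finset.sum_add_distrib]
  refine Finset.sum_congr rfl fun j _ => ?_
  rcases lt_trichotomy (j : ℕ) k with h | h | h
  · have h' : ((j : ℕ) : ℝ) + 1 ≤ k := by exact_mod_cast h
    rw [if_pos h, if_pos (by omega), min_eq_left (by linarith), max_eq_right zero_le_one]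
    ring
  · rw [if_neg (by omega), if_pos (by omega), h, min_eq_right (by linarith),
      max_eq_right (by linarith)]
    ring
  · have h' : (k : ℝ) + 1 ≤ (j : ℕ) := by exact_mod_cast h
    rw [if_neg (by omega), if_neg (by omega), min_eq_right (by linarith),
      max_eq_left (by linarith)]
    ring

/-- On a grid interval the difference is a convex combination of the two grid errors, plus the
oscillation of `b` up to `t`, minus a fraction of its increment over the interval. These contribute
`r`, `a` and `a`. -/
lemma dist_brokenLine_le {n : ℕ} (hn : 1 ≤ n) (v : Fin n → ℝ) (b : C(unitInterval, ℝ)) {r a : ℝ}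
    (hr : 0 ≤ r) (hb : b 0 = 0)
    (hv : ∀ i : Fin n, |b (gridTime n (i + 1)) - ∑ j ∈ Finset.Iic i, v j| ≤ r)
    (ha : ∀ k < n, ∀ u, gridTime n k ≤ u → u ≤ gridTime n (k + 1) →
      |b u - b (gridTime n k)| ≤ a) : dist b (brokenLine v) ≤ r + 2 * a := by
  have hn0 : (0 : ℝ) < n := by exact_mod_cast hn
  have ha0 : 0 ≤ a := (abs_nonneg _).trans (ha 0 hn _ le_rfl (gridTime_mono n (Nat.zero_le _)))
  have hv' : ∀ k ≤ n, |b (gridTime n k) - ∑ j : Fin n, (if (j : ℕ) < k then v j else 0)| ≤ r := by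
    intro k hk
    rcases k with _ | k
    · simpa [gridTime_zero, hb] using hr
    · convert hv ⟨k, hk⟩ using 3
      rw [← Finset.sum_filter]
      congr 1
      ext j
      simp [Fin.le_def]
  rw [ContinuousMap.dist_le (by positivity)]
  intro t
  obtain ⟨k, hk, h1, h2⟩ := exists_gridTime hn t
  have h1' : (k : ℝ) ≤ n * t := by
    have : (gridTime n k : ℝ) ≤ t := h1
    rw [coe_gridTime hn hk.le, div_le_iff₀ hn0] at this
    linarith
  have h2' : (n * t : ℝ) ≤ k + 1 := by
    have : (t : ℝ) ≤ gridTime n (k + 1) := h2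
    rw [coe_gridTime hn hk, le_div_iff₀ hn0] at this
    push_cast at this
    linarith
  rw [brokenLine_eq v t h1' h2', Real.dist_eq]
  set θ := (n * t - k : ℝ)
  have e1 := abs_le.1 (hv' k hk.le)
  have e2 := abs_le.1 (hv' (k + 1) hk)
  have e3 := abs_le.1 (ha k hk t h1 h2)
  have e4 := abs_le.1 (ha k hk _ (gridTime_mono n (Nat.le_succ k)) le_rfl)
  have hθ0 : 0 ≤ θ := by simp only [θ]; linarith
  have hθ1 : 0 ≤ 1 - θ := by simp only [θ]; linarith
  set P := ∑ j : Fin n, (if (j : ℕ) < k then v j else 0)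
  set P' := ∑ j : Fin n, (if (j : ℕ) < k + 1 then v j else 0)
  set x := b t
  set y := b (gridTime n k)
  set z := b (gridTime n (k + 1))
  have q : x - ((1 - θ) * P + θ * P') =
      (1 - θ) * (y - P) + θ * (z - P') + (x - y) - θ * (z - y) := by ring
  have f1 : θ * (z - y) ≤ a := by nlinarith [e4.1, e4.2]
  have f2 : -a ≤ θ * (z - y) := by nlinarith [e4.1, e4.2]
  rw [q, abs_le]
  constructor <;> nlinarith [mul_le_mul_of_nonneg_left e1.1 hθ1,
    mul_le_mul_of_nonneg_left e1.2 hθ1, mul_le_mul_of_nonneg_left e2.1 hθ0,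
    mul_le_mul_of_nonneg_left e2.2 hθ0, e3.1, e3.2]

/-- `S` may be non-measurable, so its measure is an outer measure and a measurable hull takes its
place. If `f` is not integrable, its integral is `0` and the bound still holds. -/
lemma integral_le_measureReal {Ω' : Type*} [MeasurableSpace Ω'] {P' : Measure Ω'}
    [IsProbabilityMeasure P'] {f : Ω' → ℝ} (hf : ∀ ω, f ω ∈ Set.Icc (0 : ℝ) 1) {S : Set Ω'}
    (h : ∀ ω, f ω ≠ 0 → ω ∈ S) : ∫ ω, f ω ∂P' ≤ P'.real S := by
  have hm := measurableSet_toMeasurable P' S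
  have h1 : ∫ ω, f ω ∂P' ≤ ∫ ω, (toMeasurable P' S).indicator (fun _ => (1 : ℝ)) ω ∂P' := by
    refine integral_mono_of_nonneg (Filter.Eventually.of_forall fun ω => (hf ω).1)
      ((integrable_const _).indicator hm) (Filter.Eventually.of_forall fun ω => ?_)
    by_cases hω : f ω = 0
    · simp only [hω]
      exact Set.indicator_nonneg (fun _ _ => zero_le_one) _
    · simp only [Set.indicator_of_mem (subset_toMeasurable P' S (h ω hω))]
      exact (hf ω).2
  rw [integral_indicator hm, setIntegral_const, smul_eq_mul, mul_one] at h1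
  rwa [Measure.real, measure_toMeasurable] at h1

namespace IsWienerProcess

variable {Ω' : Type*} [MeasurableSpace Ω'] {P' : Measure Ω'} [IsProbabilityMeasure P']
  {B : Ω' → C(unitInterval, ℝ)}

/-- The Gaussian walk stays near the grid values of lines in `D` with at most the probability that
`B` is near `D`, up to the oscillation of `B` between the grid times. -/
lemma walkValue_le (hB : IsWienerProcess P' B) {n : ℕ} (hn : 1 ≤ n) (D : Set C(unitInterval, ℝ))
    {r a ε : ℝ} (hr : 0 < r) (ha : 0 < a) (hε : r + 2 * a < ε) {g : (ℕ → ℝ) → ℝ} (hg : Continuous g)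
    (hgb : ∀ d, g d ∈ Set.Icc (0 : ℝ) 1)
    (hgD : ∀ d, g d ≠ 0 → (fun i : Fin n => d i) ∈ Metric.thickening r (gridValues n D)) :
    walkValue (gaussianReal 0 (1 / n : ℝ≥0)) g n 0 0 0 ≤
      P'.real {ω | B ω ∈ Metric.thickening ε D} + n * (2 * Real.exp (-(a ^ 2 * n / 2))) := by
  have hn0 : (0 : ℝ) < n := by exact_mod_cast hn
  have hm : ∀ k, AEMeasurable (fun ω => B ω (gridTime n (k + 1)) - B ω (gridTime n k)) P' :=
    fun k => (hB.aemeasurable _).sub (hB.aemeasurable _)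
  rw [walkValue_eq_integral hm (hB.indep.nat (gridTime_mono n)) (fun k hk => by
    rw [(hB.hasLaw_sub (gridTime_lt hn hk).le).map_eq, gridTime_sub hn hk]
    congr 1
    exact NNReal.eq (by simp)) hg hgb]
  let bad : ℕ → Set Ω' := fun k => {ω | ∃ u, gridTime n k ≤ u ∧ u ≤ gridTime n (k + 1) ∧
    a < |B ω u - B ω (gridTime n k)|}
  have hbad : ∀ k ∈ Finset.range n, P'.real (bad k) ≤ 2 * Real.exp (-(a ^ 2 * n / 2)) := by
    intro k hk
    have := hB.measure_exists_lt_abs_sub_le (gridTime_lt hn (Finset.mem_range.1 hk)) ha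
    rw [gridTime_sub hn (Finset.mem_range.1 hk)] at this
    have h2 := ENNReal.toReal_mono (by finiteness) this
    rw [ENNReal.toReal_mul, ENNReal.toReal_ofReal (Real.exp_pos _).le] at h2
    refine h2.trans_eq ?_
    rw [show a ^ 2 / (2 * (1 / (n : ℝ))) = a ^ 2 * n / 2 by field_simp]
    simp
  -- Where `g` does not vanish, either `B` is near `D`, or `B 0 ≠ 0` (a null event), or `B`
  -- oscillates by more than `a` within some grid interval.
  refine (integral_le_measureReal (S := {ω | B ω ∈ Metric.thickening ε D} ∪
    ({ω | B ω 0 ≠ 0} ∪ ⋃ k ∈ Finset.range n, bad k)) (fun ω => hgb _) fun ω hω => ?_).trans ?_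
  · by_contra hcon
    simp only [Set.mem_union, not_or, Set.mem_iUnion, not_exists, Set.mem_ofPred_eq, not_not,
      Finset.mem_range] at hcon
    obtain ⟨hc1, hc2, hc3⟩ := hcon
    obtain ⟨P, ⟨v, hvD, hP⟩, hdist⟩ := Metric.mem_thickening_iff.1 (hgD _ hω)
    refine hc1 (Metric.mem_thickening_iff.2 ⟨_, hvD, ?_⟩)
    refine (dist_brokenLine_le hn v (B ω) hr.le hc2 (fun i => ?_) fun k hk u h1 h2 => ?_).trans_lt hε
    · have h1 := (dist_le_pi_dist (fun i : Fin n => (partialPath n (fun i =>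
        B ω (gridTime n (i + 1)) - B ω (gridTime n i))).1 i) P i).trans hdist.le
      rw [Real.dist_eq, hP i] at h1
      simp only [partialPath, if_pos i.2] at h1
      rwa [Finset.sum_range_sub (fun i => B ω (gridTime n i)), gridTime_zero, hc2, sub_zero] at h1
    · by_contra h3
      exact hc3 k hk ⟨u, h1, h2, not_le.1 h3⟩
  · have z : P'.real {ω | B ω 0 ≠ 0} = 0 := by
      rw [Measure.real, ae_iff.1 hB.ae_zero, ENNReal.toReal_zero]
    have h1 := measureReal_union_le (μ := P') {ω | B ω ∈ Metric.thickening ε D}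
      ({ω | B ω 0 ≠ 0} ∪ ⋃ k ∈ Finset.range n, bad k)
    have h2 := measureReal_union_le (μ := P') {ω | B ω 0 ≠ 0} (⋃ k ∈ Finset.range n, bad k)
    have h3 := measureReal_biUnion_finset_le (μ := P') (Finset.range n) bad
    have h4 := h3.trans (Finset.sum_le_sum hbad)
    rw [Finset.sum_const, Finset.card_range, nsmul_eq_mul] at h4
    linarith

end IsWienerProcess

/-! ### The defect in terms of the smoothing scales -/

/-- The indicator of a neighbourhood of `E`, smoothed at the scale `κ`, as a function of the first
`n` coordinates. -/
noncomputable def pathIndicator {κ : ℝ} (hκ : 0 < κ) {n : ℕ} (E : Set (Fin n → ℝ)) (d : ℕ → ℝ) : ℝ :=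
  thickenedIndicator hκ E (fun i => d i)

section

variable {κ : ℝ} (hκ : 0 < κ) {n : ℕ} (E : Set (Fin n → ℝ))

lemma continuous_pathIndicator : Continuous (pathIndicator hκ E) := by
  unfold pathIndicator
  have := (thickenedIndicator hκ E).continuous
  fun_prop

lemma pathIndicator_mem (d : ℕ → ℝ) : pathIndicator hκ E d ∈ Set.Icc (0 : ℝ) 1 :=
  ⟨NNReal.coe_nonneg _, by exact_mod_cast thickenedIndicator_le_one hκ E _⟩

lemma pathIndicator_eq_one {d : ℕ → ℝ} (h : (fun i : Fin n => d i) ∈ E) :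
    pathIndicator hκ E d = 1 := by
  unfold pathIndicator
  rw [thickenedIndicator_one hκ E h, NNReal.coe_one]

lemma mem_thickening_of_pathIndicator_ne_zero {d : ℕ → ℝ} (h : pathIndicator hκ E d ≠ 0) :
    (fun i : Fin n => d i) ∈ Metric.thickening κ E := by
  by_contra hcon
  refine h ?_
  unfold pathIndicator
  rw [thickenedIndicator_zero hκ E hcon, NNReal.coe_zero]

end

namespace SublinearExpectation

variable {Ω Ω' : Type*} [MeasurableSpace Ω'] {P' : Measure Ω'}
  {B : Ω' → C(unitInterval, ℝ)} {𝔼 : SublinearExpectation Ω} {X₀ : Ω → ℝ} {X : ℕ → Ω → ℝ}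

lemma prokhorovDefect_le_of_admissible {n : ℕ} {D : Set C(unitInterval, ℝ)} {ε : ℝ}
    {m s : (i : Fin n) → (Fin (i : ℕ) → ℝ) → ℝ} (h : 𝔼.Admissible X₀ n m s) :
    𝔼.prokhorovDefect X₀ X n P' B D ε ≤ 𝔼.upperProb X n {ω | controlledLine X n m s ω ∈ D} -
      P'.real {ω | B ω ∈ Metric.thickening ε D} := by
  have hb : BddBelow {r : ℝ | ∃ m s : (i : Fin n) → (Fin (i : ℕ) → ℝ) → ℝ,
      𝔼.Admissible X₀ n m s ∧ r = 𝔼.upperProb X n {ω | controlledLine X n m s ω ∈ D}} := by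
    refine ⟨0, ?_⟩
    rintro _ ⟨m, s, -, rfl⟩
    exact upperProb_nonneg n _
  exact sub_le_sub_right (csInf_le hb ⟨m, s, h, rfl⟩) _

lemma prokhorovDefect_le_one (n : ℕ) (D : Set C(unitInterval, ℝ)) (ε : ℝ) :
    𝔼.prokhorovDefect X₀ X n P' B D ε ≤ 1 := by
  have h0 : (0 : ℝ) ≤ P'.real {ω | B ω ∈ Metric.thickening ε D} := measureReal_nonneg
  by_cases h : ∃ m s, 𝔼.Admissible X₀ n m s
  · obtain ⟨m, s, h⟩ := h
    have := prokhorovDefect_le_of_admissible (P' := P') (B := B) (X := X) (D := D) (ε := ε) h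
    have := upperProb_le_one (𝔼 := 𝔼) (X := X) n {ω | controlledLine X n m s ω ∈ D}
    linarith
  · have e : {r : ℝ | ∃ m s : (i : Fin n) → (Fin (i : ℕ) → ℝ) → ℝ, 𝔼.Admissible X₀ n m s ∧
        r = 𝔼.upperProb X n {ω | controlledLine X n m s ω ∈ D}} = ∅ := by
      refine Set.eq_empty_iff_forall_notMem.2 ?_
      rintro _ ⟨m, s, hms, -⟩
      exact h ⟨m, s, hms⟩
    unfold SublinearExpectation.prokhorovDefect
    -- Without admissible controls the infimum over the empty set is `0` by convention.
    rw [e, Real.sInf_empty]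
    linarith

variable [IsProbabilityMeasure P']

/-- The bound on the defect in terms of the smoothing scale `δ` and the tolerance `a` for the
oscillation of the Wiener process. -/
theorem prokhorovDefect_le (hB : IsWienerProcess P' B) (h : 𝔼.NonDegenerate X₀)
    (hX : 𝔼.IIDWith X₀ X) {n : ℕ} (hn : 1 ≤ n) {p : ℝ} (hp : p ∈ Set.Icc (2 : ℝ) 3) {Γ : ℝ}
    (hΓ : 𝔼.gammaTrunc X₀ p √(n : ℝ) < ENNReal.ofReal Γ) {δ κ a ε : ℝ} (hδ : 0 < δ) (hδ1 : δ ≤ 1)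
    (hκ : 0 < κ) (ha : 0 < a) (hε : 2 * δ + 2 * κ + 2 * a < ε) (D : Set C(unitInterval, ℝ)) :
    𝔼.prokhorovDefect X₀ X n P' B D ε ≤
      n * (4.5 * δ ^ (-p) * √(n : ℝ) ^ (-p) * Γ + 9 / 4 * (2.3 * (1 / n * (1 / √(n : ℝ)))) / δ ^ 3) +
        n * (2 * Real.exp (-(a ^ 2 * n / 2))) := by
  refine le_of_forall_pos_le_add fun η hη => ?_
  set E := gridValues n D
  set v : ℝ≥0 := 1 / n with hv
  have hvR : (v : ℝ) = 1 / n := by rw [hv]; push_cast; rfl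
  have i3 : Integrable (fun x => |x| ^ 3) (gaussianReal 0 v) := by
    simpa using (integrable_pow_gaussianReal v 3).abs
  obtain ⟨m, s, hms, hle⟩ := exists_admissible_upperProb_le h hX hn hp hΓ
    (γ := gaussianReal 0 v) (m₃ := 2.3 * (1 / n * (1 / √(n : ℝ))))
    (by simpa using integrable_pow_gaussianReal v 1) (integrable_pow_gaussianReal v 2) i3
    (by simp) (by rw [integral_sq_gaussianReal, hvR])
    (by
      refine (integral_abs_cube_gaussianReal_le v).trans_eq ?_
      rw [hvR, Real.sqrt_div zero_le_one, Real.sqrt_one])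
    -- The reward `f` is positive only within `κ` of `E`. A shift by `2δ` then stays in the `(2δ +
    -- κ)`-neighbourhood, where `g` equals `1`, and `g` vanishes outside the `(2δ +
    -- 2κ)`-neighbourhood.
    (continuous_pathIndicator hκ E) (pathIndicator_mem hκ E)
    (continuous_pathIndicator hκ (Metric.thickening (2 * δ + κ) E))
    (pathIndicator_mem hκ _) hδ hδ1
    (fun d y hdy => by
      by_cases h0 : pathIndicator hκ E d = 0
      · rw [h0]
        exact (pathIndicator_mem hκ _ _).1
      · have h1 := mem_thickening_of_pathIndicator_ne_zero hκ E h0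
        rw [pathIndicator_eq_one hκ (d := y)]
        · exact (pathIndicator_mem hκ _ _).2
        · obtain ⟨P, hP, hdP⟩ := Metric.mem_thickening_iff.1 h1
          refine Metric.mem_thickening_iff.2 ⟨P, hP, ?_⟩
          have h2 : dist (fun i : Fin n => y i) (fun i : Fin n => d i) ≤ 2 * δ :=
            (dist_pi_le_iff (by positivity)).2 fun i => by
              rw [dist_comm, Real.dist_eq]
              exact hdy i i.2
          linarith [dist_triangle (fun i : Fin n => y i) (fun i : Fin n => d i) P]) hη
  have h1 := prokhorovDefect_le_of_admissible (P' := P') (B := B) (X := X) (D := D) (ε := ε) hms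
  have h2 := hle {ω | controlledLine X n m s ω ∈ D} fun ω hω d hd => by
    rw [pathIndicator_eq_one hκ]
    exact ⟨_, hω, hd⟩
  have h3 := hB.walkValue_le hn D (r := κ + (2 * δ + κ)) (a := a) (ε := ε) (by positivity) ha
    (by linarith) (continuous_pathIndicator hκ (Metric.thickening (2 * δ + κ) E))
    (pathIndicator_mem hκ _) fun d hd => Metric.thickening_thickening_subset _ _ _
      (mem_thickening_of_pathIndicator_ne_zero hκ _ hd)
  linarith

end SublinearExpectation

/-! ### Numerical estimates for the rate -/

namespace SublinearExpectation

variable {Ω : Type*} {𝔼 : SublinearExpectation Ω} {X₀ : Ω → ℝ}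

/-- The truncated moments are bounded away from `0`. -/
lemma le_gammaTrunc (h : 𝔼.NonDegenerate X₀) {p N : ℝ} (hp : p ∈ Set.Icc (2 : ℝ) 3)
    (hN : 1 ≤ N) : ENNReal.ofReal 0.35 ≤ 𝔼.gammaTrunc X₀ p N := by
  obtain ⟨h1, h2, -⟩ := id h
  have hm : 𝔼.lowerMean X₀ ∈ 𝔼.meanSet X₀ := ⟨le_rfl, lowerMean_le_upperMean h1⟩
  set m := 𝔼.lowerMean X₀
  have hl := h.lowerSD_pos hm
  refine le_trans ?_ (le_iSup₂ (f := fun μ (_ : μ ∈ 𝔼.meanSet X₀) => 𝔼.upperE (fun ω =>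
      min (|𝔼.xiZero X₀ μ ω| ^ p) (N ^ (p - 2) * 𝔼.xiZero X₀ μ ω ^ 2))) m hm)
  refine le_iInf fun Z => le_iInf₂ fun hZ hle => ENNReal.ofReal_le_ofReal ?_
  -- The minimum dominates `0.7 ξ² - 0.35`: this is nonpositive for `ξ² ≤ 1/2`, and for larger `ξ²`
  -- both entries are at least `0.7 ξ²`. As `ξ²` has upper expectation at least `1`, the bound
  -- `0.35` follows.
  have key : ∀ ω, 0.7 / 𝔼.lowerSD X₀ m ^ 2 * (X₀ ω - m) ^ 2 + -0.35 ≤ Z ω := by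
    intro ω
    refine le_trans ?_ (hle ω)
    set ξ := 𝔼.xiZero X₀ m ω with hξ
    have e : 0.7 / 𝔼.lowerSD X₀ m ^ 2 * (X₀ ω - m) ^ 2 = 0.7 * ξ ^ 2 := by
      rw [hξ, xiZero, div_pow]
      ring
    rw [e]
    have hN' : 1 ≤ N ^ (p - 2) := Real.one_le_rpow hN (by linarith [hp.1])
    rcases le_total (ξ ^ 2) (1 / 2) with hs | hs
    · refine le_trans (by linarith) (le_min (Real.rpow_nonneg (abs_nonneg ξ) p) ?_)
      positivity
    · refine le_min ?_ (by nlinarith)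
      have hξ0 : (0.7 : ℝ) ≤ |ξ| := by
        rw [← sq_abs] at hs
        nlinarith [abs_nonneg ξ]
      have e2 : |ξ| ^ p = |ξ| ^ (p - 2) * ξ ^ 2 := by
        rw [← sq_abs ξ, ← Real.rpow_natCast, ← Real.rpow_add (by linarith)]
        norm_num
      have e3 : (0.7 : ℝ) ≤ |ξ| ^ (p - 2) := by
        calc (0.7 : ℝ) = 0.7 ^ (1 : ℝ) := (Real.rpow_one _).symm
          _ ≤ 0.7 ^ (p - 2) := Real.rpow_le_rpow_of_exponent_ge (by norm_num) (by norm_num)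
              (by linarith [hp.2])
          _ ≤ |ξ| ^ (p - 2) := Real.rpow_le_rpow (by norm_num) hξ0 (by linarith [hp.1])
      rw [e2]
      nlinarith [sq_nonneg ξ]
  have hsq := sq_sub_mem h1 h2 m
  have hE := 𝔼.mono _ (𝔼.add_const_mem (𝔼.smul_mem hsq _) _) _ hZ key
  rw [𝔼.E_add_const (𝔼.smul_mem hsq _), 𝔼.E_mul hsq (by positivity), ← upperSD_sq h1 h2] at hE
  have h3 : 𝔼.lowerSD X₀ m ^ 2 ≤ 𝔼.upperSD X₀ m ^ 2 := by
    have := lowerSD_le_upperSD h1 h2 m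
    gcongr
  have h4 : 0.7 ≤ 0.7 / 𝔼.lowerSD X₀ m ^ 2 * 𝔼.upperSD X₀ m ^ 2 := by
    rw [div_mul_eq_mul_div, le_div_iff₀ (by positivity)]
    gcongr
  linarith

end SublinearExpectation

lemma exp_neg_le (y : ℝ) (hy : 0 < y) : Real.exp (-y) ≤ 24 / y ^ 4 := by
  have h := Real.pow_div_factorial_le_exp y hy.le 4
  rw [show ((Nat.factorial 4 : ℕ) : ℝ) = 24 by norm_num [Nat.factorial]] at h
  rw [Real.exp_neg, ← inv_div]
  exact inv_anti₀ (by positivity) h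

/-- If the rate is below `1`, then `n` is large. -/
lemma inv_sqrt_le_of_rate {p x t γ₀ : ℝ} (hp : p ∈ Set.Icc (2 : ℝ) 3) (hx : 1 ≤ x) (ht : 0 < t)
    (ht1 : 4.7 * t < 1) (hγ : 0.35 ≤ γ₀) (h : t ^ (p + 1) = γ₀ * x ^ (2 - p)) :
    x⁻¹ ≤ (4.7 * t) ^ 4 / 170 := by
  have hx0 : 0 < x := one_pos.trans_le hx
  set w := t ^ 3 / 0.35 with hw
  have hw0 : 0 < w := by positivity
  have htt : t ≤ 1 / 4.7 := by rw [le_div_iff₀ (by norm_num)]; linarith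
  have hw1 : w < 1 := by
    rw [hw, div_lt_one (by norm_num)]
    calc t ^ 3 ≤ (1 / 4.7) ^ 3 := by gcongr
      _ < 0.35 := by norm_num
  have e : t ^ (p + 1) = t ^ 3 * t ^ (p - 2) := by
    rw [← Real.rpow_natCast t 3, ← Real.rpow_add ht]
    norm_num
    ring_nf
  have h1 : x⁻¹ ^ (p - 2) ≤ w * t ^ (p - 2) := by
    have e2 : x⁻¹ ^ (p - 2) = x ^ (2 - p) := by
      rw [Real.inv_rpow hx0.le, ← Real.rpow_neg hx0.le]
      ring_nf
    rw [e2]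
    have : 0.35 * x ^ (2 - p) ≤ t ^ 3 * t ^ (p - 2) := by
      rw [← e, h]
      gcongr
    rw [hw, div_mul_eq_mul_div, le_div_iff₀ (by norm_num)]
    linarith
  -- For `p = 2` the bound just proved would read `1 ≤ w`: the rate is then never below `1`.
  have hp2 : 0 < p - 2 := by
    refine lt_of_le_of_ne (by linarith [hp.1]) fun h0 => ?_
    rw [← h0, Real.rpow_zero, Real.rpow_zero] at h1
    linarith
  have h2 : x⁻¹ ^ (p - 2) ≤ (w * t) ^ (p - 2) := by
    rw [Real.mul_rpow hw0.le ht.le]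
    refine h1.trans ?_
    gcongr
    -- Since `w < 1` and `p - 2 ≤ 1`, the factor `w` can be put under the power `p - 2`. Taking
    -- roots gives `x⁻¹ ≤ w * t = t ^ 4 / 0.35`, and `4.7 ^ 4 * 0.35` exceeds `170`.
    calc w = w ^ (1 : ℝ) := (Real.rpow_one _).symm
      _ ≤ w ^ (p - 2) := Real.rpow_le_rpow_of_exponent_ge hw0 hw1.le (by linarith [hp.2])
  have h3 := (Real.rpow_le_rpow_iff (by positivity) (by positivity) hp2).1 h2
  refine h3.trans ?_
  rw [hw]
  have : 0 < t ^ 4 := by positivity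
  calc t ^ 3 / 0.35 * t = t ^ 4 / 0.35 := by ring
    _ ≤ _ := by
      rw [mul_pow, div_le_div_iff₀ (by norm_num) (by norm_num)]
      nlinarith

/-- The three error terms add up to at most the rate. -/
lemma error_le_rate {p x t γ₀ : ℝ} (hp : p ∈ Set.Icc (2 : ℝ) 3) (hx : 1 ≤ x) (ht : 0 < t)
    (ht1 : 4.7 * t < 1) (hγ : 0.35 ≤ γ₀) (h : t ^ (p + 1) = γ₀ * x ^ (2 - p)) :
    x ^ 2 * (4.5 * (0.4 * (4.7 * t)) ^ (-p) * x ^ (-p) * (1.1 * γ₀) +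
        9 / 4 * (2.3 * (1 / x ^ 2 * (1 / x))) / (0.4 * (4.7 * t)) ^ 3) +
      x ^ 2 * (2 * Real.exp (-((0.08 * (4.7 * t)) ^ 2 * x ^ 2 / 2))) ≤ 4.7 * t := by
  have hx0 : 0 < x := one_pos.trans_le hx
  have hxi := inv_sqrt_le_of_rate hp hx ht ht1 hγ h
  set ε := 4.7 * t with hε
  have hε0 : 0 < ε := by positivity
  -- The moment term: the equation for `t` removes `γ₀`, leaving `4.95 * 1.88 ^ (-p) * t`, largest
  -- at `p = 2`. With the two error terms below, `0.3 + 0.5 + 0.1` leaves room under `1`.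
  have T1 : x ^ 2 * (4.5 * (0.4 * ε) ^ (-p) * x ^ (-p) * (1.1 * γ₀)) ≤ 0.3 * ε := by
    have e1 : x ^ 2 * x ^ (-p) = x ^ (2 - p) := by
      rw [← Real.rpow_natCast, ← Real.rpow_add hx0]
      norm_num
      ring_nf
    have e2 : (0.4 * ε) ^ (-p) * t ^ (p + 1) = 1.88 ^ (-p) * t := by
      rw [hε, show 0.4 * (4.7 * t) = 1.88 * t by ring, Real.mul_rpow (by norm_num) ht.le, mul_assoc,
        ← Real.rpow_add ht]
      norm_num
    have e3 : (1.88 : ℝ) ^ (-p) ≤ 1.88 ^ (-2 : ℝ) :=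
      Real.rpow_le_rpow_of_exponent_le (by norm_num) (by linarith [hp.1])
    have e4 : (1.88 : ℝ) ^ (-2 : ℝ) = 1 / 3.5344 := by
      rw [Real.rpow_neg (by norm_num)]
      norm_num
    calc _ = 4.95 * ((0.4 * ε) ^ (-p) * (γ₀ * (x ^ 2 * x ^ (-p)))) := by ring
      _ = 4.95 * (1.88 ^ (-p) * t) := by rw [e1, ← h, e2]
      _ ≤ 4.95 * (1 / 3.5344 * t) := by rw [← e4]; gcongr
      _ ≤ 0.3 * ε := by rw [hε]; nlinarith
  -- The Gaussian third moment is of order `x⁻¹ / ε³`, and `x⁻¹ ≤ ε⁴ / 170` makes it of order `ε`.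
  have T2 : x ^ 2 * (9 / 4 * (2.3 * (1 / x ^ 2 * (1 / x))) / (0.4 * ε) ^ 3) ≤ 0.5 * ε := by
    calc _ = 5.175 / (0.064 * ε ^ 3) * x⁻¹ := by field_simp; norm_num
      _ ≤ 5.175 / (0.064 * ε ^ 3) * (ε ^ 4 / 170) := by gcongr
      _ = 5.175 / (0.064 * 170) * ε := by field_simp
      _ ≤ 0.5 * ε := by gcongr; norm_num
  have T3 : x ^ 2 * (2 * Real.exp (-((0.08 * ε) ^ 2 * x ^ 2 / 2))) ≤ 0.1 * ε := by
    have h1 := exp_neg_le ((0.08 * ε) ^ 2 * x ^ 2 / 2) (by positivity)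
    calc _ ≤ x ^ 2 * (2 * (24 / ((0.08 * ε) ^ 2 * x ^ 2 / 2) ^ 4)) := by gcongr
      _ = 768 / (0.08 ^ 8 * ε ^ 8) * x⁻¹ ^ 6 := by field_simp; norm_num
      _ ≤ 768 / (0.08 ^ 8 * ε ^ 8) * (ε ^ 4 / 170) ^ 6 := by gcongr
      _ = 768 / (0.08 ^ 8 * 170 ^ 6) * ε ^ 15 * ε := by field_simp
      _ ≤ 768 / (0.08 ^ 8 * 170 ^ 6) * 1 * ε := by
          gcongr
          exact pow_le_one₀ hε0.le ht1.le
      _ ≤ 0.1 * ε := by gcongr; norm_num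
  rw [mul_add]
  linarith

lemma rateBound_mono {p : ℝ} (hp : 2 ≤ p) (n : ℕ) {a b : ℝ≥0∞} (h : a ≤ b) :
    rateBound p n a ≤ rateBound p n b := by
  unfold rateBound
  gcongr

lemma rateBound_top {p : ℝ} (hp : 2 ≤ p) {n : ℕ} (hn : 1 ≤ n) : rateBound p n ⊤ = ⊤ := by
  unfold rateBound
  have hn' : (n : ℝ≥0∞) ≠ 0 := by exact_mod_cast (by omega : n ≠ 0)
  rw [ENNReal.top_rpow_of_pos (by positivity), ENNReal.mul_top (by norm_num), ENNReal.top_div_of_ne_top]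
  exact (ENNReal.rpow_lt_top_of_nonneg (by apply div_nonneg <;> linarith) (ENNReal.natCast_ne_top n)).ne

lemma rateBound_ofReal {p : ℝ} (hp : 2 ≤ p) {n : ℕ} (hn : 1 ≤ n) {γ₀ : ℝ} (hγ : 0 < γ₀) :
    rateBound p n (ENNReal.ofReal γ₀) =
      ENNReal.ofReal (4.7 * (γ₀ ^ (1 / (p + 1)) / √(n : ℝ) ^ ((p - 2) / (p + 1)))) := by
  have hn0 : (0 : ℝ) < n := by exact_mod_cast hn
  have e : √(n : ℝ) ^ ((p - 2) / (p + 1)) = (n : ℝ) ^ ((p - 2) / (2 * p + 2)) := by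
    rw [Real.sqrt_eq_rpow, ← Real.rpow_mul hn0.le]
    congr 1
    field_simp
  unfold rateBound
  rw [e, ENNReal.ofReal_mul (by norm_num), ENNReal.ofReal_div_of_pos (by positivity),
    ENNReal.ofReal_rpow_of_pos hγ, ← ENNReal.ofReal_natCast, ENNReal.ofReal_rpow_of_pos hn0,
    mul_div_assoc]

/-! ### The bound under sublinear expectations -/

namespace SublinearExpectation

variable {Ω Ω' : Type*} [MeasurableSpace Ω'] {P' : Measure Ω'} [IsProbabilityMeasure P']
  {B : Ω' → C(unitInterval, ℝ)} {𝔼 : SublinearExpectation Ω} {X₀ : Ω → ℝ} {X : ℕ → Ω → ℝ}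

/-- If the truncated moment is finite, the rate is an admissible `ε` in the definition of the
Prokhorov distance. -/
theorem exists_rate (hB : IsWienerProcess P' B) (h : 𝔼.NonDegenerate X₀)
    (hX : 𝔼.IIDWith X₀ X) {n : ℕ} (hn : 1 ≤ n) {p : ℝ} (hp : p ∈ Set.Icc (2 : ℝ) 3)
    (hfin : 𝔼.gammaTrunc X₀ p √(n : ℝ) ≠ ⊤) :
    ∃ ε : ℝ, 0 < ε ∧ ENNReal.ofReal ε = rateBound p n (𝔼.gammaTrunc X₀ p √(n : ℝ)) ∧
      ∀ D : Set C(unitInterval, ℝ), 𝔼.prokhorovDefect X₀ X n P' B D ε ≤ ε := by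
  have hn0 : (0 : ℝ) < n := by exact_mod_cast hn
  have hx : 1 ≤ √(n : ℝ) := Real.one_le_sqrt.2 (by exact_mod_cast hn)
  have hlow := le_gammaTrunc h hp hx
  set γ₀ := (𝔼.gammaTrunc X₀ p √(n : ℝ)).toReal with hγ₀
  have hγ : 0.35 ≤ γ₀ := (ENNReal.ofReal_le_iff_le_toReal hfin).1 hlow
  have hγ0 : 0 < γ₀ := by linarith
  have hofReal : ENNReal.ofReal γ₀ = 𝔼.gammaTrunc X₀ p √(n : ℝ) := ENNReal.ofReal_toReal hfin
  set x := √(n : ℝ) with hxdef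
  have hx0 : 0 < x := one_pos.trans_le hx
  have hx2 : x ^ 2 = n := Real.sq_sqrt hn0.le
  set t := γ₀ ^ (1 / (p + 1)) / x ^ ((p - 2) / (p + 1)) with ht
  have hp1 : 0 < p + 1 := by linarith [hp.1]
  have ht0 : 0 < t := by positivity
  refine ⟨4.7 * t, by positivity, ?_, fun D => ?_⟩
  · rw [← hofReal, rateBound_ofReal hp.1 hn hγ0]
  rcases le_or_gt 1 (4.7 * t) with h1 | h1
  · exact (prokhorovDefect_le_one n D _).trans h1
  have htp : t ^ (p + 1) = γ₀ * x ^ (2 - p) := by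
    rw [ht, Real.div_rpow (by positivity) (by positivity), ← Real.rpow_mul hγ0.le,
      ← Real.rpow_mul hx0.le, div_mul_cancel₀ _ hp1.ne', div_mul_cancel₀ _ hp1.ne', Real.rpow_one,
      show 2 - p = -(p - 2) by ring, Real.rpow_neg hx0.le, div_eq_mul_inv]
  -- The factor `1.1` provides the strict inequality needed to select a majorant in `H`.
  have hΓ : 𝔼.gammaTrunc X₀ p x < ENNReal.ofReal (1.1 * γ₀) := by
    rw [← hofReal]
    exact (ENNReal.ofReal_lt_ofReal_iff (by positivity)).2 (by linarith)
  -- The neighbourhood radius used is `2 * (0.4 + 0.01 + 0.08) = 0.98` times `ε`. Most of it goes to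
  -- `δ`, on which the errors from exchanging steps depend.
  have key := prokhorovDefect_le hB h hX hn hp hΓ (δ := 0.4 * (4.7 * t)) (κ := 0.01 * (4.7 * t))
    (a := 0.08 * (4.7 * t)) (ε := 4.7 * t) (by positivity) (by linarith) (by positivity)
    (by positivity) (by linarith) D
  refine key.trans ?_
  rw [← hxdef, ← hx2]
  exact error_le_rate hp hx ht0 h1 hγ htp

theorem prokhorovDist_le (hB : IsWienerProcess P' B) (h : 𝔼.NonDegenerate X₀)
    (hX : 𝔼.IIDWith X₀ X) {n : ℕ} (hn : 1 ≤ n) {p : ℝ} (hp : p ∈ Set.Icc (2 : ℝ) 3) :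
    ENNReal.ofReal (𝔼.prokhorovDist X₀ X n P' B) ≤
      rateBound p n (𝔼.gammaTrunc X₀ p √(n : ℝ)) := by
  by_cases hfin : 𝔼.gammaTrunc X₀ p √(n : ℝ) = ⊤
  · rw [hfin, rateBound_top hp.1 hn]
    exact le_top
  · obtain ⟨ε, hε, hε', hD⟩ := exists_rate hB h hX hn hp hfin
    rw [← hε']
    exact ENNReal.ofReal_le_ofReal (csInf_le ⟨0, fun _ hr => hr.1.le⟩ ⟨hε, hD⟩)

lemma gammaTrunc_le_gamma (p C : ℝ) : 𝔼.gammaTrunc X₀ p C ≤ 𝔼.gamma X₀ p :=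
  iSup₂_mono fun _ _ => iInf_mono fun _ => iInf_mono fun _ =>
    iInf_mono' fun h => ⟨fun ω => (min_le_left _ _).trans (h ω), le_rfl⟩

end SublinearExpectation

/-! ### The classical case as a linear expectation -/

section Classical

variable {Ω : Type*} [MeasurableSpace Ω] (P : Measure Ω)

/-- The classical expectation on the integrable functions, as a sublinear expectation. -/
noncomputable def classicalExpectation [IsProbabilityMeasure P] : SublinearExpectation Ω where
  H :=
    { carrier := {f | Integrable f P}
      add_mem' := fun hf hg => hf.add hg
      zero_mem' := integrable_zero _ _ _
      smul_mem' := fun c _ hf => hf.smul c }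
  E f := ∫ ω, f ω ∂P
  const_mem c := integrable_const c
  mono _ hX _ hY h := integral_mono hX hY h
  const c := by simp
  subadd _ hX _ hY := (integral_add hX hY).le
  pos_homog _ _ c _ := integral_const_mul c _

variable {P}

lemma integrable_boundedContinuous_comp [IsProbabilityMeasure P] {α : Type*} [TopologicalSpace α]
    [MeasurableSpace α] [OpensMeasurableSpace α] {f : Ω → α} (hf : AEMeasurable f P)
    (ψ : α →ᵇ ℝ) : Integrable (fun ω => ψ (f ω)) P :=
  Integrable.of_bound (ψ.continuous.measurable.comp_aemeasurable hf).aestronglyMeasurable ‖ψ‖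
    (ae_of_all _ fun _ => ψ.norm_coe_le_norm _)

lemma indepTo_classicalExpectation [IsProbabilityMeasure P] {α β : Type*} [TopologicalSpace α]
    [TopologicalSpace β] [MeasurableSpace α] [MeasurableSpace β] [BorelSpace α] [BorelSpace β]
    [SecondCountableTopology α] [SecondCountableTopology β] {f : Ω → α} {g : Ω → β}
    (hf : AEMeasurable f P) (hg : AEMeasurable g P) (hfg : IndepFun f g P) :
    (classicalExpectation P).IndepTo g f := by
  intro ψ
  have := Measure.isProbabilityMeasure_map hf
  have := Measure.isProbabilityMeasure_map hg
  have hψ : Integrable ψ ((P.map f).prod (P.map g)) :=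
    integrable_boundedContinuous_comp aemeasurable_id ψ
  have hin : ∀ x, ∫ y, ψ (x, y) ∂(P.map g) = ∫ ω, ψ (x, g ω) ∂P := fun x =>
    integral_map hg (ψ.continuous.measurable.comp measurable_prodMk_left).aestronglyMeasurable
  have hint := hψ.integral_prod_left
  simp only [hin] at hint
  refine ⟨integrable_boundedContinuous_comp (hf.prodMk hg) ψ, hint.comp_aemeasurable hf, ?_⟩
  calc ∫ ω, ψ (f ω, g ω) ∂P = ∫ z, ψ z ∂(P.map fun ω => (f ω, g ω)) :=
        (integral_map (hf.prodMk hg) ψ.continuous.measurable.aestronglyMeasurable).symm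
    _ = ∫ x, ∫ y, ψ (x, y) ∂(P.map g) ∂(P.map f) := by
        rw [(indepFun_iff_map_prod_eq_prod_map_map hf hg).1 hfg, integral_prod _ hψ]
    _ = ∫ ω, ∫ ω', ψ (f ω, g ω') ∂P ∂P := by
        simp only [hin]
        exact integral_map hf hint.aestronglyMeasurable

lemma indepFun_firstVars {X : ℕ → Ω → ℝ} (hX : iIndepFun X P) (hm : ∀ i, AEMeasurable (X i) P)
    (k : ℕ) : IndepFun (firstVars X k) (X k) P := by
  have h := hX.indepFun_finset₀ (Finset.range k) {k} (by simp) hm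
  have h1 : Measurable fun (z : Finset.range k → ℝ) (j : Fin k) =>
      z ⟨j, Finset.mem_range.2 j.2⟩ := by fun_prop
  have h2 : Measurable fun z : ({k} : Finset ℕ) → ℝ => z ⟨k, Finset.mem_singleton_self k⟩ := by
    fun_prop
  exact h.comp h1 h2

variable [IsProbabilityMeasure P] {X : ℕ → Ω → ℝ}

lemma iidWith_classicalExpectation (hX : iIndepFun X P)
    (hid : ∀ i, IdentDistrib (X i) (X 0) P P) : (classicalExpectation P).IIDWith (X 0) X := by
  have hm : ∀ i, AEMeasurable (X i) P := fun i => (hid i).aemeasurable_fst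
  exact ⟨fun i _ => indepTo_classicalExpectation (aemeasurable_pi_lambda _ fun j => hm j) (hm i)
      (indepFun_firstVars hX hm i),
    fun i ψ => ⟨integrable_boundedContinuous_comp (hm i) ψ,
      integrable_boundedContinuous_comp (hm 0) ψ,
      ((hid i).comp ψ.continuous.measurable).integral_eq⟩⟩

lemma meanSet_classicalExpectation (Y : Ω → ℝ) :
    (classicalExpectation P).meanSet Y = {∫ ω, Y ω ∂P} := by
  have h : (classicalExpectation P).lowerMean Y = ∫ ω, Y ω ∂P :=
    neg_eq_iff_eq_neg.2 (integral_neg Y)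
  rw [SublinearExpectation.meanSet, h]
  exact Set.Icc_self _

lemma upperSD_classicalExpectation {Y : Ω → ℝ} (hY : AEMeasurable Y P) :
    (classicalExpectation P).upperSD Y (∫ ω, Y ω ∂P) = √(Var[Y; P]) := by
  rw [variance_eq_integral hY]
  rfl

lemma lowerSD_classicalExpectation {Y : Ω → ℝ} (hY : AEMeasurable Y P) :
    (classicalExpectation P).lowerSD Y (∫ ω, Y ω ∂P) = √(Var[Y; P]) := by
  rw [variance_eq_integral hY]
  exact congrArg Real.sqrt (neg_eq_iff_eq_neg.2 (integral_neg _))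

lemma nonDegenerate_classicalExpectation {Y : Ω → ℝ} (hY : MemLp Y 2 P) (hvar : 0 < Var[Y; P]) :
    (classicalExpectation P).NonDegenerate Y := by
  refine ⟨hY.integrable one_le_two, hY.integrable_sq, ?_⟩
  rw [meanSet_classicalExpectation, Set.image_singleton, csInf_singleton,
    lowerSD_classicalExpectation hY.aemeasurable]
  exact Real.sqrt_pos.2 hvar

/-- For a linear expectation lower and upper means coincide, and so do lower and upper standard
deviations about the mean. Standardization is the only control. -/
lemma admissible_classicalExpectation_iff {Y : Ω → ℝ} (hY : AEMeasurable Y P) {n : ℕ}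
    {m s : (i : Fin n) → (Fin (i : ℕ) → ℝ) → ℝ} :
    (classicalExpectation P).Admissible Y n m s ↔
      (∀ i x, m i x = ∫ ω, Y ω ∂P) ∧ ∀ i x, s i x = √(Var[Y; P]) := by
  constructor
  · intro h
    have hm : ∀ i x, m i x = ∫ ω, Y ω ∂P := fun i x => by
      simpa [meanSet_classicalExpectation] using ((h i).2.2 x).1
    refine ⟨hm, fun i x => ?_⟩
    have := ((h i).2.2 x).2
    rwa [hm, lowerSD_classicalExpectation hY, upperSD_classicalExpectation hY, Set.Icc_self] at this
  · rintro ⟨hm, hs⟩ i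
    have e1 : m i = fun _ => ∫ ω, Y ω ∂P := funext (hm i)
    have e2 : s i = fun _ => √(Var[Y; P]) := funext (hs i)
    rw [e1, e2]
    refine ⟨continuous_const, continuous_const, fun x => ?_⟩
    rw [meanSet_classicalExpectation, lowerSD_classicalExpectation hY,
      upperSD_classicalExpectation hY, Set.Icc_self]
    exact ⟨rfl, rfl⟩

lemma controlledLine_eq_classicalLine (hid : ∀ i, IdentDistrib (X i) (X 0) P P) {n : ℕ}
    {m s : (i : Fin n) → (Fin (i : ℕ) → ℝ) → ℝ}
    (h : (classicalExpectation P).Admissible (X 0) n m s) (ω : Ω) :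
    controlledLine X n m s ω = classicalLine P X n ω := by
  obtain ⟨hm, hs⟩ := (admissible_classicalExpectation_iff (hid 0).aemeasurable_fst).1 h
  simp only [controlledLine, classicalLine, normalized, hm, hs, (hid _).integral_eq,
    (hid _).variance_eq]

/-- Markov's inequality for any competitor `ψ`; since `P` is an outer measure on all sets, no
measurability of `A` is needed. -/
lemma measureReal_le_upperProb (n : ℕ) (A : Set Ω) :
    P.real A ≤ (classicalExpectation P).upperProb X n A := by
  refine le_csInf ⟨1, fun _ => 1, (classicalExpectation P).const_mem 1,
    fun ω => Set.indicator_le_self' (fun _ _ => zero_le_one) ω,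
    ((classicalExpectation P).const 1).symm⟩ ?_
  rintro r ⟨ψ, hψ, hA, rfl⟩
  have h0 : ∀ ω, 0 ≤ ψ (firstVars X n ω) := fun ω =>
    (Set.indicator_nonneg (fun _ _ => zero_le_one) ω).trans (hA ω)
  have hsub : A ⊆ {ω | 1 ≤ ψ (firstVars X n ω)} := fun ω hω => by
    simpa [Set.indicator_of_mem hω] using hA ω
  calc P.real A ≤ 1 * P.real {ω | 1 ≤ ψ (firstVars X n ω)} := by
        rw [one_mul]; exact measureReal_mono hsub
    _ ≤ ∫ ω, ψ (firstVars X n ω) ∂P := mul_meas_ge_le_integral_of_nonneg (ae_of_all _ h0) hψ 1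

lemma sub_le_prokhorovDefect (hid : ∀ i, IdentDistrib (X i) (X 0) P P) (n : ℕ) {Ω' : Type*}
    [MeasurableSpace Ω'] (P' : Measure Ω') (B : Ω' → C(unitInterval, ℝ))
    (D : Set C(unitInterval, ℝ)) (ε : ℝ) :
    P.real {ω | classicalLine P X n ω ∈ D} - P'.real {ω | B ω ∈ Metric.thickening ε D} ≤
      (classicalExpectation P).prokhorovDefect (X 0) X n P' B D ε := by
  unfold SublinearExpectation.prokhorovDefect
  refine sub_le_sub_right ?_ _
  refine le_csInf ⟨_, fun _ _ => ∫ ω, X 0 ω ∂P, fun _ _ => √(Var[X 0; P]),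
    (admissible_classicalExpectation_iff (hid 0).aemeasurable_fst).2
      ⟨fun _ _ => rfl, fun _ _ => rfl⟩, rfl⟩ ?_
  rintro r ⟨m, s, hms, rfl⟩
  simp only [controlledLine_eq_classicalLine hid hms]
  exact measureReal_le_upperProb n _

/-- The truncation bounds the integrand by a multiple of the squared variable, so finite variance
suffices for integrability and no `p`-th moment is assumed. The integrand is then its own majorant
in `H`. -/
lemma gammaTrunc_classicalExpectation_le {Y : Ω → ℝ} (hY : MemLp Y 2 P) {p C : ℝ}
    (hC : 0 ≤ C) :
    (classicalExpectation P).gammaTrunc Y p C ≤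
      ENNReal.ofReal (∫ ω, min (|normalized P Y ω| ^ p) (C ^ (p - 2) * normalized P Y ω ^ 2) ∂P) ∧
    Integrable (fun ω => min (|normalized P Y ω| ^ p) (C ^ (p - 2) * normalized P Y ω ^ 2)) P := by
  have hN : MemLp (normalized P Y) 2 P := by
    have e : normalized P Y = fun ω => (Y ω - ∫ ω, Y ω ∂P) * (√(Var[Y; P]))⁻¹ :=
      funext fun _ => div_eq_mul_inv _ _
    rw [e]
    exact (hY.sub (memLp_const (∫ ω, Y ω ∂P))).mul_const _
  have hC' : 0 ≤ C ^ (p - 2) := Real.rpow_nonneg hC _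
  have hint : Integrable
      (fun ω => min (|normalized P Y ω| ^ p) (C ^ (p - 2) * normalized P Y ω ^ 2)) P := by
    refine (hN.integrable_sq.const_mul (C ^ (p - 2))).mono' ?_ (ae_of_all _ fun ω => ?_)
    · have h1 := hN.aemeasurable
      exact ((h1.abs.pow_const p).min ((h1.pow_const 2).const_mul _)).aestronglyMeasurable
    · rw [Real.norm_of_nonneg (by positivity)]
      exact min_le_right _ _
  refine ⟨iSup₂_le fun μ hμ => ?_, hint⟩
  rw [meanSet_classicalExpectation, Set.mem_singleton_iff] at hμ
  subst hμ
  have hxi : (classicalExpectation P).xiZero Y (∫ ω, Y ω ∂P) = normalized P Y := by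
    ext ω
    rw [SublinearExpectation.xiZero, lowerSD_classicalExpectation hY.aemeasurable, normalized]
  rw [hxi]
  exact iInf₂_le_of_le _ hint (iInf_le_of_le (fun _ => le_rfl) le_rfl)

theorem classicalProkhorovDist_le {Ω' : Type*} [MeasurableSpace Ω'] {P' : Measure Ω'}
    [IsProbabilityMeasure P'] {B : Ω' → C(unitInterval, ℝ)} (hB : IsWienerProcess P' B)
    (hX : iIndepFun X P) (hid : ∀ i, IdentDistrib (X i) (X 0) P P) (h2 : MemLp (X 0) 2 P)
    (hvar : 0 < Var[X 0; P]) {n : ℕ} (hn : 1 ≤ n) {p : ℝ} (hp : p ∈ Set.Icc (2 : ℝ) 3) :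
    ENNReal.ofReal (classicalProkhorovDist P (classicalLine P X n) P' B) ≤
      rateBound p n (∫⁻ ω, ENNReal.ofReal (min (|normalized P (X 0) ω| ^ p)
        (√(n : ℝ) ^ (p - 2) * normalized P (X 0) ω ^ 2)) ∂P) := by
  obtain ⟨hγ, hint⟩ := gammaTrunc_classicalExpectation_le h2
    (Real.sqrt_nonneg (n : ℝ)) (p := p)
  obtain ⟨ε, hε, hε', hD⟩ := SublinearExpectation.exists_rate hB
    (nonDegenerate_classicalExpectation h2 hvar) (iidWith_classicalExpectation hX hid) hn hp
    (hγ.trans_lt ENNReal.ofReal_lt_top).ne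
  rw [← ofReal_integral_eq_lintegral_ofReal hint (ae_of_all _ fun ω => by positivity)]
  refine le_trans ?_ (rateBound_mono hp.1 n hγ)
  rw [← hε']
  exact ENNReal.ofReal_le_ofReal (csInf_le ⟨0, fun _ hr => hr.1.le⟩
    ⟨hε, fun D _ => (sub_le_prokhorovDefect hid n P' B D ε).trans (hD D)⟩)

end Classical

theorem corollary2p1 {Ω Ω₁ Ω' : Type*} [MeasurableSpace Ω₁] [MeasurableSpace Ω']
    (P' : Measure Ω') [IsProbabilityMeasure P'] (B : Ω' → C(unitInterval, ℝ))
    (hB : IsWienerProcess P' B) (n : ℕ) (hn : 1 ≤ n) (p : ℝ) (hp : p ∈ Set.Icc (2 : ℝ) 3) :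
    -- sublinear expectations
    (∀ (𝔼 : SublinearExpectation Ω) (X₀ : Ω → ℝ) (X : ℕ → Ω → ℝ),
      𝔼.NonDegenerate X₀ → 𝔼.IIDWith X₀ X →
        ENNReal.ofReal (𝔼.prokhorovDist X₀ X n P' B)
            ≤ rateBound p n (𝔼.gammaTrunc X₀ p √(n : ℝ)) ∧
          rateBound p n (𝔼.gammaTrunc X₀ p √(n : ℝ)) ≤ rateBound p n (𝔼.gamma X₀ p)) ∧
    -- the classical case
    (∀ (P : Measure Ω₁) [IsProbabilityMeasure P] (X : ℕ → Ω₁ → ℝ),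
      iIndepFun X P → (∀ i, IdentDistrib (X i) (X 0) P P) → MemLp (X 0) 2 P →
      0 < Var[X 0; P] →
        ENNReal.ofReal (classicalProkhorovDist P (classicalLine P X n) P' B)
            ≤ rateBound p n (∫⁻ ω, ENNReal.ofReal (min (|normalized P (X 0) ω| ^ p)
                (√(n : ℝ) ^ (p - 2) * normalized P (X 0) ω ^ 2)) ∂P) ∧
          rateBound p n (∫⁻ ω, ENNReal.ofReal (min (|normalized P (X 0) ω| ^ p)
                (√(n : ℝ) ^ (p - 2) * normalized P (X 0) ω ^ 2)) ∂P)
            ≤ rateBound p n (∫⁻ ω, ENNReal.ofReal (min (|normalized P (X 0) ω| ^ p)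
                (√(n : ℝ) * normalized P (X 0) ω ^ 2)) ∂P) ∧
          rateBound p n (∫⁻ ω, ENNReal.ofReal (min (|normalized P (X 0) ω| ^ p)
                (√(n : ℝ) * normalized P (X 0) ω ^ 2)) ∂P)
            ≤ rateBound p n (∫⁻ ω, ENNReal.ofReal (|normalized P (X 0) ω| ^ p) ∂P)) := by
  refine ⟨fun 𝔼 X₀ X h hX => ⟨SublinearExpectation.prokhorovDist_le hB h hX hn hp,
      rateBound_mono hp.1 n (SublinearExpectation.gammaTrunc_le_gamma _ _)⟩,
    fun P _ X hX hid h2 hvar => ⟨classicalProkhorovDist_le hB hX hid h2 hvar hn hp,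
      rateBound_mono hp.1 n (lintegral_mono fun ω => ENNReal.ofReal_le_ofReal ?_),
      rateBound_mono hp.1 n (lintegral_mono fun ω => ENNReal.ofReal_le_ofReal (min_le_left _ _))⟩⟩
  -- Only the middle comparison remains: `p - 2 ≤ 1` and a base of at least `1`.
  have hx : 1 ≤ √(n : ℝ) := Real.one_le_sqrt.2 (by exact_mod_cast hn)
  have hpow : √(n : ℝ) ^ (p - 2) ≤ √(n : ℝ) := by
    simpa using Real.rpow_le_rpow_of_exponent_le hx (show p - 2 ≤ 1 by linarith [hp.2])
  gcongr
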